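/- **Proposition 5.1.** Let $\alpha>0$, $V_0>0$, $\theta\in(0,\frac{\pi}{2})$, let $\Sigma=\{z=\cot\theta\,\sqrt{x^2+y^2}\}\subset\mathbb{R}^3$ be the circular conical surface of opening angle $2\theta$, let $\Omega_{\mathrm{int}}=\{z>\cot\theta\,\sqrt{x^2+y^2}\}$ be its convex side and $V=V_0\,\chi_{\Omega_{\mathrm{int}}}$. Put $\mu=-\frac{(\alpha^2-V_0)^2}{4\alpha^2}$ if $V_0<\alpha^2$ and $\mu=0$ otherwise. For $\psi\in H^1(\mathbb{R}^3)$ and $m\in\mathbb{Z}$ let $\omega_m$ be the reduced component of $\psi$ in cylindrical coordinates, $$\omega_m(r,z)=\frac{\sqrt{2\pi r}}{2\pi}\int_0^{2\pi}\psi(r\cos\varphi,r\sin\varphi,z)\,\mathrm{e}^{-im\varphi}\,\mathrm{d}\varphi,\qquad \psi(r,\varphi,z)=\sum_{m\in\mathbb{Z}}\frac{\omega_m(r,z)}{\sqrt{2\pi r}}\,\mathrm{e}^{im\varphi},$$ on the half-plane $\mathbb{R}^2_+=\{(r,z):r>0\}$, and let $$q_m[\psi]=\|\nabla\omega_m\|^2_{L^2(\mathbb{R}^2_+)}+\int_{\mathbb{R}^2_+}\frac{4m^2-1}{4r^2}|\omega_m|^2\,\mathrm{d}r\,\mathrm{d}z+\int_{\mathbb{R}^2_+}V|\omega_m|^2\,\mathrm{d}r\,\mathrm{d}z-\alpha\,\big\|\omega_m|_{\Gamma_\theta}\big\|^2_{L^2(\Gamma_\theta)},$$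 where $\Gamma_\theta$ is the half-line $z=r\cot\theta$, $r>0$, with its arc length, and $\omega_m|_{\Gamma_\theta}$ is the trace. Then for every nonzero $m\in\mathbb{Z}$ and every $\psi\in H^1(\mathbb{R}^3)$ one has $\omega_m\in H^1(\mathbb{R}^2_+)$ and $\omega_m/r\in L^2(\mathbb{R}^2_+)$, the trace exists in $L^2(\Gamma_\theta)$ (so all terms of $q_m[\psi]$ are finite), and $$q_m[\psi]\ \ge\ \mu\,\|\omega_m\|^2_{L^2(\mathbb{R}^2_+)}.$$ Moreover, for nonzero $m$ the operator $H^{(m)}$ in $L^2(\mathbb{R}^2_+)$ associated with the form $q_m$ on the domain $\{\omega_m:\psi\in H^1(\mathbb{R}^3)\}$ has empty discrete spectrum (no isolated point of its spectrum is an eigenvalue of finite multiplicity), so that only the component $m=0$ can produce discrete spectrum. -/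

import Mathlib

open MeasureTheory Set Filter Topology
open scoped ComplexConjugate InnerProductSpace

noncomputable section

namespace ConicalSurface

/-! ## Sobolev spaces of first order, through weak derivatives -/

section Sobolev

variable {E : Type*} [NormedAddCommGroup E] [NormedSpace ℝ E] [MeasureSpace E]

/-- `g` is the weak derivative of `f` in the direction `v` on the open set `Ω`. -/
def HasWeakPartial (Ω : Set E) (v : E) (f g : E → ℂ) : Prop :=
  ∀ φ : E → ℝ, ContDiff ℝ (⊤ : ℕ∞) φ → HasCompactSupport φ → tsupport φ ⊆ Ω →
    ∫ x in Ω, (fderiv ℝ φ x v) • f x = -∫ x in Ω, φ x • g x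

/-- `f ∈ H¹(Ω)`: `f` is square integrable and so are its weak partial derivatives in the
directions `b i`, where `b` is the family of coordinate directions. -/
def MemH1 {ι : Type*} (Ω : Set E) (b : ι → E) (f : E → ℂ) : Prop :=
  MemLp f 2 (volume.restrict Ω) ∧
    ∀ i, ∃ g : E → ℂ, MemLp g 2 (volume.restrict Ω) ∧ HasWeakPartial Ω (b i) f g

open Classical in
/-- The square integrable weak partial derivative (unique up to null sets), and `0` if there is
none. -/
def weakPartial (Ω : Set E) (v : E) (f : E → ℂ) : E → ℂ :=
  if h : ∃ g : E → ℂ, MemLp g 2 (volume.restrict Ω) ∧ HasWeakPartial Ω v f g then h.choose else 0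

end Sobolev

/-! ## Geometry of the cone -/

/-- Physical space `ℝ³` with the Cartesian coordinates `x = p 0`, `y = p 1`, `z = p 2`. -/
abbrev Space : Type := EuclideanSpace ℝ (Fin 3)

/-- `ψ ∈ H¹(ℝ³)`. -/
def MemH1Space (ψ : Space → ℂ) : Prop :=
  MemH1 univ (fun i : Fin 3 => (EuclideanSpace.single i 1 : Space)) ψ

/-- The point of `ℝ³` with cylindrical coordinates `r, φ, z`. -/
def cyl (r φ z : ℝ) : Space := !₂[r * Real.cos φ, r * Real.sin φ, z]

/-- The convex ("interior") one of the two regions into which the circular conical surface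
`z = cot θ * √(x² + y²)` divides `ℝ³`. -/
def interiorRegion (θ : ℝ) : Set Space :=
  {p | Real.cot θ * √(p 0 ^ 2 + p 1 ^ 2) < p 2}

/-- The bias `V = V₀ χ` with `χ` the characteristic function of the interior region. -/
def bias (V₀ θ : ℝ) : Space → ℝ := (interiorRegion θ).indicator fun _ => V₀

/-- The half-plane of the coordinates `(r, z)`, `r > 0`. -/
def halfPlane : Set (ℝ × ℝ) := {p | 0 < p.1}

/-- The bias, which does not depend on the azimuth, as a function of `(r, z)`. -/
def biasRZ (V₀ θ : ℝ) (p : ℝ × ℝ) : ℝ := bias V₀ θ (cyl p.1 0 p.2)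

/-- Arc length parametrization, for `s > 0`, of the half-line `z = r cot θ` in the half-plane. -/
def ray (θ s : ℝ) : ℝ × ℝ := (s * Real.sin θ, s * Real.cos θ)

/-- `ω ∈ H¹` of the half-plane. -/
def MemH1HalfPlane (ω : ℝ × ℝ → ℂ) : Prop :=
  MemH1 halfPlane ![((1, 0) : ℝ × ℝ), (0, 1)] ω

/-- Weak derivative with respect to `r` in the half-plane. -/
def dr (ω : ℝ × ℝ → ℂ) : ℝ × ℝ → ℂ := weakPartial halfPlane (1, 0) ω

/-- Weak derivative with respect to `z` in the half-plane. -/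
def dz (ω : ℝ × ℝ → ℂ) : ℝ × ℝ → ℂ := weakPartial halfPlane (0, 1) ω

/-- `τ ∈ L²(0, ∞)`, as a function of the arc length, is the trace of `ω ∈ H¹` of the half-plane on
the half-line: the limit of the restrictions of smooth functions that approximate `ω` in `H¹`. -/
def IsTrace (θ : ℝ) (ω : ℝ × ℝ → ℂ) (τ : ℝ → ℂ) : Prop :=
  MemH1HalfPlane ω ∧ MemLp τ 2 (volume.restrict (Ioi 0)) ∧
    ∃ φ : ℕ → ℝ × ℝ → ℂ,
      (∀ n, ContDiff ℝ (⊤ : ℕ∞) (φ n) ∧ HasCompactSupport (φ n)) ∧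
      Tendsto (fun n => eLpNorm (fun p => φ n p - ω p) 2 (volume.restrict halfPlane))
        atTop (𝓝 0) ∧
      Tendsto (fun n => eLpNorm (fun p => fderiv ℝ (φ n) p (1, 0) - dr ω p) 2
        (volume.restrict halfPlane)) atTop (𝓝 0) ∧
      Tendsto (fun n => eLpNorm (fun p => fderiv ℝ (φ n) p (0, 1) - dz ω p) 2
        (volume.restrict halfPlane)) atTop (𝓝 0) ∧
      Tendsto (fun n => eLpNorm (fun s => φ n (ray θ s) - τ s) 2 (volume.restrict (Ioi 0)))
        atTop (𝓝 0)

open Classical in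
/-- The trace on the half-line (unique up to null sets), and `0` if there is none. -/
def trace (θ : ℝ) (ω : ℝ × ℝ → ℂ) : ℝ → ℂ :=
  if h : ∃ τ, IsTrace θ ω τ then h.choose else 0

/-! ## Partial waves -/

/-- The reduced component `ω_m` in `ψ(r, φ, z) = ∑ₘ ω_m(r, z) / √(2πr) * exp(imφ)`, that is,
`√(2πr)` times the `m`-th Fourier coefficient of `ψ` in the azimuth. -/
def reduced (m : ℤ) (ψ : Space → ℂ) (p : ℝ × ℝ) : ℂ :=
  (√(2 * Real.pi * p.1) / (2 * Real.pi) : ℝ) *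
    ∫ φ in (0 : ℝ)..(2 * Real.pi), ψ (cyl p.1 φ p.2) * Complex.exp (-(Complex.I * m * φ))

/-- The partial-wave form `q_m`, as a function of the reduced component. -/
def qm (α V₀ θ : ℝ) (m : ℤ) (ω : ℝ × ℝ → ℂ) : ℝ :=
  (∫ p in halfPlane, (‖dr ω p‖ ^ 2 + ‖dz ω p‖ ^ 2))
    + (∫ p in halfPlane, (4 * (m : ℝ) ^ 2 - 1) / (4 * p.1 ^ 2) * ‖ω p‖ ^ 2)
    + (∫ p in halfPlane, biasRZ V₀ θ p * ‖ω p‖ ^ 2)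
    - α * ∫ s in Ioi (0 : ℝ), ‖trace θ ω s‖ ^ 2

/-- The sesquilinear form of `qm`, conjugate linear in the first argument. -/
def qmSesq (α V₀ θ : ℝ) (m : ℤ) (v ω : ℝ × ℝ → ℂ) : ℂ :=
  (∫ p in halfPlane, (conj (dr v p) * dr ω p + conj (dz v p) * dz ω p))
    + (∫ p in halfPlane, ((4 * (m : ℝ) ^ 2 - 1) / (4 * p.1 ^ 2) : ℝ) * (conj (v p) * ω p))
    + (∫ p in halfPlane, (biasRZ V₀ θ p : ℂ) * (conj (v p) * ω p))
    - α * ∫ s in Ioi (0 : ℝ), conj (trace θ v s) * trace θ ω s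

theorem qmSesq_self (α V₀ θ : ℝ) (m : ℤ) (ω : ℝ × ℝ → ℂ) :
    qmSesq α V₀ θ m ω ω = (qm α V₀ θ m ω : ℂ) := by
  have h : ∀ c : ℂ, conj c * c = ((‖c‖ ^ 2 : ℝ) : ℂ) := fun c => by
    rw [Complex.conj_mul']; push_cast; rfl
  simp only [qmSesq, qm, h, ← Complex.ofReal_mul, ← Complex.ofReal_add, integral_complex_ofReal,
    ← Complex.ofReal_sub]

/-- The bottom `μ` of the essential spectrum: the eigenvalue
`-(α² - V₀)² / (4α²)` of the transverse operator if `V₀ < α²`, and `0` otherwise. -/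
def threshold (α V₀ : ℝ) : ℝ :=
  if V₀ < α ^ 2 then -(α ^ 2 - V₀) ^ 2 / (4 * α ^ 2) else 0

/-! ## Operators associated with forms and their discrete spectrum -/

section Spectrum

variable {H : Type*} [NormedAddCommGroup H] [InnerProductSpace ℂ H]

/-- The operator `A` associated with the form `a` with domain `D`: here `FormOp D a u f` says that
`u` lies in the domain of `A` and `A u = f`. -/
def FormOp (D : Set H) (a : H → H → ℂ) (u f : H) : Prop :=
  u ∈ D ∧ ∀ v ∈ D, a v u = ⟪v, f⟫_ℂ

/-- The spectrum of a self-adjoint operator, given by its graph: all real `l` for which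
`A - l` does not map the domain of `A` bijectively onto `H`. -/
def opSpectrum (A : H → H → Prop) : Set ℝ :=
  {l | ¬ ∀ f : H, ∃! u : H, A u (f + (l : ℂ) • u)}

/-- The discrete spectrum of a self-adjoint operator, given by its graph: the isolated points
of its spectrum that are eigenvalues of finite multiplicity. -/
def discreteSpectrum (A : H → H → Prop) : Set ℝ :=
  {l | l ∈ opSpectrum A ∧ (∃ ε > 0, ∀ l' ∈ opSpectrum A, |l' - l| < ε → l' = l) ∧
    (∃ u : H, u ≠ 0 ∧ A u ((l : ℂ) • u)) ∧
    FiniteDimensional ℂ (Submodule.span ℂ {u : H | A u ((l : ℂ) • u)})}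

end Spectrum

/-- `L²` of the half-plane. -/
abbrev L2HalfPlane : Type := Lp ℂ 2 (volume.restrict halfPlane)

/-- The domain of `q_m`: the reduced components of the functions in `H¹(ℝ³)`. -/
def formDomain (m : ℤ) : Set L2HalfPlane :=
  {ω | ∃ ψ : Space → ℂ, MemH1Space ψ ∧ ω =ᵐ[volume.restrict halfPlane] reduced m ψ}

/-- The partial-wave operator of angular momentum `m`, as an operator in `L²` of the half-plane:
the one associated with `q_m`. It is used for nonzero `m`, where `q_m` is finite on the whole
of its domain. -/
def partialWaveOp (α V₀ θ : ℝ) (m : ℤ) : L2HalfPlane → L2HalfPlane → Prop :=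
  FormOp (formDomain m) fun v ω => qmSesq α V₀ θ m v ω

end ConicalSurface

end

namespace ConicalSurface

open scoped Convolution

/-! ### Weak derivatives: uniqueness and mollification -/

section Sobolev

/-! For m ≠ 0 the coefficient 4m² - 1 is positive, so the centrifugal term is repulsive and may be
dropped from below. What remains is the Schrödinger form with an attractive δ on a ray. In the
rotated coordinates (s, t), along and across the ray, this form dominates the transverse operator
-d²/dt² + V₀ χ(t > 0) - α δ(t), whose bottom is μ. The bound must hold on each transverse line
separately, which needs ω to vanish at r = 0: extended by zero and rotated, it becomes a function on
the whole plane.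

The vanishing is supplied by ω/r ∈ L². Testing the weak derivatives of ψ with partial waves shows
that im ω/r is the reduced component of the angular derivative of ψ. Hence ω/r is square integrable
when m ≠ 0, and then so is the r-derivative of ω (`admissible_reduced`). Such functions are H¹
limits of smooth functions with compact support inside the open half-plane
(`Admissible.exists_test_tendsto`), so traces exist by a trace inequality, and every estimate is
proved for smooth functions and carried to the limit. The transverse bound
`mul_norm_sq_le_transverse` comes from k|f(0)|² ≤ ∫ |f'|² + k²|f|² on each half-line, with α split
as k₁ + k₂; integration over s gives `Admissible.lower_bound`.

For the spectral part, every eigenvalue is at least μ by the lower bound, so it is enough that the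
whole of [μ, ∞) is spectrum: then no eigenvalue is isolated. For l = μ + k² the approximate
eigenfunction is a long wave packet exp(iks) along the ray (`exists_wavePacket`) times an
approximate transverse ground state (`exists_transverse`), pushed so far from the axis that 1/r² is
negligible. The exact ground state has a corner at t = 0, so it is smoothed, and the residual is
measured only weakly, against the H¹ norm of the other argument of the form
(`exists_approximate_form`).

A weak residual suffices (`discreteSpectrum_eq_empty`): if l were not in the spectrum, the resolvent
R would be symmetric and everywhere defined, hence bounded. By the coercivity in
`Admissible.norm_gradient_le`, the H¹ norm of Ru would then be at most a constant times ‖u‖. Taking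
v = Ru in the weak equation turns its left side into ‖u‖², a contradiction for a small residual.
Closedness of the form plays no role. -/

theorem lintegral_sq_le_of_isProbabilityMeasure {α : Type*} [MeasurableSpace α] (ν : Measure α)
    [IsProbabilityMeasure ν] {h : α → ENNReal} (hh : AEMeasurable h ν) :
    (∫⁻ a, h a ∂ν) ^ 2 ≤ ∫⁻ a, h a ^ 2 ∂ν := by
  have := ENNReal.lintegral_mul_le_Lp_mul_Lq ν Real.HolderConjugate.two_two hh
    (aemeasurable_const (b := (1 : ENNReal)))
  simp only [Pi.mul_apply, mul_one, ENNReal.rpow_two, one_pow, lintegral_const, measure_univ,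
    ENNReal.one_rpow] at this
  calc (∫⁻ a, h a ∂ν) ^ 2 ≤ ((∫⁻ a, h a ^ 2 ∂ν) ^ (1 / 2 : ℝ)) ^ 2 := by gcongr
    _ = _ := by rw [← ENNReal.rpow_natCast, ← ENNReal.rpow_mul]; norm_num

theorem lintegral_enorm_sq {α F : Type*} [MeasurableSpace α] [NormedAddCommGroup F]
    (ν : Measure α) (f : α → F) : eLpNorm f 2 ν ^ 2 = ∫⁻ a, ‖f a‖ₑ ^ 2 ∂ν := by
  have := eLpNorm_nnreal_pow_eq_lintegral (μ := ν) (f := f) (p := 2) (by norm_num)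
  simpa only [ENNReal.coe_ofNat, NNReal.coe_ofNat, ENNReal.rpow_two] using this

variable {E : Type*} [NormedAddCommGroup E] [NormedSpace ℝ E] [MeasureSpace E] [BorelSpace E]
  [FiniteDimensional ℝ E] [(volume : Measure E).IsAddHaarMeasure]

/-- Continuity in the mean: the additive group acts continuously on L² by translations. -/
theorem exists_translation_close {f : E → ℂ} (hf : MemLp f 2 volume) {ε : ENNReal} (hε : 0 < ε) :
    ∃ δ > 0, ∀ y : E, ‖y‖ ≤ δ → eLpNorm (fun x => f (x - y) - f x) 2 volume ≤ ε := by
  have : Fact ((2 : ENNReal) ≠ ⊤) := ⟨by simp⟩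
  have hc : Tendsto (fun y : E => DomAddAct.mk y +ᵥ hf.toLp f) (𝓝 0)
      (𝓝 (DomAddAct.mk (0 : E) +ᵥ hf.toLp f)) := by
    refine Continuous.tendsto ?_ 0
    exact (DomAddAct.continuous_mk).vadd continuous_const
  rw [Lp.tendsto_Lp_iff_tendsto_eLpNorm'] at hc
  have h2 := hc.eventually (ge_mem_nhds hε)
  obtain ⟨δ, hδ, h3⟩ := Metric.eventually_nhds_iff.1 h2
  refine ⟨δ / 2, by positivity, fun y hy => ?_⟩
  -- `DomAddAct.mk y` adds y to the argument, whereas convolution subtracts it.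
  have h4 := h3 (y := -y) (by simp only [dist_zero_right, norm_neg]; linarith)
  refine le_trans (le_of_eq (eLpNorm_congr_ae ?_)) h4
  have e1 : ((DomAddAct.mk (-y) +ᵥ hf.toLp f : Lp ℂ 2 volume) : E → ℂ) =ᵐ[volume]
      fun x => f (x - y) := by
    refine (DomAddAct.vadd_Lp_ae_eq _ _).trans ?_
    have := (measurePreserving_add_left (volume : Measure E) (-y)).quasiMeasurePreserving.ae_eq_comp
      hf.coeFn_toLp
    filter_upwards [this] with x hx
    simp only [Function.comp] at hx ⊢
    simpa [sub_eq_neg_add] using hx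
  have e2 : ((DomAddAct.mk (0 : E) +ᵥ hf.toLp f : Lp ℂ 2 volume) : E → ℂ) =ᵐ[volume] f := by
    simpa using hf.coeFn_toLp
  filter_upwards [e1, e2] with x h1 h2
  simp only [Pi.sub_apply, h1, h2]

/-- The normalized bump is the density of a probability measure ν, so the error is a ν-average of
the differences f(x - y) - f(x). Jensen's inequality for the square followed by Tonelli bounds its
L² norm by the largest translation error over the support of the bump. -/
theorem eLpNorm_convolution_sub_le {f : E → ℂ} (hf : MemLp f 2 volume)
    (b : ContDiffBump (0 : E)) {ε : ENNReal}
    (h : ∀ y : E, ‖y‖ ≤ b.rOut → eLpNorm (fun x => f (x - y) - f x) 2 volume ≤ ε) :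
    eLpNorm (fun x => (b.normed volume ⋆[ContinuousLinearMap.lsmul ℝ ℝ, volume] f) x - f x) 2 volume
      ≤ ε := by
  set ρ := b.normed (volume : Measure E) with hρ
  have hρc : Continuous ρ := b.continuous_normed
  have hρi : Integrable ρ := b.integrable_normed
  set ν : Measure E := volume.withDensity fun y => ENNReal.ofReal (ρ y) with hν
  have hνp : IsProbabilityMeasure ν := ⟨by
    rw [hν, withDensity_apply _ MeasurableSet.univ, Measure.restrict_univ,
      ← ofReal_integral_eq_lintegral_ofReal hρi (ae_of_all _ fun y => b.nonneg_normed y),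
      b.integral_normed, ENNReal.ofReal_one]⟩
  have hac : ν ≪ volume := withDensity_absolutelyContinuous _ _
  have key : ∀ x, ‖(ρ ⋆[ContinuousLinearMap.lsmul ℝ ℝ, volume] f) x - f x‖ₑ
      ≤ ∫⁻ y, ‖f (x - y) - f x‖ₑ ∂ν := by
    intro x
    have e1 : (ρ ⋆[ContinuousLinearMap.lsmul ℝ ℝ, volume] f) x - f x
        = ∫ y, ρ y • (f (x - y) - f x) := by
      simp only [smul_sub]
      rw [integral_sub, integral_smul_const, b.integral_normed, one_smul]
      · rfl
      · have := (b.hasCompactSupport_normed (μ := volume)).convolutionExists_left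
          (ContinuousLinearMap.lsmul ℝ ℝ) hρc (hf.locallyIntegrable one_le_two) x
        exact this
      · exact hρi.smul_const _
    rw [e1]
    refine (enorm_integral_le_lintegral_enorm _).trans (le_of_eq ?_)
    rw [hν, lintegral_withDensity_eq_lintegral_mul₀ (by fun_prop)]
    · refine lintegral_congr fun y => ?_
      rw [enorm_smul, Pi.mul_apply, Real.enorm_eq_ofReal (b.nonneg_normed y)]
    · refine AEStronglyMeasurable.enorm ?_
      refine AEStronglyMeasurable.sub ?_ aestronglyMeasurable_const
      exact hf.1.comp_measurePreserving (Measure.measurePreserving_sub_left volume x)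
  have hm : AEStronglyMeasurable (fun q : E × E => f (q.1 - q.2) - f q.1) (volume.prod volume) := by
    refine AEStronglyMeasurable.sub ?_ ?_
    · exact hf.1.comp_quasiMeasurePreserving (quasiMeasurePreserving_sub volume volume)
    · exact hf.1.comp_quasiMeasurePreserving Measure.quasiMeasurePreserving_fst
  have hm' : AEStronglyMeasurable (fun q : E × E => f (q.1 - q.2) - f q.1) (volume.prod ν) :=
    hm.mono_ac (Measure.AbsolutelyContinuous.rfl.prod hac)
  rw [← ENNReal.pow_le_pow_left_iff two_ne_zero, lintegral_enorm_sq]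
  calc ∫⁻ x, ‖(ρ ⋆[ContinuousLinearMap.lsmul ℝ ℝ, volume] f) x - f x‖ₑ ^ 2
      ≤ ∫⁻ x, ∫⁻ y, ‖f (x - y) - f x‖ₑ ^ 2 ∂ν := by
        refine lintegral_mono fun x => ?_
        refine (pow_le_pow_left₀ zero_le (key x) 2).trans
          (lintegral_sq_le_of_isProbabilityMeasure ν ?_)
        refine AEStronglyMeasurable.enorm ?_
        refine AEStronglyMeasurable.sub ?_ aestronglyMeasurable_const
        exact (hf.1.comp_measurePreserving
          (Measure.measurePreserving_sub_left volume x)).mono_ac hac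
    _ = ∫⁻ y, (∫⁻ x, ‖f (x - y) - f x‖ₑ ^ 2) ∂ν :=
        lintegral_lintegral_swap (hm'.enorm.pow_const 2)
    _ ≤ ∫⁻ y, ε ^ 2 ∂ν := by
        refine lintegral_mono_ae ?_
        rw [hν, ae_withDensity_iff (by fun_prop)]
        refine ae_of_all _ fun y hy => ?_
        rw [← lintegral_enorm_sq]
        gcongr
        refine h y ?_
        have : y ∈ Function.support ρ := fun h0 => hy (by simp [h0])
        rw [hρ, b.support_normed_eq] at this
        simpa using (Metric.mem_ball.1 this).le
    _ = ε ^ 2 := by simp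

/-- The fundamental lemma of the calculus of variations. It is what identifies the derivatives
picked by choice in `weakPartial` with any explicitly computed ones. -/
theorem hasWeakPartial_unique {Ω : Set E} (hΩ : IsOpen Ω) {v : E} {f g g' : E → ℂ}
    (hg : MemLp g 2 (volume.restrict Ω)) (hg' : MemLp g' 2 (volume.restrict Ω))
    (h : HasWeakPartial Ω v f g) (h' : HasWeakPartial Ω v f g') :
    g =ᵐ[volume.restrict Ω] g' := by
  have hl : ∀ {k : E → ℂ}, MemLp k 2 (volume.restrict Ω) → LocallyIntegrableOn k Ω volume := by
    intro k hk
    exact locallyIntegrableOn_of_locallyIntegrable_restrict (hk.locallyIntegrable one_le_two)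
  rw [Filter.EventuallyEq, ae_restrict_iff' hΩ.measurableSet]
  have := hΩ.ae_eq_zero_of_integral_contDiff_smul_eq_zero (f := g - g') (μ := volume)
    ((hl hg).sub (hl hg')) ?_
  · filter_upwards [this] with x hx hxΩ
    exact sub_eq_zero.1 (hx hxΩ)
  intro φ hφ hφc hφs
  have hz : ∀ x, x ∉ Ω → φ x • (g - g') x = 0 := fun x hx => by
    rw [image_eq_zero_of_notMem_tsupport fun h => hx (hφs h), zero_smul]
  rw [← setIntegral_eq_integral_of_forall_compl_eq_zero hz]
  have hi : ∀ {k : E → ℂ}, MemLp k 2 (volume.restrict Ω) →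
      Integrable (fun x => φ x • k x) (volume.restrict Ω) := fun {k} hk =>
    MemLp.integrable_mul (p := 2) (q := 2) 
      ((hφ.continuous.memLp_of_hasCompactSupport hφc).ofReal (K := ℂ)) hk |>.congr
      (ae_of_all _ fun x => by simp)
  simp only [Pi.sub_apply, smul_sub]
  rw [integral_sub (hi hg) (hi hg'), sub_eq_zero]
  have := (h φ hφ hφc hφs).symm.trans (h' φ hφ hφc hφs)
  exact neg_injective this

end Sobolev

/-! ### Approximation by smooth functions -/

section Sobolev

variable {E : Type*} [NormedAddCommGroup E] [NormedSpace ℝ E] [MeasureSpace E] [BorelSpace E]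
  [FiniteDimensional ℝ E] [(volume : Measure E).IsAddHaarMeasure]

/-- Smooth complex functions with compact support contained in `Ω`. -/
structure IsTest (Ω : Set E) (φ : E → ℂ) : Prop where
  smooth : ContDiff ℝ (⊤ : ℕ∞) φ
  compact : HasCompactSupport φ
  support : tsupport φ ⊆ Ω

theorem memLp_smul_cutoff {Ω : Set E} (hΩ : IsOpen Ω) {χ : E → ℝ} (hχ : Continuous χ)
    (hχc : HasCompactSupport χ) (hχs : tsupport χ ⊆ Ω) {f : E → ℂ}
    (hf : MemLp f 2 (volume.restrict Ω)) : MemLp (fun x => χ x • f x) 2 volume := by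
  have h1 := (memLp_indicator_iff_restrict hΩ.measurableSet).2 hf
  obtain ⟨C, hC⟩ := hχ.bounded_above_of_compact_support hχc
  have h2 : MemLp (fun x => χ x • Ω.indicator f x) 2 volume :=
    h1.of_le_mul (c := C) (hχ.aestronglyMeasurable.smul h1.1) (ae_of_all _ fun x => by
      rw [norm_smul]; exact mul_le_mul_of_nonneg_right (hC x) (norm_nonneg _))
  refine h2.ae_eq (ae_of_all _ fun x => ?_)
  · by_cases hx : x ∈ Ω
    · simp [hx]
    · simp [image_eq_zero_of_notMem_tsupport fun h => hx (hχs h)]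

theorem integrable_smul_of_memLp {ν : Measure E} [IsFiniteMeasureOnCompacts ν] {φ : E → ℝ}
    (hφ : Continuous φ) (hφc : HasCompactSupport φ) {f : E → ℂ} (hf : MemLp f 2 ν) :
    Integrable (fun x => φ x • f x) ν :=
  (hf.locallyIntegrable one_le_two).integrable_smul_left_of_hasCompactSupport hφ hφc

/-- The product rule, obtained by testing the weak derivative on Ω with φχ. Since χ is supported
inside Ω, the result holds on the whole space, where mollification is available. -/
theorem hasWeakPartial_cutoff {Ω : Set E} {v : E} {f g : E → ℂ}
    (hf : MemLp f 2 (volume.restrict Ω)) (hg : MemLp g 2 (volume.restrict Ω))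
    (h : HasWeakPartial Ω v f g) {χ : E → ℝ} (hχ : ContDiff ℝ (⊤ : ℕ∞) χ)
    (hχc : HasCompactSupport χ) (hχs : tsupport χ ⊆ Ω) :
    HasWeakPartial univ v (fun x => χ x • f x) (fun x => χ x • g x + fderiv ℝ χ x v • f x) := by
  intro φ hφ hφc _
  have hd : ∀ {χ : E → ℝ}, ContDiff ℝ (⊤ : ℕ∞) χ → Differentiable ℝ χ := fun h =>
    h.differentiable (by simp)
  have hdc : ∀ {χ : E → ℝ}, ContDiff ℝ (⊤ : ℕ∞) χ → Continuous fun x => fderiv ℝ χ x v :=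
    fun h => (h.continuous_fderiv (by simp)).clm_apply continuous_const
  have hz : ∀ x, x ∉ Ω → χ x = 0 := fun x hx =>
    image_eq_zero_of_notMem_tsupport fun h => hx (hχs h)
  have hz' : ∀ x, x ∉ Ω → fderiv ℝ χ x v = 0 := fun x hx => by
    rw [image_eq_zero_of_notMem_tsupport (f := fderiv ℝ χ)
      fun h => hx (hχs (tsupport_fderiv_subset ℝ h)), zero_apply]
  have hD : ∀ x, fderiv ℝ (fun y => φ y * χ y) x v
      = φ x * fderiv ℝ χ x v + χ x * fderiv ℝ φ x v := fun x => by
    rw [fderiv_fun_mul (hd hφ x) (hd hχ x)]; simp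
  have key := h (fun y => φ y * χ y) (hφ.mul hχ) (hφc.mul_right)
    ((tsupport_mul_subset_right).trans hχs)
  simp only [hD] at key
  rw [Measure.restrict_univ]
  rw [← setIntegral_eq_integral_of_forall_compl_eq_zero (s := Ω)
    (f := fun x => fderiv ℝ φ x v • χ x • f x) (fun x hx => by simp [hz x hx]),
    ← setIntegral_eq_integral_of_forall_compl_eq_zero (s := Ω)
    (f := fun x => φ x • (χ x • g x + fderiv ℝ χ x v • f x))
    (fun x hx => by simp [hz x hx, hz' x hx])]
  have i1 : Integrable (fun x => (φ x * fderiv ℝ χ x v) • f x) (volume.restrict Ω) :=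
    integrable_smul_of_memLp (hφ.continuous.mul (hdc hχ)) hφc.mul_right hf
  have i2 : Integrable (fun x => (χ x * fderiv ℝ φ x v) • f x) (volume.restrict Ω) :=
    integrable_smul_of_memLp (hχ.continuous.mul (hdc hφ)) hχc.mul_right hf
  have i3 : Integrable (fun x => (φ x * χ x) • g x) (volume.restrict Ω) :=
    integrable_smul_of_memLp (hφ.continuous.mul hχ.continuous) hφc.mul_right hg
  simp only [add_smul] at key
  rw [integral_add i1 i2] at key
  have e1 : ∀ x, fderiv ℝ φ x v • χ x • f x = (χ x * fderiv ℝ φ x v) • f x := fun x => by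
    rw [smul_smul, mul_comm]
  have e2 : ∀ x, φ x • (χ x • g x + fderiv ℝ χ x v • f x)
      = (φ x * χ x) • g x + (φ x * fderiv ℝ χ x v) • f x := fun x => by
    rw [smul_add, smul_smul, smul_smul]
  simp only [e1, e2]
  rw [integral_add i3 i1]
  linear_combination key

/-- The derivative falls on ρ, and y ↦ ρ(x - y) is itself a test function; its inner sign cancels
the sign of the weak derivative. -/
theorem fderiv_convolution_of_hasWeakPartial {v : E} {F G : E → ℂ} (hF : MemLp F 2 volume)
    (h : HasWeakPartial univ v F G) {ρ : E → ℝ} (hρ : ContDiff ℝ (⊤ : ℕ∞) ρ)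
    (hρc : HasCompactSupport ρ) (x : E) :
    fderiv ℝ (ρ ⋆[ContinuousLinearMap.lsmul ℝ ℝ, volume] F) x v
      = (ρ ⋆[ContinuousLinearMap.lsmul ℝ ℝ, volume] G) x := by
  have hl := hF.locallyIntegrable one_le_two
  have h1 : ContDiff ℝ 1 ρ := hρ.of_le (by exact_mod_cast le_top)
  rw [(hρc.hasFDerivAt_convolution_left (ContinuousLinearMap.lsmul ℝ ℝ) h1 hl x).fderiv]
  have hex := (hρc.fderiv ℝ).convolutionExists_left
    (ContinuousLinearMap.precompL E (ContinuousLinearMap.lsmul ℝ ℝ))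
    (h1.continuous_fderiv one_ne_zero) hl x
  rw [convolution_def, ContinuousLinearMap.integral_apply hex, convolution_def]
  simp only [ContinuousLinearMap.precompL_apply, ContinuousLinearMap.lsmul_apply]
  rw [← integral_sub_left_eq_self _ volume x,
    ← integral_sub_left_eq_self (fun t => ρ t • G (x - t)) volume x]
  simp only [sub_sub_cancel]
  have := h (fun y => ρ (x - y)) (hρ.comp (contDiff_const.sub contDiff_id))
    (hρc.comp_homeomorph (Homeomorph.subLeft x)) (subset_univ _)
  simp only [Measure.restrict_univ] at this
  have e : ∀ y, fderiv ℝ (fun y => ρ (x - y)) y v = - fderiv ℝ ρ (x - y) v := fun y => by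
    have := (h1.differentiable one_ne_zero (x - y)).hasFDerivAt.comp y
      ((hasFDerivAt_id y).const_sub x)
    rw [HasFDerivAt.fderiv (f := fun y => ρ (x - y)) this]
    simp
  simp only [e, neg_smul, integral_neg] at this
  exact neg_injective this

/-- Mollification at a radius below the L² moduli of continuity of the function and of all its
derivatives, and also below the distance from the support to the complement of Ω, so that the
support stays in Ω. -/
theorem exists_isTest_close {ι : Type*} [Finite ι] {Ω : Set E} (hΩ : IsOpen Ω) {v : ι → E}
    {F : E → ℂ} {G : ι → E → ℂ} (hF : MemLp F 2 volume) (hG : ∀ i, MemLp (G i) 2 volume)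
    (h : ∀ i, HasWeakPartial univ (v i) F (G i)) (hFc : HasCompactSupport F)
    (hFs : tsupport F ⊆ Ω) {ε : ENNReal} (hε : 0 < ε) :
    ∃ φ, IsTest Ω φ ∧ eLpNorm (fun x => φ x - F x) 2 volume ≤ ε ∧
      ∀ i, eLpNorm (fun x => fderiv ℝ φ x (v i) - G i x) 2 volume ≤ ε := by
  obtain ⟨δ₀, hδ₀, h0⟩ := exists_translation_close hF hε
  choose δ₁ hδ₁ h1 using fun i => exists_translation_close (hG i) hε
  obtain ⟨δ₂, hδ₂, h2⟩ := hFc.exists_cthickening_subset_open hΩ hFs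
  obtain ⟨δ, hδ, hle0, hle2, hle1⟩ : ∃ δ > 0, δ ≤ δ₀ ∧ δ ≤ δ₂ ∧ ∀ i, δ ≤ δ₁ i := by
    have : ∀ᶠ δ in 𝓝[>] (0 : ℝ), 0 < δ ∧ δ ≤ δ₀ ∧ δ ≤ δ₂ ∧ ∀ i, δ ≤ δ₁ i := by
      have hh : ∀ a > (0 : ℝ), ∀ᶠ δ in 𝓝[>] (0 : ℝ), δ ≤ a := fun a ha =>
        mem_nhdsWithin_of_mem_nhds (Iic_mem_nhds ha)
      have hpos : ∀ᶠ δ in 𝓝[>] (0 : ℝ), 0 < δ := self_mem_nhdsWithin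
      exact hpos.and ((hh _ hδ₀).and ((hh _ hδ₂).and
        (eventually_all.2 fun i => hh _ (hδ₁ i))))
    exact this.exists
  let b : ContDiffBump (0 : E) := ⟨δ / 2, δ, by positivity, by linarith⟩
  have hbc : HasCompactSupport (b.normed volume) := b.hasCompactSupport_normed
  have hbs : ContDiff ℝ (⊤ : ℕ∞) (b.normed volume) := b.contDiff_normed
  refine ⟨b.normed volume ⋆[ContinuousLinearMap.lsmul ℝ ℝ, volume] F, ⟨?_, ?_, ?_⟩, ?_, ?_⟩
  · exact hbc.contDiff_convolution_left _ hbs (hF.locallyIntegrable one_le_two)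
  · exact hbc.convolution _ hFc
  · refine subset_trans (closure_minimal ?_ Metric.isClosed_cthickening) h2
    refine (support_convolution_subset _).trans ?_
    rintro _ ⟨y, hy, z, hz, rfl⟩
    rw [b.support_normed_eq, mem_ball_zero_iff] at hy
    refine Metric.mem_cthickening_of_dist_le (y + z) z δ₂ _ (subset_tsupport F hz) ?_
    simpa using hy.le.trans hle2
  · exact eLpNorm_convolution_sub_le hF b fun y hy => h0 y (hy.trans hle0)
  · intro i
    simp only [fderiv_convolution_of_hasWeakPartial hF (h i) hbs hbc]
    exact eLpNorm_convolution_sub_le (hG i) b fun y hy => h1 i y (hy.trans (hle1 i))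

end Sobolev

/-! ### Cutoffs of the half-plane -/

theorem isOpen_halfPlane : IsOpen halfPlane := isOpen_lt continuous_const continuous_fst

theorem measurableSet_halfPlane : MeasurableSet halfPlane := isOpen_halfPlane.measurableSet

theorem hasFDerivAt_mul_prod {A B : ℝ → ℝ} {a b : ℝ} {p : ℝ × ℝ} (hA : HasDerivAt A a p.1)
    (hB : HasDerivAt B b p.2) (v : ℝ × ℝ) :
    fderiv ℝ (fun q : ℝ × ℝ => A q.1 * B q.2) p v = v.1 * a * B p.2 + A p.1 * (v.2 * b) := by
  have h1 := hA.hasFDerivAt.comp p (hasFDerivAt_fst (𝕜 := ℝ) (p := p))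
  have h2 := hB.hasFDerivAt.comp p (hasFDerivAt_snd (𝕜 := ℝ) (p := p))
  have := (h1.mul h2).fderiv
  rw [show (fun q : ℝ × ℝ => A q.1 * B q.2) = (A ∘ Prod.fst) * (B ∘ Prod.snd) from rfl, this]
  simp
  ring

theorem tendsto_eLpNorm_zero_of_dominated {α F : Type*} [MeasurableSpace α] {ν : Measure α}
    [NormedAddCommGroup F] {f : ℕ → α → F} {g : α → ℝ} (hf : ∀ n, AEStronglyMeasurable (f n) ν)
    (hg : MemLp g 2 ν) (hb : ∀ n, ∀ᵐ a ∂ν, ‖f n a‖ ≤ g a)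
    (hl : ∀ᵐ a ∂ν, Tendsto (fun n => f n a) atTop (𝓝 0)) :
    Tendsto (fun n => eLpNorm (f n) 2 ν) atTop (𝓝 0) := by
  have h1 : Tendsto (fun n => ∫⁻ a, ‖f n a‖ₑ ^ 2 ∂ν) atTop (𝓝 (∫⁻ _, 0 ∂ν)) := by
    refine tendsto_lintegral_of_dominated_convergence' (fun a => ‖g a‖ₑ ^ 2)
      (fun n => (hf n).enorm.pow_const 2) (fun n => ?_) ?_ ?_
    · filter_upwards [hb n] with a ha
      gcongr
      exact enorm_le_iff_norm_le.2 (ha.trans (Real.le_norm_self _))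
    · rw [← lintegral_enorm_sq]
      exact ENNReal.pow_ne_top hg.eLpNorm_ne_top
    · filter_upwards [hl] with a ha
      simpa using ENNReal.Tendsto.pow (n := 2) ha.enorm
  have h2 := h1.ennrpow_const (1 / 2)
  simp only [lintegral_zero] at h2
  rw [ENNReal.zero_rpow_of_pos (by norm_num)] at h2
  refine h2.congr fun n => ?_
  rw [← lintegral_enorm_sq, ← ENNReal.rpow_natCast, ← ENNReal.rpow_mul]
  norm_num

/-- The bound on x ξ'(x) serves dilations: the derivative of ξ(Nr) in r is r⁻¹ times x ξ'(x) at x =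
Nr, so it is at most C/r uniformly in N. -/
theorem exists_bound_deriv_bump {ξ : ℝ → ℝ} (h : ContDiff ℝ (⊤ : ℕ∞) ξ)
    (hc : HasCompactSupport (deriv ξ)) : ∃ C, 0 ≤ C ∧
    ∀ x, |deriv ξ x| ≤ C ∧ |x * deriv ξ x| ≤ C := by
  have hd : Continuous (deriv ξ) := h.continuous_deriv (by simp)
  obtain ⟨C₁, h1⟩ := hd.bounded_above_of_compact_support hc
  obtain ⟨C₂, h2⟩ := (continuous_id.mul hd).bounded_above_of_compact_support
    (hc.mul_left (f := id))
  refine ⟨max C₁ C₂, ?_, fun x => ⟨(h1 x).trans (le_max_left _ _), (h2 x).trans (le_max_right _ _)⟩⟩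
  exact (norm_nonneg _).trans ((h1 0).trans (le_max_left _ _))

theorem exists_bump : ∃ ξ : ℝ → ℝ, ContDiff ℝ (⊤ : ℕ∞) ξ ∧ HasCompactSupport ξ ∧
    (∀ x, 0 ≤ ξ x ∧ ξ x ≤ 1) ∧ (∀ x, |x| ≤ 1 → ξ x = 1) ∧ ∀ x, 2 ≤ |x| → ξ x = 0 := by
  let b : ContDiffBump (0 : ℝ) := ⟨1, 2, one_pos, one_lt_two⟩
  refine ⟨b, b.contDiff, b.hasCompactSupport, fun x => ⟨b.nonneg, b.le_one⟩, fun x hx => ?_,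
    fun x hx => ?_⟩
  · exact b.one_of_mem_closedBall (by rwa [mem_closedBall_zero_iff, Real.norm_eq_abs])
  · exact b.zero_of_le_dist (by rwa [dist_zero_right, Real.norm_eq_abs])

/-- Cutoffs exhausting the half-plane, whose gradient is controlled by the inverse distance to the
boundary. -/
theorem exists_cutoff_halfPlane : ∃ (C : ℝ) (χ : ℕ → ℝ × ℝ → ℝ),
    (∀ n, ContDiff ℝ (⊤ : ℕ∞) (χ n) ∧ HasCompactSupport (χ n) ∧ tsupport (χ n) ⊆ halfPlane) ∧
    (∀ n p, |χ n p| ≤ 1) ∧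
    (∀ n, ∀ p ∈ halfPlane, |fderiv ℝ (χ n) p (1, 0)| ≤ C * (1 / p.1 + 1)) ∧
    (∀ n, ∀ p ∈ halfPlane, |fderiv ℝ (χ n) p (0, 1)| ≤ C) ∧
    ∀ p ∈ halfPlane, ∀ᶠ n in atTop, χ n =ᶠ[𝓝 p] fun _ => 1 := by
  -- This profile is 0 for x ≤ 1 and 1 for x ≥ 2, so ζ(Nr) vanishes near the boundary r = 0.
  let ζ : ℝ → ℝ := fun x => Real.smoothTransition (x - 1)
  obtain ⟨b, hb, hbc, hb01, hbone, hbzero⟩ := exists_bump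
  have hζ : ContDiff ℝ (⊤ : ℕ∞) ζ :=
    Real.smoothTransition.contDiff.comp (contDiff_id.sub contDiff_const)
  have hζc : HasCompactSupport (deriv ζ) := by
    refine HasCompactSupport.intro (isCompact_Icc (a := (1 : ℝ)) (b := 2)) fun x hx => ?_
    rw [mem_Icc, not_and_or, not_le, not_le] at hx
    rcases hx with hx | hx
    · have : ζ =ᶠ[𝓝 x] fun _ => 0 := by
        filter_upwards [Iio_mem_nhds hx] with y hy
        exact Real.smoothTransition.zero_of_nonpos (by linarith [mem_Iio.1 hy])
      rw [this.deriv_eq, deriv_const]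
    · have : ζ =ᶠ[𝓝 x] fun _ => 1 := by
        filter_upwards [Ioi_mem_nhds hx] with y hy
        exact Real.smoothTransition.one_of_one_le (by linarith [mem_Ioi.1 hy])
      rw [this.deriv_eq, deriv_const]
  obtain ⟨C₁, hC₁, h1⟩ := exists_bound_deriv_bump hζ hζc
  obtain ⟨C₂, hC₂, h2⟩ := exists_bound_deriv_bump hb hbc.deriv
  have hζ1 : ∀ x, |ζ x| ≤ 1 := fun x => by
    rw [abs_of_nonneg (Real.smoothTransition.nonneg _)]; exact Real.smoothTransition.le_one _
  have hb1 : ∀ x, |b x| ≤ 1 := fun x => by rw [abs_of_nonneg (hb01 x).1]; exact (hb01 x).2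
  let N : ℕ → ℝ := fun n => (n : ℝ) + 1
  have hN : ∀ n, 1 ≤ N n := fun n => by simp [N]
  -- The first factor removes the strip r ≤ 1/N, the second truncates at r ≥ 2N. Only the first has
  -- a steep derivative, and it is the one controlled by 1/r.
  let A : ℕ → ℝ → ℝ := fun n r => ζ (N n * r) * b (r / N n)
  let B : ℕ → ℝ → ℝ := fun n z => b (z / N n)
  have hA : ∀ n, ContDiff ℝ (⊤ : ℕ∞) (A n) := fun n =>
    (hζ.comp (contDiff_const.mul contDiff_id)).mul (hb.comp (contDiff_id.div_const _))
  have hB : ∀ n, ContDiff ℝ (⊤ : ℕ∞) (B n) := fun n => hb.comp (contDiff_id.div_const _)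
  have hdζ : ∀ x, HasDerivAt ζ (deriv ζ x) x := fun x =>
    (hζ.differentiable (by simp) x).hasDerivAt
  have hdb : ∀ x, HasDerivAt b (deriv b x) x := fun x =>
    (hb.differentiable (by simp) x).hasDerivAt
  have hdA : ∀ n r, HasDerivAt (A n) (deriv ζ (N n * r) * N n * b (r / N n)
      + ζ (N n * r) * (deriv b (r / N n) * (1 / N n))) r := fun n r => by
    have e1 := (hdζ (N n * r)).comp r ((hasDerivAt_id r).const_mul (N n))
    have e2 := (hdb (r / N n)).comp r ((hasDerivAt_id r).div_const (N n))
    rw [mul_one] at e1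
    exact e1.mul e2
  have hdB : ∀ n r, HasDerivAt (B n) (deriv b (r / N n) * (1 / N n)) r := fun n r =>
    (hdb (r / N n)).comp r ((hasDerivAt_id r).div_const (N n))
  have hNi : ∀ n, |1 / N n| ≤ 1 := fun n => by
    rw [abs_of_nonneg (by have := hN n; positivity)]
    exact div_le_one_of_le₀ (hN n) (by linarith [hN n])
  have hbN : ∀ n x, |deriv b (x / N n) * (1 / N n)| ≤ C₂ := fun n x => by
    rw [abs_mul]
    calc _ ≤ C₂ * 1 := mul_le_mul (h2 _).1 (hNi n) (abs_nonneg _) hC₂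
      _ = C₂ := mul_one _
  refine ⟨C₁ + C₂, fun n p => A n p.1 * B n p.2, fun n => ⟨?_, ?_⟩, ?_, ?_, ?_, ?_⟩
  · exact ((hA n).comp contDiff_fst).mul ((hB n).comp contDiff_snd)
  · have hK : ∀ p : ℝ × ℝ, p ∉ Icc (1 / N n) (2 * N n) ×ˢ Icc (-(2 * N n)) (2 * N n) →
        A n p.1 * B n p.2 = 0 := by
      have hN0 : 0 < N n := by linarith [hN n]
      have hbz : ∀ x, 2 * N n < |x| → b (x / N n) = 0 := fun x hx => hbzero _ (by
        rw [abs_div, abs_of_pos hN0, le_div_iff₀ hN0]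
        exact hx.le)
      intro p hp
      by_contra h0
      apply hp
      have h3 : ζ (N n * p.1) ≠ 0 := fun h => h0 (by simp [A, h])
      have h4 : b (p.1 / N n) ≠ 0 := fun h => h0 (by simp [A, h])
      have h5 : b (p.2 / N n) ≠ 0 := fun h => h0 (by simp [B, h])
      have h6 : 1 < N n * p.1 := by
        by_contra hh
        exact h3 (Real.smoothTransition.zero_of_nonpos (by linarith))
      have h7 := not_lt.1 (fun h => h4 (hbz _ h))
      have h8 := not_lt.1 (fun h => h5 (hbz _ h))
      refine ⟨⟨?_, (le_abs_self _).trans h7⟩, abs_le.1 h8⟩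
      rw [div_le_iff₀ hN0]; linarith
    have hKc : IsCompact (Icc (1 / N n) (2 * N n) ×ˢ Icc (-(2 * N n)) (2 * N n)) :=
      isCompact_Icc.prod isCompact_Icc
    refine ⟨HasCompactSupport.intro hKc fun p hp => hK p hp, ?_⟩
    refine (closure_minimal (fun p hp => ?_) hKc.isClosed).trans (fun p hp => ?_)
    · exact (by by_contra h; exact hp (hK p h))
    · have : 0 < 1 / N n := by have := hN n; positivity
      exact this.trans_le hp.1.1
  · intro n p
    simp only [A, B, abs_mul]
    exact mul_le_one₀ (mul_le_one₀ (hζ1 _) (abs_nonneg _) (hb1 _)) (abs_nonneg _) (hb1 _)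
  · intro n p hp
    have hr : 0 < p.1 := hp
    have hN0 : 0 < N n := by linarith [hN n]
    rw [hasFDerivAt_mul_prod (hdA n p.1) (hdB n p.2)]
    simp only [one_mul, zero_mul, mul_zero, add_zero]
    rw [abs_mul]
    have e1 : |deriv ζ (N n * p.1) * N n * b (p.1 / N n)| ≤ C₁ * (1 / p.1) := by
      rw [abs_mul, mul_one_div]
      refine (mul_le_of_le_one_right (abs_nonneg _) (hb1 _)).trans ?_
      rw [le_div_iff₀ hr]
      have := (h1 (N n * p.1)).2
      rw [abs_mul, abs_of_pos (mul_pos hN0 hr)] at this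
      rw [abs_mul, abs_of_pos hN0]
      linarith
    have e2 : |ζ (N n * p.1) * (deriv b (p.1 / N n) * (1 / N n))| ≤ C₂ := by
      rw [abs_mul]
      exact (mul_le_of_le_one_left (abs_nonneg _) (hζ1 _)).trans (hbN _ _)
    have hr' : 0 < 1 / p.1 := by positivity
    calc _ ≤ (C₁ * (1 / p.1) + C₂) * 1 :=
          mul_le_mul ((abs_add_le _ _).trans (add_le_add e1 e2)) (hb1 _) (abs_nonneg _)
            (by positivity)
      _ ≤ _ := by nlinarith [mul_nonneg hC₂ hr'.le]
  · intro n p hp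
    rw [hasFDerivAt_mul_prod (hdA n p.1) (hdB n p.2)]
    simp only [one_mul, zero_mul, zero_add]
    rw [abs_mul]
    have : |A n p.1| ≤ 1 := by
      simp only [A, abs_mul]
      exact mul_le_one₀ (hζ1 _) (abs_nonneg _) (hb1 _)
    exact ((mul_le_of_le_one_left (abs_nonneg _) this).trans (hbN _ _)).trans (by linarith)
  · intro p hp
    have hr : 0 < p.1 := hp
    have hNt : Tendsto N atTop atTop :=
      tendsto_atTop_add_const_right _ _ tendsto_natCast_atTop_atTop
    filter_upwards [hNt.eventually_gt_atTop (2 / p.1), hNt.eventually_gt_atTop |p.1|,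
      hNt.eventually_gt_atTop |p.2|] with n h3 h4 h5
    have hN0 : 0 < N n := by linarith [hN n]
    have o1 : IsOpen {q : ℝ × ℝ | 2 < N n * q.1} :=
      isOpen_lt continuous_const (continuous_const.mul continuous_fst)
    have o2 : IsOpen {q : ℝ × ℝ | |q.1| < N n} := isOpen_lt continuous_fst.abs continuous_const
    have o3 : IsOpen {q : ℝ × ℝ | |q.2| < N n} := isOpen_lt continuous_snd.abs continuous_const
    have hb' : ∀ x, |x| < N n → b (x / N n) = 1 := fun x hx => hbone _ (by
      rw [abs_div, abs_of_pos hN0]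
      exact div_le_one_of_le₀ hx.le hN0.le)
    filter_upwards [o1.mem_nhds (by rwa [div_lt_iff₀ hr] at h3), o2.mem_nhds h4, o3.mem_nhds h5]
      with q h6 h7 h8
    have : ζ (N n * q.1) = 1 := Real.smoothTransition.one_of_one_le (by
      have : 2 < N n * q.1 := h6
      linarith)
    simp only [A, B, this, hb' _ h7, hb' _ h8, mul_one]

/-! ### Admissible functions on the half-plane -/

theorem weakPartial_spec {E : Type*} [NormedAddCommGroup E] [NormedSpace ℝ E] [MeasureSpace E]
    {Ω : Set E} {v : E} {f : E → ℂ}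
    (h : ∃ g : E → ℂ, MemLp g 2 (volume.restrict Ω) ∧ HasWeakPartial Ω v f g) :
    MemLp (weakPartial Ω v f) 2 (volume.restrict Ω) ∧
      HasWeakPartial Ω v f (weakPartial Ω v f) := by
  rw [weakPartial, dif_pos h]
  exact h.choose_spec

theorem HasWeakPartial.congr {E : Type*} [NormedAddCommGroup E] [NormedSpace ℝ E] [MeasureSpace E]
    {Ω : Set E} {v : E} {f f' g g' : E → ℂ} (h : HasWeakPartial Ω v f g)
    (hf : f =ᵐ[volume.restrict Ω] f') (hg : g =ᵐ[volume.restrict Ω] g') :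
    HasWeakPartial Ω v f' g' := by
  intro φ h1 h2 h3
  have e1 : ∫ x in Ω, fderiv ℝ φ x v • f x = ∫ x in Ω, fderiv ℝ φ x v • f' x :=
    integral_congr_ae (hf.mono fun x hx => by simp only [hx])
  have e2 : ∫ x in Ω, φ x • g x = ∫ x in Ω, φ x • g' x :=
    integral_congr_ae (hg.mono fun x hx => by simp only [hx])
  rw [← e1, ← e2]
  exact h φ h1 h2 h3

theorem continuous_fderiv_apply {E F : Type*} [NormedAddCommGroup E]
    [NormedSpace ℝ E] [NormedAddCommGroup F] [NormedSpace ℝ F] {φ : E → F}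
    (h : ContDiff ℝ (⊤ : ℕ∞) φ) (v : E) : Continuous fun x => fderiv ℝ φ x v :=
  (h.continuous_fderiv (by simp)).clm_apply continuous_const

theorem HasWeakPartial.const_smul {E : Type*} [NormedAddCommGroup E] [NormedSpace ℝ E]
    [MeasureSpace E] {Ω : Set E} {v : E} {f g : E → ℂ} (h : HasWeakPartial Ω v f g)
    (c : ℂ) : HasWeakPartial Ω v (c • f) (c • g) := by
  intro φ h1 h2 h3
  simp only [Pi.smul_apply, smul_comm _ c]
  rw [integral_smul, integral_smul, h φ h1 h2 h3, smul_neg]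

section Linear

variable {E : Type*} [NormedAddCommGroup E] [NormedSpace ℝ E] [MeasureSpace E] [BorelSpace E]
  [FiniteDimensional ℝ E] [(volume : Measure E).IsAddHaarMeasure]

theorem HasWeakPartial.add {Ω : Set E} {v : E} {f f' g g' : E → ℂ} (h : HasWeakPartial Ω v f g)
    (h' : HasWeakPartial Ω v f' g') (hf : MemLp f 2 (volume.restrict Ω))
    (hf' : MemLp f' 2 (volume.restrict Ω)) (hg : MemLp g 2 (volume.restrict Ω))
    (hg' : MemLp g' 2 (volume.restrict Ω)) : HasWeakPartial Ω v (f + f') (g + g') := by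
  intro φ h1 h2 h3
  have hd := continuous_fderiv_apply h1 v
  have hc : HasCompactSupport fun x => fderiv ℝ φ x v := h2.fderiv_apply ℝ v
  simp only [Pi.add_apply, smul_add]
  rw [integral_add (integrable_smul_of_memLp hd hc hf) (integrable_smul_of_memLp hd hc hf'),
    integral_add (integrable_smul_of_memLp h1.continuous h2 hg)
      (integrable_smul_of_memLp h1.continuous h2 hg'), h φ h1 h2 h3, h' φ h1 h2 h3]
  ring

theorem hasWeakPartial_of_contDiff {Ω : Set E} {f : E → ℂ} (hf : ContDiff ℝ (⊤ : ℕ∞) f) (v : E) :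
    HasWeakPartial Ω v f (fun x => fderiv ℝ f x v) := by
  intro φ h1 h2 h3
  have hz : ∀ x, x ∉ Ω → φ x = 0 := fun x hx =>
    image_eq_zero_of_notMem_tsupport fun h => hx (h3 h)
  have hz' : ∀ x, x ∉ Ω → fderiv ℝ φ x v = 0 := fun x hx => by
    rw [image_eq_zero_of_notMem_tsupport (f := fderiv ℝ φ)
      fun h => hx (h3 (tsupport_fderiv_subset ℝ h)), zero_apply]
  rw [setIntegral_eq_integral_of_forall_compl_eq_zero fun x hx => by simp [hz' x hx],
    setIntegral_eq_integral_of_forall_compl_eq_zero fun x hx => by simp [hz x hx],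
    integral_smul_fderiv_eq_neg_fderiv_smul_of_integrable, neg_neg]
  · exact ((continuous_fderiv_apply h1 v).smul hf.continuous).integrable_of_hasCompactSupport
      (h2.fderiv_apply ℝ v).smul_right
  · exact (h1.continuous.smul (continuous_fderiv_apply hf v)).integrable_of_hasCompactSupport
      h2.smul_right
  · exact (h1.continuous.smul hf.continuous).integrable_of_hasCompactSupport h2.smul_right
  · exact fun x _ => h1.differentiable (by simp) x
  · exact fun x _ => hf.differentiable (by simp) x

theorem IsTest.memLp {Ω : Set E} {φ : E → ℂ} (h : IsTest Ω φ) : MemLp φ 2 volume :=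
  h.smooth.continuous.memLp_of_hasCompactSupport h.compact

theorem IsTest.memLp_fderiv {Ω : Set E} {φ : E → ℂ} (h : IsTest Ω φ) (v : E) :
    MemLp (fun x => fderiv ℝ φ x v) 2 volume :=
  (continuous_fderiv_apply h.smooth v).memLp_of_hasCompactSupport (h.compact.fderiv_apply ℝ v)

end Linear

/-- The functions in `H¹` of the half-plane for which the centrifugal term is finite. -/
structure Admissible (ω : ℝ × ℝ → ℂ) : Prop where
  memH1 : MemH1HalfPlane ω
  hardy : MemLp (fun p => ω p / (p.1 : ℂ)) 2 (volume.restrict halfPlane)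

namespace Admissible

variable {ω ω' : ℝ × ℝ → ℂ}

theorem memLp (h : Admissible ω) : MemLp ω 2 (volume.restrict halfPlane) := h.memH1.1

theorem dr_spec (h : Admissible ω) : MemLp (dr ω) 2 (volume.restrict halfPlane) ∧
    HasWeakPartial halfPlane (1, 0) ω (dr ω) := weakPartial_spec (h.memH1.2 0)

theorem dz_spec (h : Admissible ω) : MemLp (dz ω) 2 (volume.restrict halfPlane) ∧
    HasWeakPartial halfPlane (0, 1) ω (dz ω) := weakPartial_spec (h.memH1.2 1)

/-- Because `dr` and `dz` are chosen representatives, they are known only almost everywhere. All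
later rules for them go through this statement, which turns explicit weak derivatives into both
admissibility and an identification. -/
theorem of_hasWeakPartial {g₀ g₁ : ℝ × ℝ → ℂ} (h : MemLp ω 2 (volume.restrict halfPlane))
    (h₀ : MemLp g₀ 2 (volume.restrict halfPlane)) (h₁ : MemLp g₁ 2 (volume.restrict halfPlane))
    (w₀ : HasWeakPartial halfPlane (1, 0) ω g₀) (w₁ : HasWeakPartial halfPlane (0, 1) ω g₁)
    (hh : MemLp (fun p => ω p / (p.1 : ℂ)) 2 (volume.restrict halfPlane)) :
    Admissible ω ∧ dr ω =ᵐ[volume.restrict halfPlane] g₀ ∧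
      dz ω =ᵐ[volume.restrict halfPlane] g₁ := by
  have ha : Admissible ω := ⟨⟨h, fun i => by fin_cases i; exacts [⟨g₀, h₀, w₀⟩, ⟨g₁, h₁, w₁⟩]⟩, hh⟩
  exact ⟨ha, hasWeakPartial_unique isOpen_halfPlane ha.dr_spec.1 h₀ ha.dr_spec.2 w₀,
    hasWeakPartial_unique isOpen_halfPlane ha.dz_spec.1 h₁ ha.dz_spec.2 w₁⟩

theorem congr (h : Admissible ω) (e : ω =ᵐ[volume.restrict halfPlane] ω') :
    Admissible ω' ∧ dr ω' =ᵐ[volume.restrict halfPlane] dr ω ∧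
      dz ω' =ᵐ[volume.restrict halfPlane] dz ω :=
  of_hasWeakPartial (h.memLp.ae_eq e) h.dr_spec.1 h.dz_spec.1 (h.dr_spec.2.congr e .rfl)
    (h.dz_spec.2.congr e .rfl)
    (h.hardy.ae_eq (e.mono fun p hp => show _ = _ by simp only; rw [hp]))

theorem add (h : Admissible ω) (h' : Admissible ω') :
    Admissible (ω + ω') ∧ dr (ω + ω') =ᵐ[volume.restrict halfPlane] dr ω + dr ω' ∧
      dz (ω + ω') =ᵐ[volume.restrict halfPlane] dz ω + dz ω' :=
  of_hasWeakPartial (h.memLp.add h'.memLp) (h.dr_spec.1.add h'.dr_spec.1)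
    (h.dz_spec.1.add h'.dz_spec.1)
    (h.dr_spec.2.add h'.dr_spec.2 h.memLp h'.memLp h.dr_spec.1 h'.dr_spec.1)
    (h.dz_spec.2.add h'.dz_spec.2 h.memLp h'.memLp h.dz_spec.1 h'.dz_spec.1)
    ((h.hardy.add h'.hardy).ae_eq (ae_of_all _ fun p => by simp [add_div]))

theorem const_smul (h : Admissible ω) (c : ℂ) :
    Admissible (c • ω) ∧ dr (c • ω) =ᵐ[volume.restrict halfPlane] c • dr ω ∧
      dz (c • ω) =ᵐ[volume.restrict halfPlane] c • dz ω :=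
  of_hasWeakPartial (h.memLp.const_smul c) (h.dr_spec.1.const_smul c)
    (h.dz_spec.1.const_smul c) (h.dr_spec.2.const_smul c) (h.dz_spec.2.const_smul c)
    ((h.hardy.const_smul c).ae_eq (ae_of_all _ fun p => by simp [mul_div_assoc]))

end Admissible

/-- A continuous function with compact support in the half-plane keeps these properties when
divided by a power of the distance to the boundary. -/
theorem isTest_div {φ : ℝ × ℝ → ℂ} (h : IsTest halfPlane φ) :
    IsTest halfPlane fun p => φ p / (p.1 : ℂ) := by
  have hz : ∀ p, p ∉ tsupport φ → φ p / (p.1 : ℂ) = 0 := fun p hp => by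
    rw [image_eq_zero_of_notMem_tsupport hp, zero_div]
  have hs : tsupport (fun p : ℝ × ℝ => φ p / (p.1 : ℂ)) ⊆ tsupport φ :=
    closure_minimal (fun p hp => by_contra fun h => hp (hz p h)) (isClosed_tsupport _)
  refine ⟨contDiff_iff_contDiffAt.2 fun p => ?_, HasCompactSupport.intro h.compact hz,
    hs.trans h.support⟩
  by_cases hp : p ∈ tsupport φ
  · have hr : (0 : ℝ) < p.1 := h.support hp
    have h1 : ContDiffAt ℝ (⊤ : ℕ∞) (fun q : ℝ × ℝ => (q.1 : ℂ)) p :=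
      (Complex.ofRealCLM.contDiff.comp contDiff_fst).contDiffAt
    simp only [div_eq_mul_inv]
    exact h.smooth.contDiffAt.mul (h1.inv (by exact_mod_cast hr.ne'))
  · have : (fun p : ℝ × ℝ => φ p / (p.1 : ℂ)) =ᶠ[𝓝 p] fun _ => 0 := by
      filter_upwards [(isClosed_tsupport φ).isOpen_compl.mem_nhds hp] with q hq using hz q hq
    exact contDiffAt_const.congr_of_eventuallyEq this

theorem IsTest.admissible {φ : ℝ × ℝ → ℂ} (h : IsTest halfPlane φ) :
    Admissible φ ∧ dr φ =ᵐ[volume.restrict halfPlane] (fun p => fderiv ℝ φ p (1, 0)) ∧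
      dz φ =ᵐ[volume.restrict halfPlane] (fun p => fderiv ℝ φ p (0, 1)) :=
  Admissible.of_hasWeakPartial (h.memLp.restrict _) ((h.memLp_fderiv _).restrict _)
    ((h.memLp_fderiv _).restrict _) (hasWeakPartial_of_contDiff h.smooth _)
    (hasWeakPartial_of_contDiff h.smooth _) ((isTest_div h).memLp.restrict _)

/-- The functions `φ n` converge to `ω` in `H¹` of the half-plane. -/
structure H1Tendsto (φ : ℕ → ℝ × ℝ → ℂ) (ω : ℝ × ℝ → ℂ) : Prop where
  val : Tendsto (fun n => eLpNorm (fun p => φ n p - ω p) 2 (volume.restrict halfPlane))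
    atTop (𝓝 0)
  dr : Tendsto (fun n => eLpNorm (fun p => fderiv ℝ (φ n) p (1, 0) - dr ω p) 2
    (volume.restrict halfPlane)) atTop (𝓝 0)
  dz : Tendsto (fun n => eLpNorm (fun p => fderiv ℝ (φ n) p (0, 1) - dz ω p) 2
    (volume.restrict halfPlane)) atTop (𝓝 0)

theorem tendsto_eLpNorm_sub_of_tendsto {α : Type*} [MeasurableSpace α] {ν : Measure α}
    {f g : ℕ → α → ℂ} {h : α → ℂ} (hf : ∀ n, AEStronglyMeasurable (f n) ν)
    (hg : ∀ n, AEStronglyMeasurable (g n) ν) (hh : AEStronglyMeasurable h ν)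
    (h1 : Tendsto (fun n => eLpNorm (fun p => f n p - g n p) 2 ν) atTop (𝓝 0))
    (h2 : Tendsto (fun n => eLpNorm (fun p => g n p - h p) 2 ν) atTop (𝓝 0)) :
    Tendsto (fun n => eLpNorm (fun p => f n p - h p) 2 ν) atTop (𝓝 0) := by
  have h3 := h1.add h2
  rw [add_zero] at h3
  refine tendsto_of_tendsto_of_tendsto_of_le_of_le tendsto_const_nhds h3 (fun n => zero_le)
    fun n => ?_
  have e : (fun p => f n p - h p) = (fun p => f n p - g n p) + fun p => g n p - h p := by
    ext p; simp
  simp only [e]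
  exact eLpNorm_add_le ((hf n).sub (hg n)) ((hg n).sub hh) one_le_two

/-- Cut off, then mollify. The cutoff produces the extra term ω ∇χₙ, which is bounded by C(|ω|/r +
|ω|) and is eventually zero at each point, so it tends to 0 in L² by dominated convergence precisely
because ω/r is square integrable. In H¹ alone the claim would fail for functions that do not vanish
at r = 0. -/
theorem Admissible.exists_test_tendsto {ω : ℝ × ℝ → ℂ} (h : Admissible ω) :
    ∃ φ : ℕ → ℝ × ℝ → ℂ, (∀ n, IsTest halfPlane (φ n)) ∧ H1Tendsto φ ω := by
  obtain ⟨C, χ, h1, h2, h3, h4, h5⟩ := exists_cutoff_halfPlane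
  have hC : 0 ≤ C := (abs_nonneg _).trans (h4 0 (1, 0) (show (0 : ℝ) < 1 by norm_num))
  have hdd : ∀ n v, Continuous fun x => fderiv ℝ (χ n) x v := fun n v =>
    continuous_fderiv_apply (h1 n).1 v
  let v : Fin 2 → ℝ × ℝ := ![(1, 0), (0, 1)]
  let g : Fin 2 → ℝ × ℝ → ℂ := ![ConicalSurface.dr ω, ConicalSurface.dz ω]
  have hg : ∀ i, MemLp (g i) 2 (volume.restrict halfPlane) := fun i => by
    fin_cases i; exacts [h.dr_spec.1, h.dz_spec.1]
  have hw : ∀ i, HasWeakPartial halfPlane (v i) ω (g i) := fun i => by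
    fin_cases i; exacts [h.dr_spec.2, h.dz_spec.2]
  let F : ℕ → ℝ × ℝ → ℂ := fun n p => χ n p • ω p
  let G : ℕ → Fin 2 → ℝ × ℝ → ℂ := fun n i p => χ n p • g i p + fderiv ℝ (χ n) p (v i) • ω p
  have hF : ∀ n, MemLp (F n) 2 volume := fun n =>
    memLp_smul_cutoff isOpen_halfPlane (h1 n).1.continuous (h1 n).2.1 (h1 n).2.2 h.memLp
  have hG : ∀ n i, MemLp (G n i) 2 volume := fun n i =>
    (memLp_smul_cutoff isOpen_halfPlane (h1 n).1.continuous (h1 n).2.1 (h1 n).2.2 (hg i)).add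
      (memLp_smul_cutoff isOpen_halfPlane (hdd n _) ((h1 n).2.1.fderiv_apply ℝ _)
        ((tsupport_fderiv_apply_subset ℝ _).trans (h1 n).2.2) h.memLp)
  have hFG : ∀ n i, HasWeakPartial univ (v i) (F n) (G n i) := fun n i =>
    hasWeakPartial_cutoff h.memLp (hg i) (hw i) (h1 n).1 (h1 n).2.1 (h1 n).2.2
  -- The mollification error at stage n; it only has to tend to 0.
  have hε : ∀ n : ℕ, (0 : ENNReal) < ((n : ENNReal) + 1)⁻¹ := fun n => by simp
  choose φ hφ hφF hφG using fun n => exists_isTest_close isOpen_halfPlane (hF n) (hG n) (hFG n)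
    ((h1 n).2.1.smul_right) ((tsupport_smul_subset_left _ _).trans (h1 n).2.2) (hε n)
  have hlim : Tendsto (fun n : ℕ => ((n : ENNReal) + 1)⁻¹) atTop (𝓝 0) := by
    have := ENNReal.tendsto_inv_nat_nhds_zero.comp (tendsto_add_atTop_nat 1)
    refine this.congr fun n => by simp
  have hsq : ∀ {f : ℕ → ENNReal}, (∀ n, f n ≤ ((n : ENNReal) + 1)⁻¹) → Tendsto f atTop (𝓝 0) :=
    fun hf => tendsto_of_tendsto_of_tendsto_of_le_of_le tendsto_const_nhds hlim
      (fun n => zero_le) hf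
  have hr : ∀ {f : ℝ × ℝ → ℂ}, eLpNorm f 2 (volume.restrict halfPlane) ≤ eLpNorm f 2 volume :=
    fun {f} => eLpNorm_mono_measure f Measure.restrict_le_self
  have hmr : ∀ {f : ℝ × ℝ → ℂ}, MemLp f 2 volume →
    AEStronglyMeasurable f (volume.restrict halfPlane) := fun hf => (hf.restrict _).1
  have hχ1 : ∀ n p, ‖(χ n p - 1 : ℝ)‖ ≤ 2 := fun n p => by
    rw [Real.norm_eq_abs]
    have := abs_sub (χ n p) 1
    have := h2 n p
    rw [abs_one] at *
    linarith
  have hFt : Tendsto (fun n => eLpNorm (fun p => F n p - ω p) 2 (volume.restrict halfPlane))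
      atTop (𝓝 0) := by
    refine tendsto_eLpNorm_zero_of_dominated (g := fun p => 2 * ‖ω p‖)
      (fun n => (hmr (hF n)).sub h.memLp.1) (h.memLp.norm.const_mul 2)
      (fun n => ae_of_all _ fun p => ?_) ?_
    · have : F n p - ω p = (χ n p - 1) • ω p := by simp [F, sub_mul]
      rw [this, norm_smul]
      exact mul_le_mul_of_nonneg_right (hχ1 n p) (norm_nonneg _)
    · filter_upwards [ae_restrict_mem measurableSet_halfPlane] with p hp
      refine tendsto_const_nhds.congr' ?_
      filter_upwards [h5 p hp] with n hn
      simp [F, hn.eq_of_nhds]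
  have hGt : ∀ i, Tendsto (fun n => eLpNorm (fun p => G n i p - g i p) 2
      (volume.restrict halfPlane)) atTop (𝓝 0) := by
    intro i
    refine tendsto_eLpNorm_zero_of_dominated
      (g := fun p => 2 * ‖g i p‖ + C * (‖ω p / (p.1 : ℂ)‖ + ‖ω p‖))
      (fun n => (hmr (hG n i)).sub (hg i).1)
      (((hg i).norm.const_mul 2).add ((h.hardy.norm.add h.memLp.norm).const_mul C))
      (fun n => ?_) ?_
    · filter_upwards [ae_restrict_mem measurableSet_halfPlane] with p hp
      have hp' : (0 : ℝ) < p.1 := hp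
      have e : G n i p - g i p = (χ n p - 1) • g i p + fderiv ℝ (χ n) p (v i) • ω p := by
        simp [G, sub_mul]; ring
      rw [e]
      refine (norm_add_le _ _).trans (add_le_add ?_ ?_)
      · rw [norm_smul]
        exact mul_le_mul_of_nonneg_right (hχ1 n p) (norm_nonneg _)
      · have hb : |fderiv ℝ (χ n) p (v i)| ≤ C * (1 / p.1 + 1) := by
          fin_cases i
          · exact h3 n p hp
          · have h6 : 0 < 1 / p.1 := by positivity
            exact (h4 n p hp).trans (by nlinarith)
        rw [norm_smul, norm_div, Complex.norm_real, Real.norm_eq_abs, Real.norm_eq_abs,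
          abs_of_pos hp']
        calc _ ≤ C * (1 / p.1 + 1) * ‖ω p‖ := mul_le_mul_of_nonneg_right hb (norm_nonneg _)
          _ = _ := by ring
    · filter_upwards [ae_restrict_mem measurableSet_halfPlane] with p hp
      refine tendsto_const_nhds.congr' ?_
      filter_upwards [h5 p hp] with n hn
      simp [G, hn.eq_of_nhds, hn.fderiv_eq]
  have hφt : ∀ i, Tendsto (fun n => eLpNorm (fun p => fderiv ℝ (φ n) p (v i) - g i p) 2
      (volume.restrict halfPlane)) atTop (𝓝 0) := fun i =>
    tendsto_eLpNorm_sub_of_tendsto (fun n => hmr ((hφ n).memLp_fderiv _)) (fun n => hmr (hG n i))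
      (hg i).1 (hsq fun n => hr.trans (hφG n i)) (hGt i)
  exact ⟨φ, hφ, tendsto_eLpNorm_sub_of_tendsto (fun n => hmr (hφ n).memLp) (fun n => hmr (hF n))
    h.memLp.1 (hsq fun n => hr.trans (hφF n)) hFt, hφt 0, hφt 1⟩

/-! ### Inequalities on lines and the trace inequality -/

section Line

variable {f : ℝ → ℂ}

theorem hasDerivAt_norm_sq (hf : ContDiff ℝ (⊤ : ℕ∞) f) (t : ℝ) :
    HasDerivAt (fun t => ‖f t‖ ^ 2) (2 * ⟪f t, deriv f t⟫_ℝ) t :=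
  (hf.differentiable (by simp) t).hasDerivAt.norm_sq

/-- The square (‖w‖ - k‖z‖)² is nonnegative. -/
theorem abs_two_inner_le (k : ℝ) (z w : ℂ) :
    k * |2 * ⟪z, w⟫_ℝ| ≤ ‖w‖ ^ 2 + k ^ 2 * ‖z‖ ^ 2 := by
  rcases le_or_gt k 0 with hk | hk
  · have : k * |2 * ⟪z, w⟫_ℝ| ≤ 0 := mul_nonpos_of_nonpos_of_nonneg hk (abs_nonneg _)
    exact this.trans (by positivity)
  have h1 := abs_real_inner_le_norm z w
  rw [abs_mul, abs_two]
  nlinarith [sq_nonneg (‖w‖ - k * ‖z‖), mul_le_mul_of_nonneg_left h1 hk.le]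

theorem integrable_norm_sq_of_test (hf : Continuous f) (hc : HasCompactSupport f) :
    Integrable fun t => ‖f t‖ ^ 2 :=
  (hf.norm.pow 2).integrable_of_hasCompactSupport
    (HasCompactSupport.intro hc fun t ht => by simp [image_eq_zero_of_notMem_tsupport ht])

theorem integrable_energy (hf : ContDiff ℝ (⊤ : ℕ∞) f) (hc : HasCompactSupport f) (k : ℝ) :
    Integrable fun t => ‖deriv f t‖ ^ 2 + k ^ 2 * ‖f t‖ ^ 2 :=
  (integrable_norm_sq_of_test (hf.continuous_deriv (by simp)) hc.deriv).add
    ((integrable_norm_sq_of_test hf.continuous hc).const_mul _)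

theorem contDiff_norm_sq_test (hf : ContDiff ℝ (⊤ : ℕ∞) f) :
    ContDiff ℝ 1 fun t => ‖f t‖ ^ 2 := (hf.norm_sq ℝ).of_le (by exact_mod_cast le_top)

theorem hasCompactSupport_norm_sq (hc : HasCompactSupport f) :
    HasCompactSupport fun t => ‖f t‖ ^ 2 :=
  HasCompactSupport.intro hc fun t ht => by simp [image_eq_zero_of_notMem_tsupport ht]

theorem integrable_deriv_norm_sq (hf : ContDiff ℝ (⊤ : ℕ∞) f) (hc : HasCompactSupport f) :
    Integrable (deriv fun t => ‖f t‖ ^ 2) :=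
  ((contDiff_norm_sq_test hf).continuous_deriv le_rfl).integrable_of_hasCompactSupport
    (hasCompactSupport_norm_sq hc).deriv

/-- Write |f(a)|² as the integral of its derivative and apply `abs_two_inner_le` pointwise.
Exponentials exp(kt) would give equality, which is why this half-line bound yields the sharp bottom
of the transverse operator; with k = 1 it also yields the trace inequality. -/
theorem mul_norm_sq_le_integral_Iic (hf : ContDiff ℝ (⊤ : ℕ∞) f) (hc : HasCompactSupport f)
    {k : ℝ} (hk : 0 ≤ k) (a : ℝ) :
    k * ‖f a‖ ^ 2 ≤ ∫ t in Iic a, (‖deriv f t‖ ^ 2 + k ^ 2 * ‖f t‖ ^ 2) := by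
  rw [← (hasCompactSupport_norm_sq hc).integral_Iic_deriv_eq (contDiff_norm_sq_test hf) a,
    ← integral_const_mul]
  refine integral_mono ((integrable_deriv_norm_sq hf hc).restrict.const_mul k)
    (integrable_energy hf hc k).restrict fun t => ?_
  simp only [(hasDerivAt_norm_sq hf t).deriv]
  exact (mul_le_mul_of_nonneg_left (le_abs_self _) hk).trans (abs_two_inner_le k _ _)

theorem mul_norm_sq_le_integral_Ioi (hf : ContDiff ℝ (⊤ : ℕ∞) f) (hc : HasCompactSupport f)
    {k : ℝ} (hk : 0 ≤ k) (a : ℝ) :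
    k * ‖f a‖ ^ 2 ≤ ∫ t in Ioi a, (‖deriv f t‖ ^ 2 + k ^ 2 * ‖f t‖ ^ 2) := by
  have h := (hasCompactSupport_norm_sq hc).integral_Ioi_deriv_eq (contDiff_norm_sq_test hf) a
  rw [← neg_eq_iff_eq_neg.2 h, ← integral_neg, ← integral_const_mul]
  refine integral_mono ((integrable_deriv_norm_sq hf hc).restrict.neg.const_mul k)
    (integrable_energy hf hc k).restrict fun t => ?_
  simp only [(hasDerivAt_norm_sq hf t).deriv]
  exact (mul_le_mul_of_nonneg_left (neg_le_abs _) hk).trans (abs_two_inner_le k _ _)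

theorem norm_sq_le_integral (hf : ContDiff ℝ (⊤ : ℕ∞) f) (hc : HasCompactSupport f) (a : ℝ) :
    ‖f a‖ ^ 2 ≤ ∫ t, (‖f t‖ ^ 2 + ‖deriv f t‖ ^ 2) := by
  have h := mul_norm_sq_le_integral_Iic hf hc zero_le_one a
  have hi := integrable_energy hf hc 1
  rw [one_mul] at h
  refine h.trans ((setIntegral_le_integral hi (ae_of_all _ fun t => by positivity)).trans
    (le_of_eq (integral_congr_ae (ae_of_all _ fun t => ?_))))
  simp only
  ring

end Line

theorem restrict_halfPlane_eq_prod : (volume.restrict halfPlane : Measure (ℝ × ℝ))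
    = (volume.restrict (Ioi (0 : ℝ))).prod volume := by
  have : halfPlane = Ioi (0 : ℝ) ×ˢ (univ : Set ℝ) := by ext p; simp [halfPlane]
  rw [this, Measure.volume_eq_prod, ← Measure.prod_restrict, Measure.restrict_univ]

theorem eLpNorm_sq_eq_ofReal {α F : Type*} [MeasurableSpace α] [NormedAddCommGroup F]
    {ν : Measure α} {f : α → F} (hf : MemLp f 2 ν) :
    eLpNorm f 2 ν ^ 2 = ENNReal.ofReal (∫ a, ‖f a‖ ^ 2 ∂ν) := by
  rw [lintegral_enorm_sq, ofReal_integral_eq_lintegral_ofReal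
    ((memLp_two_iff_integrable_sq_norm hf.1).1 hf) (ae_of_all _ fun a => by positivity)]
  refine lintegral_congr fun a => ?_
  rw [ENNReal.ofReal_pow (norm_nonneg _), ofReal_norm]

theorem contDiff_vertical {φ : ℝ × ℝ → ℂ} (hφ : ContDiff ℝ (⊤ : ℕ∞) φ) (r : ℝ) :
    ContDiff ℝ (⊤ : ℕ∞) fun z => φ (r, z) := hφ.comp (contDiff_const.prodMk contDiff_id)

theorem isClosedEmbedding_vertical (r : ℝ) : IsClosedEmbedding fun z : ℝ => (r, z) :=
  Isometry.isClosedEmbedding fun a b => by simp [Prod.edist_eq]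

theorem deriv_vertical {φ : ℝ × ℝ → ℂ} (hφ : ContDiff ℝ (⊤ : ℕ∞) φ) (r z : ℝ) :
    deriv (fun z => φ (r, z)) z = fderiv ℝ φ (r, z) (0, 1) :=
  ((hφ.differentiable (by simp) (r, z)).hasFDerivAt.comp_hasDerivAt z
    ((hasDerivAt_const z r).prodMk (hasDerivAt_id z))).deriv

/-- Needed so that a compactly supported function in the plane restricts to a compactly supported
function of the arc length. -/
theorem isClosedEmbedding_ray (θ : ℝ) : IsClosedEmbedding (ray θ) := by
  -- The plane carries the maximum metric, and |sin θ| + |cos θ| ≥ 1 makes the larger of the two at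
  -- least 1/2.
  have h : AntilipschitzWith 2 (ray θ) := by
    refine AntilipschitzWith.of_le_mul_dist fun a b => ?_
    have h1 : |a - b| * |Real.sin θ| ≤ dist (ray θ a) (ray θ b) := by
      rw [← abs_mul, sub_mul]
      exact le_max_left _ _
    have h2 : |a - b| * |Real.cos θ| ≤ dist (ray θ a) (ray θ b) := by
      rw [← abs_mul, sub_mul]
      exact le_max_right _ _
    have h3 : 1 ≤ |Real.sin θ| + |Real.cos θ| := by
      have := Real.sin_sq_add_cos_sq θ
      have e1 := Real.abs_sin_le_one θ
      have e2 := Real.abs_cos_le_one θ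
      rw [← sq_abs (Real.sin θ), ← sq_abs (Real.cos θ)] at this
      nlinarith [abs_nonneg (Real.sin θ), abs_nonneg (Real.cos θ)]
    rw [Real.dist_eq]
    push_cast
    nlinarith [abs_nonneg (a - b)]
  have hc : Continuous (ray θ) :=
    (continuous_id.mul continuous_const).prodMk (continuous_id.mul continuous_const)
  refine h.isClosedEmbedding ?_
  have hl : LipschitzWith 1 (ray θ) := LipschitzWith.of_dist_le_mul fun a b => by
    rw [NNReal.coe_one, one_mul, Prod.dist_eq, Real.dist_eq, Real.dist_eq, Real.dist_eq]
    simp only [ray]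
    rw [← sub_mul, ← sub_mul, abs_mul, abs_mul]
    exact max_le (mul_le_of_le_one_right (abs_nonneg _) (Real.abs_sin_le_one θ))
      (mul_le_of_le_one_right (abs_nonneg _) (Real.abs_cos_le_one θ))
  exact hl.uniformContinuous

theorem memLp_ray {φ : ℝ × ℝ → ℂ} (hφ : ContDiff ℝ (⊤ : ℕ∞) φ) (hc : HasCompactSupport φ) (θ : ℝ) :
    MemLp (fun s => φ (ray θ s)) 2 (volume.restrict (Ioi 0)) :=
  ((hφ.continuous.comp (isClosedEmbedding_ray θ).continuous).memLp_of_hasCompactSupport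
    (hc.comp_isClosedEmbedding (isClosedEmbedding_ray θ))).restrict _

/-- Each point of the ray lies on one vertical line r = s sin θ, where the one-dimensional bound
applies. Integrating over s and substituting r = s sin θ produces the factor 1/sin θ. -/
theorem integral_ray_le {φ : ℝ × ℝ → ℂ} (hφ : ContDiff ℝ (⊤ : ℕ∞) φ) (hc : HasCompactSupport φ)
    {θ : ℝ} (hθ : 0 < Real.sin θ) :
    ∫ s in Ioi 0, ‖φ (ray θ s)‖ ^ 2 ≤
      (Real.sin θ)⁻¹ * ∫ p in halfPlane, (‖φ p‖ ^ 2 + ‖fderiv ℝ φ p (0, 1)‖ ^ 2) := by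
  set G : ℝ × ℝ → ℝ := fun p => ‖φ p‖ ^ 2 + ‖fderiv ℝ φ p (0, 1)‖ ^ 2 with hG
  have hGi : Integrable G := by
    refine Continuous.integrable_of_hasCompactSupport
      ((hφ.continuous.norm.pow 2).add ((continuous_fderiv_apply hφ _).norm.pow 2))
      (HasCompactSupport.intro hc fun p hp => ?_)
    have h2 : fderiv ℝ φ p = 0 := image_eq_zero_of_notMem_tsupport (f := fderiv ℝ φ)
      fun h => hp (tsupport_fderiv_subset ℝ h)
    simp [hG, image_eq_zero_of_notMem_tsupport hp, h2]
  have hGr : Integrable G ((volume.restrict (Ioi (0 : ℝ))).prod volume) := by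
    rw [← restrict_halfPlane_eq_prod]; exact hGi.restrict
  rw [restrict_halfPlane_eq_prod, integral_prod _ hGr]
  set g : ℝ → ℝ := fun r => ∫ z, G (r, z) with hg
  have hgi : IntegrableOn g (Ioi 0) := hGr.integral_prod_left
  have hs : ∫ s in Ioi (0 : ℝ), g (s * Real.sin θ) = (Real.sin θ)⁻¹ * ∫ r in Ioi 0, g r := by
    rw [integral_comp_mul_right_Ioi g 0 hθ, zero_mul, smul_eq_mul]
  rw [← hs]
  refine integral_mono
    ((memLp_two_iff_integrable_sq_norm (memLp_ray hφ hc θ).1).1 (memLp_ray hφ hc θ)) ?_ fun s => ?_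
  · have := (integrableOn_Ioi_comp_mul_right_iff g 0 hθ).2 (by rwa [zero_mul])
    exact this
  · have := norm_sq_le_integral (contDiff_vertical hφ (s * Real.sin θ))
      (hc.comp_isClosedEmbedding (isClosedEmbedding_vertical _)) (s * Real.cos θ)
    simp only [deriv_vertical hφ] at this
    exact this

/-- The trace inequality for smooth functions. -/
theorem eLpNorm_ray_le {φ : ℝ × ℝ → ℂ} (hφ : ContDiff ℝ (⊤ : ℕ∞) φ) (hc : HasCompactSupport φ)
    {θ : ℝ} (hθ : 0 < Real.sin θ) :
    eLpNorm (fun s => φ (ray θ s)) 2 (volume.restrict (Ioi 0)) ≤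
      ENNReal.ofReal (Real.sin θ)⁻¹ * (eLpNorm φ 2 (volume.restrict halfPlane) +
        eLpNorm (fun p => fderiv ℝ φ p (0, 1)) 2 (volume.restrict halfPlane)) := by
  have m1 : MemLp φ 2 (volume.restrict halfPlane) :=
    (hφ.continuous.memLp_of_hasCompactSupport hc).restrict _
  have m2 : MemLp (fun p => fderiv ℝ φ p (0, 1)) 2 (volume.restrict halfPlane) :=
    ((continuous_fderiv_apply hφ _).memLp_of_hasCompactSupport (hc.fderiv_apply ℝ _)).restrict _
  have i1 := (memLp_two_iff_integrable_sq_norm m1.1).1 m1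
  have i2 := (memLp_two_iff_integrable_sq_norm m2.1).1 m2
  set c := ENNReal.ofReal (Real.sin θ)⁻¹ with hcdef
  -- Since c ≥ 1, it may be replaced by c² when the squared inequality is compared with the square
  -- of the claim.
  have hc1 : 1 ≤ c := by
    rw [hcdef, ENNReal.one_le_ofReal]
    exact (one_le_inv₀ hθ).2 (Real.sin_le_one θ)
  rw [← ENNReal.pow_le_pow_left_iff two_ne_zero, eLpNorm_sq_eq_ofReal (memLp_ray hφ hc θ)]
  refine (ENNReal.ofReal_le_ofReal (integral_ray_le hφ hc hθ)).trans ?_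
  rw [integral_add i1 i2, ENNReal.ofReal_mul (inv_nonneg.2 hθ.le), ENNReal.ofReal_add
    (integral_nonneg fun _ => by positivity) (integral_nonneg fun _ => by positivity),
    ← eLpNorm_sq_eq_ofReal m1, ← eLpNorm_sq_eq_ofReal m2, mul_pow]
  set x := eLpNorm φ 2 (volume.restrict halfPlane)
  set y := eLpNorm (fun p => fderiv ℝ φ p (0, 1)) 2 (volume.restrict halfPlane)
  gcongr
  · calc c = c * 1 := (mul_one c).symm
      _ ≤ c * c := by gcongr
      _ = c ^ 2 := (sq c).symm
  · calc x ^ 2 + y ^ 2 ≤ x ^ 2 + y ^ 2 + 2 * x * y := le_self_add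
      _ = (x + y) ^ 2 := by ring

/-! ### The trace on the half-line -/

section Trace

variable {θ : ℝ} {ω ω' : ℝ × ℝ → ℂ}

theorem eLpNorm_sub_le_add {α : Type*} [MeasurableSpace α] {ν : Measure α} {f g h : α → ℂ}
    (hf : AEStronglyMeasurable f ν) (hg : AEStronglyMeasurable g ν)
    (hh : AEStronglyMeasurable h ν) :
    eLpNorm (fun p => f p - g p) 2 ν ≤
      eLpNorm (fun p => f p - h p) 2 ν + eLpNorm (fun p => g p - h p) 2 ν := by
  have e : (fun p => f p - g p) = (fun p => f p - h p) - fun p => g p - h p := by ext p; simp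
  rw [e]
  exact eLpNorm_sub_le (hf.sub hh) (hg.sub hh) one_le_two

theorem aestronglyMeasurable_test {φ : ℝ × ℝ → ℂ} (hφ : ContDiff ℝ (⊤ : ℕ∞) φ) :
    AEStronglyMeasurable φ (volume.restrict halfPlane) := hφ.continuous.aestronglyMeasurable

theorem aestronglyMeasurable_test_fderiv {φ : ℝ × ℝ → ℂ} (hφ : ContDiff ℝ (⊤ : ℕ∞) φ)
    (v : ℝ × ℝ) : AEStronglyMeasurable (fun p => fderiv ℝ φ p v) (volume.restrict halfPlane) :=
  (continuous_fderiv_apply hφ v).aestronglyMeasurable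

/-- The distance to `ω` that controls the distance of the traces. -/
noncomputable def traceDist (φ ω : ℝ × ℝ → ℂ) : ENNReal :=
  eLpNorm (fun p => φ p - ω p) 2 (volume.restrict halfPlane) +
    eLpNorm (fun p => fderiv ℝ φ p (0, 1) - dz ω p) 2 (volume.restrict halfPlane)

theorem eLpNorm_ray_sub_le (hω : Admissible ω) (hθ : 0 < Real.sin θ) {φ ψ : ℝ × ℝ → ℂ}
    (hφ : ContDiff ℝ (⊤ : ℕ∞) φ) (hφc : HasCompactSupport φ)
    (hψ : ContDiff ℝ (⊤ : ℕ∞) ψ) (hψc : HasCompactSupport ψ) :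
    eLpNorm (fun s => φ (ray θ s) - ψ (ray θ s)) 2 (volume.restrict (Ioi 0)) ≤
      ENNReal.ofReal (Real.sin θ)⁻¹ * (traceDist φ ω + traceDist ψ ω) := by
  refine (eLpNorm_ray_le (hφ.sub hψ) (hφc.sub hψc) hθ).trans (mul_le_mul' le_rfl ?_)
  have e : ∀ p, fderiv ℝ (φ - ψ) p (0, 1) = fderiv ℝ φ p (0, 1) - fderiv ℝ ψ p (0, 1) := fun p => by
    rw [fderiv_sub (hφ.differentiable (by simp) p) (hψ.differentiable (by simp) p)]; rfl
  have h1 := eLpNorm_sub_le_add (aestronglyMeasurable_test hφ) (aestronglyMeasurable_test hψ)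
    hω.memLp.1
  have h2 := eLpNorm_sub_le_add (aestronglyMeasurable_test_fderiv hφ (0, 1))
    (aestronglyMeasurable_test_fderiv hψ (0, 1)) hω.dz_spec.1.1
  simp only [← e] at h2
  refine (add_le_add h1 h2).trans (le_of_eq ?_)
  simp only [traceDist]
  ring

theorem H1Tendsto.traceDist {φ : ℕ → ℝ × ℝ → ℂ} (h : H1Tendsto φ ω) :
    Tendsto (fun n => traceDist (φ n) ω) atTop (𝓝 0) := by
  simpa [ConicalSurface.traceDist] using h.val.add h.dz

/-- Restrictions of smooth approximations converge to the trace, whichever are chosen. -/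
theorem IsTrace.tendsto (hω : Admissible ω) (hθ : 0 < Real.sin θ) {τ : ℝ → ℂ}
    (hτ : IsTrace θ ω τ) {ψ : ℕ → ℝ × ℝ → ℂ}
    (hψ : ∀ n, ContDiff ℝ (⊤ : ℕ∞) (ψ n) ∧ HasCompactSupport (ψ n)) (h : H1Tendsto ψ ω) :
    Tendsto (fun n => eLpNorm (fun s => ψ n (ray θ s) - τ s) 2 (volume.restrict (Ioi 0)))
      atTop (𝓝 0) := by
  obtain ⟨-, hm, φ, hφ, h1, h2, h3, h4⟩ := hτ
  have h5 : H1Tendsto φ ω := ⟨h1, h2, h3⟩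
  refine tendsto_eLpNorm_sub_of_tendsto (fun n => (memLp_ray (hψ n).1 (hψ n).2 θ).1)
    (fun n => (memLp_ray (hφ n).1 (hφ n).2 θ).1) hm.1 ?_ h4
  have h6 := ENNReal.Tendsto.const_mul (a := ENNReal.ofReal (Real.sin θ)⁻¹)
    (h.traceDist.add h5.traceDist) (Or.inr ENNReal.ofReal_ne_top)
  rw [add_zero, mul_zero] at h6
  exact tendsto_of_tendsto_of_tendsto_of_le_of_le tendsto_const_nhds h6 (fun n => zero_le)
    fun n => eLpNorm_ray_sub_le hω hθ (hψ n).1 (hψ n).2 (hφ n).1 (hφ n).2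

theorem ae_eq_of_tendsto_eLpNorm {α : Type*} [MeasurableSpace α] {ν : Measure α}
    {f : ℕ → α → ℂ} {g h : α → ℂ} (hf : ∀ n, AEStronglyMeasurable (f n) ν)
    (hg : AEStronglyMeasurable g ν) (hh : AEStronglyMeasurable h ν)
    (h1 : Tendsto (fun n => eLpNorm (fun p => f n p - g p) 2 ν) atTop (𝓝 0))
    (h2 : Tendsto (fun n => eLpNorm (fun p => f n p - h p) 2 ν) atTop (𝓝 0)) : g =ᵐ[ν] h := by
  have h3 : eLpNorm (fun p => g p - h p) 2 ν ≤ 0 := by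
    have h4 := h1.add h2
    rw [add_zero] at h4
    refine ge_of_tendsto' h4 fun n => ?_
    have e : (fun p => g p - h p) = (fun p => f n p - h p) - fun p => f n p - g p := by ext p; simp
    rw [e, add_comm]
    exact eLpNorm_sub_le ((hf n).sub hh) ((hf n).sub hg) one_le_two
  have h5 := (eLpNorm_eq_zero_iff (hg.sub hh) two_ne_zero).1 (le_antisymm h3 zero_le)
  filter_upwards [h5] with a ha
  exact sub_eq_zero.1 ha

theorem IsTrace.unique (hω : Admissible ω) (hθ : 0 < Real.sin θ) {τ τ' : ℝ → ℂ}
    (hτ : IsTrace θ ω τ) (hτ' : IsTrace θ ω τ') : τ =ᵐ[volume.restrict (Ioi 0)] τ' := by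
  obtain ⟨φ, hφ, h⟩ := hω.exists_test_tendsto
  exact ae_eq_of_tendsto_eLpNorm (fun n => (memLp_ray (hφ n).smooth (hφ n).compact θ).1)
    hτ.2.1.1 hτ'.2.1.1
    (hτ.tendsto hω hθ (fun n => ⟨(hφ n).smooth, (hφ n).compact⟩) h)
    (hτ'.tendsto hω hθ (fun n => ⟨(hφ n).smooth, (hφ n).compact⟩) h)

/-- By the trace inequality the restrictions of an approximating sequence are Cauchy in L² of the
ray, and completeness provides the limit. -/
theorem Admissible.exists_isTrace (hω : Admissible ω) (hθ : 0 < Real.sin θ) :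
    ∃ τ, IsTrace θ ω τ := by
  obtain ⟨φ, hφ, h⟩ := hω.exists_test_tendsto
  have hm : ∀ n, MemLp (fun s => φ n (ray θ s)) 2 (volume.restrict (Ioi 0)) := fun n =>
    memLp_ray (hφ n).smooth (hφ n).compact θ
  have hC : CauchySeq fun n => (hm n).toLp := by
    rw [EMetric.cauchySeq_iff]
    intro ε hε
    have h6 := ENNReal.Tendsto.const_mul (a := ENNReal.ofReal (Real.sin θ)⁻¹)
      h.traceDist (Or.inr ENNReal.ofReal_ne_top)
    rw [mul_zero] at h6
    obtain ⟨N, hN⟩ := eventually_atTop.1 (h6.eventually (gt_mem_nhds (ENNReal.half_pos hε.ne')))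
    refine ⟨N, fun m hmN n hnN => ?_⟩
    rw [Lp.edist_toLp_toLp]
    calc _ ≤ ENNReal.ofReal (Real.sin θ)⁻¹ * (ConicalSurface.traceDist (φ m) ω
            + ConicalSurface.traceDist (φ n) ω) :=
          eLpNorm_ray_sub_le hω hθ (hφ m).smooth (hφ m).compact (hφ n).smooth (hφ n).compact
      _ = _ := mul_add _ _ _
      _ < ε / 2 + ε / 2 := ENNReal.add_lt_add (hN m hmN) (hN n hnN)
      _ = ε := ENNReal.add_halves ε
  obtain ⟨τ, hτ⟩ := cauchySeq_tendsto_of_complete hC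
  refine ⟨τ, hω.memH1, Lp.memLp τ, φ, fun n => ⟨(hφ n).smooth, (hφ n).compact⟩, h.val, h.dr, h.dz,
    ?_⟩
  rw [Lp.tendsto_Lp_iff_tendsto_eLpNorm'] at hτ
  refine hτ.congr fun n => eLpNorm_congr_ae ?_
  filter_upwards [(hm n).coeFn_toLp] with s hs
  rw [Pi.sub_apply, hs]

theorem Admissible.isTrace_trace (hω : Admissible ω) (hθ : 0 < Real.sin θ) :
    IsTrace θ ω (trace θ ω) := by
  have h := hω.exists_isTrace hθ
  rw [trace, dif_pos h]
  exact h.choose_spec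

theorem Admissible.memLp_trace (hω : Admissible ω) (hθ : 0 < Real.sin θ) :
    MemLp (trace θ ω) 2 (volume.restrict (Ioi 0)) := (hω.isTrace_trace hθ).2.1

theorem tendsto_eLpNorm_congr {α : Type*} [MeasurableSpace α] {ν : Measure α}
    {f : ℕ → α → ℂ} {g h : α → ℂ} (hgh : h =ᵐ[ν] g)
    (h1 : Tendsto (fun n => eLpNorm (fun p => f n p - g p) 2 ν) atTop (𝓝 0)) :
    Tendsto (fun n => eLpNorm (fun p => f n p - h p) 2 ν) atTop (𝓝 0) := by
  refine h1.congr fun n => eLpNorm_congr_ae ?_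
  filter_upwards [hgh] with a ha
  rw [ha]

theorem tendsto_eLpNorm_add {α : Type*} [MeasurableSpace α] {ν : Measure α}
    {f f' : ℕ → α → ℂ} {g g' : α → ℂ} (hf : ∀ n, AEStronglyMeasurable (f n) ν)
    (hf' : ∀ n, AEStronglyMeasurable (f' n) ν)
    (hg : AEStronglyMeasurable g ν) (hg' : AEStronglyMeasurable g' ν)
    (h1 : Tendsto (fun n => eLpNorm (fun p => f n p - g p) 2 ν) atTop (𝓝 0))
    (h2 : Tendsto (fun n => eLpNorm (fun p => f' n p - g' p) 2 ν) atTop (𝓝 0)) :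
    Tendsto (fun n => eLpNorm (fun p => (f n + f' n) p - (g + g') p) 2 ν) atTop (𝓝 0) := by
  have h4 := h1.add h2
  rw [add_zero] at h4
  refine tendsto_of_tendsto_of_tendsto_of_le_of_le tendsto_const_nhds h4 (fun n => zero_le)
    fun n => ?_
  have e : (fun p => (f n + f' n) p - (g + g') p)
    = (fun p => f n p - g p) + fun p => f' n p - g' p := by ext p; simp; ring
  simp only [e]
  exact eLpNorm_add_le ((hf n).sub hg) ((hf' n).sub hg') one_le_two

theorem tendsto_eLpNorm_const_smul {α : Type*} [MeasurableSpace α] {ν : Measure α}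
    {f : ℕ → α → ℂ} {g : α → ℂ} (c : ℂ)
    (h1 : Tendsto (fun n => eLpNorm (fun p => f n p - g p) 2 ν) atTop (𝓝 0)) :
    Tendsto (fun n => eLpNorm (fun p => (c • f n) p - (c • g) p) 2 ν) atTop (𝓝 0) := by
  have h2 := ENNReal.Tendsto.const_mul (a := ‖c‖ₑ) h1 (Or.inr enorm_ne_top)
  rw [mul_zero] at h2
  refine h2.congr fun n => ?_
  rw [← eLpNorm_const_smul]
  congr 1
  ext p
  simp [mul_sub]

theorem Admissible.trace_congr (hω : Admissible ω) (hθ : 0 < Real.sin θ)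
    (e : ω =ᵐ[volume.restrict halfPlane] ω') :
    trace θ ω' =ᵐ[volume.restrict (Ioi 0)] trace θ ω := by
  obtain ⟨h0, h1, h2⟩ := hω.congr e
  obtain ⟨-, hm, φ, hφ, t1, t2, t3, t4⟩ := hω.isTrace_trace hθ
  exact (h0.isTrace_trace hθ).unique h0 hθ ⟨h0.memH1, hm, φ, hφ, tendsto_eLpNorm_congr e.symm t1,
    tendsto_eLpNorm_congr h1 t2, tendsto_eLpNorm_congr h2 t3, t4⟩

/-- The sum of two approximating sequences exhibits the sum of the traces as a trace of the sum;
uniqueness then compares it with the chosen one. -/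
theorem Admissible.trace_add (hω : Admissible ω) (hω' : Admissible ω') (hθ : 0 < Real.sin θ) :
    trace θ (ω + ω') =ᵐ[volume.restrict (Ioi 0)] trace θ ω + trace θ ω' := by
  obtain ⟨h0, h1, h2⟩ := hω.add hω'
  obtain ⟨φ, hφ, h⟩ := hω.exists_test_tendsto
  obtain ⟨φ', hφ', h'⟩ := hω'.exists_test_tendsto
  have t := (hω.isTrace_trace hθ).tendsto hω hθ (fun n => ⟨(hφ n).smooth, (hφ n).compact⟩) h
  have t' := (hω'.isTrace_trace hθ).tendsto hω' hθ (fun n => ⟨(hφ' n).smooth, (hφ' n).compact⟩) h'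
  refine (h0.isTrace_trace hθ).unique h0 hθ ⟨h0.memH1,
    (hω.memLp_trace hθ).add (hω'.memLp_trace hθ), fun n => φ n + φ' n, fun n =>
      ⟨(hφ n).smooth.add (hφ' n).smooth, (hφ n).compact.add (hφ' n).compact⟩, ?_, ?_, ?_, ?_⟩
  · exact tendsto_eLpNorm_add (fun n => aestronglyMeasurable_test (hφ n).smooth)
      (fun n => aestronglyMeasurable_test (hφ' n).smooth) hω.memLp.1 hω'.memLp.1 h.val h'.val
  · have := tendsto_eLpNorm_congr h1 (tendsto_eLpNorm_add
      (fun n => aestronglyMeasurable_test_fderiv (hφ n).smooth (1, 0))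
      (fun n => aestronglyMeasurable_test_fderiv (hφ' n).smooth (1, 0)) hω.dr_spec.1.1
      hω'.dr_spec.1.1 h.dr h'.dr)
    refine this.congr fun n => ?_
    simp only [fderiv_add ((hφ n).smooth.differentiable (by simp) _)
      ((hφ' n).smooth.differentiable (by simp) _), Pi.add_apply, add_apply]
  · have := tendsto_eLpNorm_congr h2 (tendsto_eLpNorm_add
      (fun n => aestronglyMeasurable_test_fderiv (hφ n).smooth (0, 1))
      (fun n => aestronglyMeasurable_test_fderiv (hφ' n).smooth (0, 1)) hω.dz_spec.1.1
      hω'.dz_spec.1.1 h.dz h'.dz)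
    refine this.congr fun n => ?_
    simp only [fderiv_add ((hφ n).smooth.differentiable (by simp) _)
      ((hφ' n).smooth.differentiable (by simp) _), Pi.add_apply, add_apply]
  · exact tendsto_eLpNorm_add (fun n => (memLp_ray (hφ n).smooth (hφ n).compact θ).1)
      (fun n => (memLp_ray (hφ' n).smooth (hφ' n).compact θ).1) (hω.memLp_trace hθ).1
      (hω'.memLp_trace hθ).1 t t'

theorem Admissible.trace_const_smul (hω : Admissible ω) (hθ : 0 < Real.sin θ) (c : ℂ) :
    trace θ (c • ω) =ᵐ[volume.restrict (Ioi 0)] c • trace θ ω := by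
  obtain ⟨h0, h1, h2⟩ := hω.const_smul c
  obtain ⟨-, hm, φ, hφ, t1, t2, t3, t4⟩ := hω.isTrace_trace hθ
  refine (h0.isTrace_trace hθ).unique h0 hθ ⟨h0.memH1, hm.const_smul c, fun n => c • φ n,
    fun n => ⟨(hφ n).1.const_smul c, (hφ n).2.smul_left⟩,
    tendsto_eLpNorm_const_smul c t1, ?_, ?_, tendsto_eLpNorm_const_smul c t4⟩
  · refine (tendsto_eLpNorm_congr h1 (tendsto_eLpNorm_const_smul c t2)).congr fun n => ?_
    simp only [fderiv_const_smul ((hφ n).1.differentiable (by simp) _), smul_apply, Pi.smul_apply]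
  · refine (tendsto_eLpNorm_congr h2 (tendsto_eLpNorm_const_smul c t3)).congr fun n => ?_
    simp only [fderiv_const_smul ((hφ n).1.differentiable (by simp) _), smul_apply, Pi.smul_apply]

theorem IsTest.trace_ae_eq {φ : ℝ × ℝ → ℂ} (h : IsTest halfPlane φ) (hθ : 0 < Real.sin θ) :
    trace θ φ =ᵐ[volume.restrict (Ioi 0)] fun s => φ (ray θ s) := by
  obtain ⟨h0, h1, h2⟩ := h.admissible
  refine (h0.isTrace_trace hθ).unique h0 hθ ⟨h0.memH1, memLp_ray h.smooth h.compact θ,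
    fun _ => φ, fun _ => ⟨h.smooth, h.compact⟩, ?_, tendsto_eLpNorm_congr h1 ?_,
    tendsto_eLpNorm_congr h2 ?_, ?_⟩ <;> simp

end Trace

/-! ### Rotated coordinates and the lower bound for smooth functions -/

/-- The coordinates `(s, t)` along the half-line and perpendicular to it. -/
noncomputable def rot (θ : ℝ) : ℝ × ℝ →L[ℝ] ℝ × ℝ :=
  (Matrix.toLin (Module.Basis.finTwoProd ℝ) (Module.Basis.finTwoProd ℝ)
    !![Real.sin θ, -Real.cos θ; Real.cos θ, Real.sin θ]).toContinuousLinearMap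

theorem rot_apply (θ : ℝ) (q : ℝ × ℝ) : rot θ q =
    (q.1 * Real.sin θ - q.2 * Real.cos θ, q.1 * Real.cos θ + q.2 * Real.sin θ) := by
  rw [rot, Matrix.toLin_finTwoProd_toContinuousLinearMap]
  simp only [ContinuousLinearMap.prod_apply, add_apply, smul_apply,
    ContinuousLinearMap.coe_fst', ContinuousLinearMap.coe_snd', smul_eq_mul]
  exact Prod.ext (by ring) (by ring)

theorem rot_zero_right (θ s : ℝ) : rot θ (s, 0) = ray θ s := by
  rw [rot_apply]; simp [ray]

theorem measurePreserving_rot (θ : ℝ) : MeasurePreserving (rot θ) := by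
  refine ⟨(rot θ).continuous.measurable, ?_⟩
  have hdet : LinearMap.det (Matrix.toLin (Module.Basis.finTwoProd ℝ) (Module.Basis.finTwoProd ℝ)
      !![Real.sin θ, -Real.cos θ; Real.cos θ, Real.sin θ]) = 1 := by
    rw [LinearMap.det_toLin, Matrix.det_fin_two_of]
    linear_combination Real.sin_sq_add_cos_sq θ
  have := Measure.map_linearMap_addHaar_eq_smul_addHaar (volume : Measure (ℝ × ℝ))
    (f := Matrix.toLin (Module.Basis.finTwoProd ℝ) (Module.Basis.finTwoProd ℝ)
      !![Real.sin θ, -Real.cos θ; Real.cos θ, Real.sin θ]) (by rw [hdet]; exact one_ne_zero)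
  rw [hdet] at this
  simp only [inv_one, abs_one, ENNReal.ofReal_one, one_smul] at this
  exact this

/-- The inverse of `rot`. -/
noncomputable def unrot (θ : ℝ) (p : ℝ × ℝ) : ℝ × ℝ :=
  (p.1 * Real.sin θ + p.2 * Real.cos θ, -(p.1 * Real.cos θ) + p.2 * Real.sin θ)

theorem unrot_rot (θ : ℝ) (q : ℝ × ℝ) : unrot θ (rot θ q) = q := by
  rw [rot_apply, unrot]
  have := Real.sin_sq_add_cos_sq θ
  exact Prod.ext (by simp only; linear_combination q.1 * this)
    (by simp only; linear_combination q.2 * this)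

theorem rot_unrot (θ : ℝ) (p : ℝ × ℝ) : rot θ (unrot θ p) = p := by
  rw [rot_apply, unrot]
  have := Real.sin_sq_add_cos_sq θ
  exact Prod.ext (by simp only; linear_combination p.1 * this)
    (by simp only; linear_combination p.2 * this)

theorem contDiff_unrot (θ : ℝ) : ContDiff ℝ (⊤ : ℕ∞) (unrot θ) := by
  unfold unrot
  fun_prop

/-- `rot` as a homeomorphism. -/
noncomputable def rotHomeomorph (θ : ℝ) : ℝ × ℝ ≃ₜ ℝ × ℝ where
  toFun := rot θ
  invFun := unrot θ
  left_inv := unrot_rot θ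
  right_inv := rot_unrot θ
  continuous_toFun := (rot θ).continuous
  continuous_invFun := (contDiff_unrot θ).continuous

theorem integral_rot {F : Type*} [NormedAddCommGroup F] [NormedSpace ℝ F] (θ : ℝ)
    (f : ℝ × ℝ → F) : ∫ q, f (rot θ q) = ∫ p, f p :=
  (measurePreserving_rot θ).integral_comp (rotHomeomorph θ).measurableEmbedding f

theorem setIntegral_halfPlane_eq_rot {F : Type*} [NormedAddCommGroup F] [NormedSpace ℝ F] (θ : ℝ)
    {f : ℝ × ℝ → F} (hf : ∀ p, p ∉ halfPlane → f p = 0) :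
    ∫ p in halfPlane, f p = ∫ s, f (rot θ s) := by
  rw [integral_rot, setIntegral_eq_integral_of_forall_compl_eq_zero hf]

/-- In rotated coordinates z - r cot θ = t / sin θ, so the interior region is t > 0 and the bias
depends on t alone. -/
theorem biasRZ_rot {V₀ θ : ℝ} (hθ : 0 < Real.sin θ) {q : ℝ × ℝ} (hq : rot θ q ∈ halfPlane) :
    biasRZ V₀ θ (rot θ q) = (Ioi (0 : ℝ)).indicator (fun _ => V₀) q.2 := by
  have hr : 0 < (rot θ q).1 := hq
  have hc : cyl (rot θ q).1 0 (rot θ q).2 ∈ interiorRegion θ ↔ q.2 ∈ Ioi (0 : ℝ) := by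
    have h0 : √((rot θ q).1 ^ 2) = (rot θ q).1 := Real.sqrt_sq hr.le
    simp only [interiorRegion, cyl, Set.mem_ofPred_eq, mem_Ioi]
    simp only [Matrix.cons_val_zero, Matrix.cons_val_one, Matrix.cons_val,
      Real.cos_zero, Real.sin_zero, mul_one, mul_zero]
    rw [show (0 : ℝ) ^ 2 = 0 by norm_num, add_zero, h0, rot_apply, Real.cot_eq_cos_div_sin]
    have e : q.1 * Real.cos θ + q.2 * Real.sin θ - Real.cos θ / Real.sin θ *
        (q.1 * Real.sin θ - q.2 * Real.cos θ) = q.2 / Real.sin θ := by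
      field_simp
      linear_combination q.2 * Real.sin_sq_add_cos_sq θ
    rw [← sub_pos, e, div_pos_iff_of_pos_right hθ]
  by_cases h : q.2 ∈ Ioi (0 : ℝ)
  · rw [biasRZ, bias, indicator_of_mem (hc.2 h), indicator_of_mem h]
  · rw [biasRZ, bias, indicator_of_notMem (fun h' => h (hc.1 h')), indicator_of_notMem h]

theorem threshold_nonpos (α V₀ : ℝ) : threshold α V₀ ≤ 0 := by
  unfold threshold
  split_ifs
  · exact div_nonpos_of_nonpos_of_nonneg (by nlinarith [sq_nonneg (α ^ 2 - V₀)]) (by positivity)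
  · exact le_rfl

/-- The decay rates of the ground state of the transverse operator. -/
theorem exists_rates {α V₀ : ℝ} (hα : 0 < α) (hV₀ : 0 < V₀) : ∃ k₁ k₂ : ℝ, 0 ≤ k₁ ∧ 0 ≤ k₂ ∧
    k₁ + k₂ = α ∧ k₁ ^ 2 ≤ V₀ - threshold α V₀ ∧ k₂ ^ 2 ≤ -threshold α V₀ ∧
    (V₀ < α ^ 2 → k₁ ^ 2 = V₀ - threshold α V₀ ∧ k₂ ^ 2 = -threshold α V₀) := by
  by_cases h : V₀ < α ^ 2
  -- The rates solve k₁ + k₂ = α (the jump of the logarithmic derivative at the δ) and k₁² - k₂² =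
  -- V₀ (equal energy on both sides).
  · have e1 : ((α ^ 2 + V₀) / (2 * α)) ^ 2 = V₀ - threshold α V₀ := by
      rw [threshold, if_pos h]; field_simp; ring
    have e2 : ((α ^ 2 - V₀) / (2 * α)) ^ 2 = - threshold α V₀ := by
      rw [threshold, if_pos h]; field_simp; ring
    exact ⟨(α ^ 2 + V₀) / (2 * α), (α ^ 2 - V₀) / (2 * α), by positivity,
      div_nonneg (by linarith) (by positivity), by field_simp; ring, e1.le, e2.le,
      fun _ => ⟨e1, e2⟩⟩
  -- With V₀ ≥ α² the step alone absorbs the δ: the side t > 0 takes all of α and the threshold is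
  -- 0.
  · exact ⟨α, 0, hα.le, le_rfl, add_zero α, by rw [threshold, if_neg h]; linarith,
      by simp [threshold, if_neg h], fun h' => absurd h' h⟩

/-- The lower bound μ of the transverse operator. The strength α is shared between the half-lines as
k₁ + k₂, and each share is paid for by the energy on its own side, with k₁² ≤ V₀ - μ for t > 0 and
k₂² ≤ -μ for t ≤ 0. -/
theorem mul_norm_sq_le_transverse {α V₀ : ℝ} (hα : 0 < α) (hV₀ : 0 < V₀) {f : ℝ → ℂ}
    (hf : ContDiff ℝ (⊤ : ℕ∞) f) (hc : HasCompactSupport f) :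
    α * ‖f 0‖ ^ 2 ≤ ∫ t, (‖deriv f t‖ ^ 2 +
      ((Ioi (0 : ℝ)).indicator (fun _ => V₀) t - threshold α V₀) * ‖f t‖ ^ 2) := by
  obtain ⟨k₁, k₂, h1, h2, h3, h4, h5, -⟩ := exists_rates hα hV₀
  have i1 := integrable_norm_sq_of_test (hf.continuous_deriv (by simp)) hc.deriv
  have i2 := integrable_norm_sq_of_test hf.continuous hc
  have hi : Integrable fun t => ‖deriv f t‖ ^ 2 +
      ((Ioi (0 : ℝ)).indicator (fun _ => V₀) t - threshold α V₀) * ‖f t‖ ^ 2 := by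
    refine i1.add ?_
    have : (fun t => ((Ioi (0 : ℝ)).indicator (fun _ => V₀) t - threshold α V₀) * ‖f t‖ ^ 2)
        = fun t => (Ioi (0 : ℝ)).indicator (fun t => V₀ * ‖f t‖ ^ 2) t
          - threshold α V₀ * ‖f t‖ ^ 2 := by
      ext t
      by_cases ht : t ∈ Ioi (0 : ℝ) <;> simp [indicator, ht, sub_mul]
    rw [this]
    exact ((i2.const_mul V₀).indicator measurableSet_Ioi).sub (i2.const_mul _)
  rw [← intervalIntegral.integral_Iic_add_Ioi hi.integrableOn hi.integrableOn (b := 0)]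
  have a1 := mul_norm_sq_le_integral_Iic hf hc h2 0
  have a2 := mul_norm_sq_le_integral_Ioi hf hc h1 0
  have b1 : ∫ t in Iic (0 : ℝ), (‖deriv f t‖ ^ 2 + k₂ ^ 2 * ‖f t‖ ^ 2) ≤
      ∫ t in Iic (0 : ℝ), (‖deriv f t‖ ^ 2 +
      ((Ioi (0 : ℝ)).indicator (fun _ => V₀) t - threshold α V₀) * ‖f t‖ ^ 2) := by
    refine setIntegral_mono_on (integrable_energy hf hc k₂).integrableOn hi.integrableOn
      measurableSet_Iic fun t ht => ?_
    rw [indicator_of_notMem (by simpa using ht), zero_sub]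
    gcongr
  have b2 : ∫ t in Ioi (0 : ℝ), (‖deriv f t‖ ^ 2 + k₁ ^ 2 * ‖f t‖ ^ 2) ≤
      ∫ t in Ioi (0 : ℝ), (‖deriv f t‖ ^ 2 +
      ((Ioi (0 : ℝ)).indicator (fun _ => V₀) t - threshold α V₀) * ‖f t‖ ^ 2) := by
    refine setIntegral_mono_on (integrable_energy hf hc k₁).integrableOn hi.integrableOn
      measurableSet_Ioi fun t ht => ?_
    rw [indicator_of_mem ht]
    gcongr
  calc α * ‖f 0‖ ^ 2 = k₁ * ‖f 0‖ ^ 2 + k₂ * ‖f 0‖ ^ 2 := by rw [← h3]; ring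
    _ ≤ _ := by linarith

section Rotated

variable {θ : ℝ} {φ : ℝ × ℝ → ℂ}

theorem contDiff_comp_rot (h : IsTest halfPlane φ) :
    ContDiff ℝ (⊤ : ℕ∞) fun q => φ (rot θ q) := h.smooth.comp (rot θ).contDiff

theorem hasCompactSupport_comp_rot (h : IsTest halfPlane φ) :
    HasCompactSupport fun q => φ (rot θ q) := h.compact.comp_homeomorph (rotHomeomorph θ)

theorem fderiv_comp_rot (h : IsTest halfPlane φ) (q v : ℝ × ℝ) :
    fderiv ℝ (fun q => φ (rot θ q)) q v = v.1 • (Real.sin θ • fderiv ℝ φ (rot θ q) (1, 0)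
      + Real.cos θ • fderiv ℝ φ (rot θ q) (0, 1)) + v.2 • (-Real.cos θ • fderiv ℝ φ (rot θ q) (1, 0)
      + Real.sin θ • fderiv ℝ φ (rot θ q) (0, 1)) := by
  have h1 : HasFDerivAt (fun q => φ (rot θ q)) ((fderiv ℝ φ (rot θ q)).comp (rot θ)) q :=
    (h.smooth.differentiable (by simp) (rot θ q)).hasFDerivAt.comp q (rot θ).hasFDerivAt
  rw [h1.fderiv, ContinuousLinearMap.comp_apply]
  have e : rot θ v = (v.1 * Real.sin θ - v.2 * Real.cos θ) • ((1, 0) : ℝ × ℝ)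
      + (v.1 * Real.cos θ + v.2 * Real.sin θ) • ((0, 1) : ℝ × ℝ) := by
    rw [rot_apply]; simp
  rw [e, map_add, map_smul, map_smul]
  module

theorem gradient_comp_rot {ψ : ℝ × ℝ → ℂ} (h : IsTest halfPlane φ) (h' : IsTest halfPlane ψ)
    (q : ℝ × ℝ) :
    conj (fderiv ℝ φ (rot θ q) (1, 0)) * fderiv ℝ ψ (rot θ q) (1, 0)
      + conj (fderiv ℝ φ (rot θ q) (0, 1)) * fderiv ℝ ψ (rot θ q) (0, 1)
    = conj (fderiv ℝ (fun q => φ (rot θ q)) q (1, 0)) * fderiv ℝ (fun q => ψ (rot θ q)) q (1, 0)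
      + conj (fderiv ℝ (fun q => φ (rot θ q)) q (0, 1)) * fderiv ℝ (fun q => ψ (rot θ q)) q (0, 1)
    := by
  have hs : ((Real.sin θ : ℂ)) ^ 2 + (Real.cos θ : ℂ) ^ 2 = 1 := by
    exact_mod_cast Real.sin_sq_add_cos_sq θ
  simp only [fderiv_comp_rot h, fderiv_comp_rot h', one_smul, zero_smul, add_zero, zero_add,
    Complex.real_smul, map_add, map_mul, Complex.conj_ofReal, Complex.ofReal_neg, map_neg]
  linear_combination -(conj (fderiv ℝ φ (rot θ q) (1, 0)) * fderiv ℝ ψ (rot θ q) (1, 0)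
      + conj (fderiv ℝ φ (rot θ q) (0, 1)) * fderiv ℝ ψ (rot θ q) (0, 1)) * hs

theorem gradient_sq_comp_rot (h : IsTest halfPlane φ) (q : ℝ × ℝ) :
    ‖fderiv ℝ φ (rot θ q) (1, 0)‖ ^ 2 + ‖fderiv ℝ φ (rot θ q) (0, 1)‖ ^ 2
      = ‖fderiv ℝ (fun q => φ (rot θ q)) q (1, 0)‖ ^ 2
        + ‖fderiv ℝ (fun q => φ (rot θ q)) q (0, 1)‖ ^ 2 := by
  have := gradient_comp_rot (θ := θ) h h q
  simp only [Complex.conj_mul'] at this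
  exact_mod_cast this

theorem IsTest.eq_zero (h : IsTest halfPlane φ) {p : ℝ × ℝ} (hp : p ∉ halfPlane) : φ p = 0 :=
  image_eq_zero_of_notMem_tsupport fun h' => hp (h.support h')

theorem IsTest.fderiv_eq_zero (h : IsTest halfPlane φ) {p : ℝ × ℝ} (hp : p ∉ halfPlane) :
    fderiv ℝ φ p = 0 :=
  image_eq_zero_of_notMem_tsupport (f := fderiv ℝ φ)
    fun h' => hp (h.support (tsupport_fderiv_subset ℝ h'))

theorem integrable_of_continuous_test {F : Type*} [NormedAddCommGroup F] {f : ℝ × ℝ → F}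
    {φ : ℝ × ℝ → ℂ} (hc : HasCompactSupport φ) (hf : Continuous f)
    (hz : ∀ p, p ∉ tsupport φ → f p = 0) : Integrable f :=
  hf.integrable_of_hasCompactSupport (HasCompactSupport.intro hc hz)

/-- The lower bound for the quadratic form without the centrifugal term. -/
theorem IsTest.lower_bound {α V₀ : ℝ} (hα : 0 < α) (hV₀ : 0 < V₀) (hθ : 0 < Real.sin θ)
    (h : IsTest halfPlane φ) :
    threshold α V₀ * (∫ p in halfPlane, ‖φ p‖ ^ 2) ≤
      (∫ p in halfPlane, (‖fderiv ℝ φ p (1, 0)‖ ^ 2 + ‖fderiv ℝ φ p (0, 1)‖ ^ 2))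
        + (∫ p in halfPlane, biasRZ V₀ θ p * ‖φ p‖ ^ 2)
        - α * ∫ s in Ioi (0 : ℝ), ‖φ (ray θ s)‖ ^ 2 := by
  set Φ : ℝ × ℝ → ℂ := fun q => φ (rot θ q) with hΦ
  have hs : ContDiff ℝ (⊤ : ℕ∞) Φ := contDiff_comp_rot h
  have hc : HasCompactSupport Φ := hasCompactSupport_comp_rot h
  have hz : ∀ q, q ∉ tsupport Φ → Φ q = 0 := fun q hq => image_eq_zero_of_notMem_tsupport hq
  have hz' : ∀ q, q ∉ tsupport Φ → fderiv ℝ Φ q = 0 := fun q hq =>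
    image_eq_zero_of_notMem_tsupport (f := fderiv ℝ Φ) fun h => hq (tsupport_fderiv_subset ℝ h)
  set W : ℝ → ℝ := (Ioi (0 : ℝ)).indicator (fun _ => V₀) with hW
  have i0 : Integrable fun q => ‖Φ q‖ ^ 2 :=
    integrable_of_continuous_test hc (hs.continuous.norm.pow 2) fun q hq => by simp [hz q hq]
  have i1 : ∀ v, Integrable fun q => ‖fderiv ℝ Φ q v‖ ^ 2 := fun v =>
    integrable_of_continuous_test hc ((continuous_fderiv_apply hs v).norm.pow 2)
      fun q hq => by simp [hz' q hq]
  have i2 : Integrable fun q : ℝ × ℝ => W q.2 * ‖Φ q‖ ^ 2 := by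
    refine i0.bdd_mul (c := V₀) ?_ (ae_of_all _ fun q => ?_)
    · exact ((measurable_const.indicator measurableSet_Ioi).comp
        measurable_snd).aestronglyMeasurable
    · by_cases hq : q.2 ∈ Ioi (0 : ℝ)
      · simp [hW, indicator_of_mem hq, abs_of_pos hV₀]
      · simp [hW, indicator_of_notMem hq, hV₀.le]
  have e0 : ∫ p in halfPlane, ‖φ p‖ ^ 2 = ∫ q, ‖Φ q‖ ^ 2 :=
    setIntegral_halfPlane_eq_rot θ fun p hp => by simp [h.eq_zero hp]
  have e1 : ∫ p in halfPlane, (‖fderiv ℝ φ p (1, 0)‖ ^ 2 + ‖fderiv ℝ φ p (0, 1)‖ ^ 2)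
      = (∫ q, ‖fderiv ℝ Φ q (1, 0)‖ ^ 2) + ∫ q, ‖fderiv ℝ Φ q (0, 1)‖ ^ 2 := by
    rw [setIntegral_halfPlane_eq_rot θ fun p hp => by simp [h.fderiv_eq_zero hp],
      ← integral_add (i1 _) (i1 _)]
    simp only [gradient_sq_comp_rot h, hΦ]
  have e2 : ∫ p in halfPlane, biasRZ V₀ θ p * ‖φ p‖ ^ 2 = ∫ q : ℝ × ℝ, W q.2 * ‖Φ q‖ ^ 2 := by
    rw [setIntegral_halfPlane_eq_rot θ fun p hp => by simp [h.eq_zero hp]]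
    refine integral_congr_ae (ae_of_all _ fun q => ?_)
    by_cases hq : rot θ q ∈ halfPlane
    · simp only [biasRZ_rot hθ hq, hΦ, hW]
    · simp [hΦ, h.eq_zero hq]
  have e3 : (∫ q, ‖fderiv ℝ Φ q (0, 1)‖ ^ 2) + (∫ q : ℝ × ℝ, W q.2 * ‖Φ q‖ ^ 2)
      - threshold α V₀ * ∫ q, ‖Φ q‖ ^ 2 = ∫ s, ∫ t, (‖fderiv ℝ Φ (s, t) (0, 1)‖ ^ 2 +
        (W t - threshold α V₀) * ‖Φ (s, t)‖ ^ 2) := by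
    rw [← integral_const_mul, ← integral_add (i1 _) i2, ← integral_sub
      (f := fun q : ℝ × ℝ => ‖fderiv ℝ Φ q (0, 1)‖ ^ 2 + W q.2 * ‖Φ q‖ ^ 2) ((i1 _).add i2)
      (i0.const_mul _)]
    rw [Measure.volume_eq_prod, integral_prod]
    · refine integral_congr_ae (ae_of_all _ fun s => integral_congr_ae (ae_of_all _ fun t => ?_))
      simp only
      ring
    · exact ((i1 _).add i2).sub (i0.const_mul _)
  have i3 : Integrable fun s => ∫ t, (‖fderiv ℝ Φ (s, t) (0, 1)‖ ^ 2 +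
        (W t - threshold α V₀) * ‖Φ (s, t)‖ ^ 2) := by
    refine Integrable.integral_prod_left (f := fun q : ℝ × ℝ => ‖fderiv ℝ Φ q (0, 1)‖ ^ 2 +
        (W q.2 - threshold α V₀) * ‖Φ q‖ ^ 2) ?_
    refine ((i1 (0, 1)).add (i2.sub (i0.const_mul (threshold α V₀)))).congr
      (ae_of_all _ fun q => ?_)
    simp only [Pi.add_apply, Pi.sub_apply]
    ring
  have key : α * ∫ s in Ioi (0 : ℝ), ‖φ (ray θ s)‖ ^ 2 ≤
      ∫ s, ∫ t, (‖fderiv ℝ Φ (s, t) (0, 1)‖ ^ 2 + (W t - threshold α V₀) * ‖Φ (s, t)‖ ^ 2) := by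
    have hmL := memLp_ray h.smooth h.compact θ
    have hWpos : ∀ t, 0 ≤ W t - threshold α V₀ := fun t => by
      have : 0 ≤ W t := indicator_nonneg (fun _ _ => hV₀.le) t
      linarith [threshold_nonpos α V₀]
    -- Only the lines with s > 0 meet the ray. On the others the transverse integrand is nonnegative
    -- because μ ≤ 0, so they may be discarded.
    refine le_trans ?_ (setIntegral_le_integral i3 (ae_of_all _ fun s => integral_nonneg fun t =>
      add_nonneg (by positivity) (mul_nonneg (hWpos t) (by positivity))) (s := Ioi 0))
    rw [← integral_const_mul]
    refine integral_mono (((memLp_two_iff_integrable_sq_norm hmL.1).1 hmL).const_mul α)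
      i3.integrableOn fun s => ?_
    have := mul_norm_sq_le_transverse hα hV₀ (contDiff_vertical hs s)
      (hc.comp_isClosedEmbedding (isClosedEmbedding_vertical s))
    simp only [deriv_vertical hs] at this
    simpa only [hΦ, rot_zero_right] using this
  -- The kinetic energy along the ray is simply thrown away.
  have hpos : 0 ≤ ∫ q, ‖fderiv ℝ Φ q (1, 0)‖ ^ 2 := integral_nonneg fun q => by positivity
  rw [e0, e1, e2]
  linarith

end Rotated

/-! ### The form in terms of `L²` inner products -/

section Lp

variable {X : Type*} [MeasurableSpace X] {ν : Measure X} {f g : X → ℂ}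

open Classical in
/-- The class of a function in `L²`, and `0` if it is not square integrable. -/
noncomputable def lp (ν : Measure X) (f : X → ℂ) : Lp ℂ 2 ν :=
  if h : MemLp f 2 ν then h.toLp f else 0

theorem lp_of_memLp (h : MemLp f 2 ν) : lp ν f = h.toLp f := dif_pos h

theorem lp_congr (h : f =ᵐ[ν] g) : lp ν f = lp ν g := by
  by_cases hf : MemLp f 2 ν
  · rw [lp_of_memLp hf, lp_of_memLp (hf.ae_eq h)]
    exact MemLp.toLp_congr _ _ h
  · have hg : ¬ MemLp g 2 ν := fun hg => hf (hg.ae_eq h.symm)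
    rw [lp, lp, dif_neg hf, dif_neg hg]

theorem coeFn_lp (h : MemLp f 2 ν) : lp ν f =ᵐ[ν] f := by
  rw [lp_of_memLp h]; exact h.coeFn_toLp

theorem lp_coeFn (u : Lp ℂ 2 ν) : lp ν u = u := by
  rw [lp_of_memLp (Lp.memLp u)]; exact Lp.toLp_coeFn _ _

theorem lp_add (hf : MemLp f 2 ν) (hg : MemLp g 2 ν) : lp ν (f + g) = lp ν f + lp ν g := by
  rw [lp_of_memLp hf, lp_of_memLp hg, lp_of_memLp (hf.add hg)]; rfl

theorem lp_const_smul (hf : MemLp f 2 ν) (c : ℂ) : lp ν (c • f) = c • lp ν f := by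
  rw [lp_of_memLp hf, lp_of_memLp (hf.const_smul c)]; rfl

theorem inner_lp (hf : MemLp f 2 ν) (hg : MemLp g 2 ν) :
    ⟪lp ν f, lp ν g⟫_ℂ = ∫ x, conj (f x) * g x ∂ν := by
  rw [L2.inner_def]
  refine integral_congr_ae ?_
  filter_upwards [coeFn_lp hf, coeFn_lp hg] with x h1 h2
  rw [h1, h2, RCLike.inner_apply, mul_comm]

theorem integrable_conj_mul (hf : MemLp f 2 ν) (hg : MemLp g 2 ν) :
    Integrable (fun x => conj (f x) * g x) ν := by
  refine (L2.integrable_inner (𝕜 := ℂ) (lp ν f) (lp ν g)).congr ?_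
  filter_upwards [coeFn_lp hf, coeFn_lp hg] with x h1 h2
  rw [h1, h2, RCLike.inner_apply, mul_comm]

theorem norm_lp_sq (hf : MemLp f 2 ν) : ‖lp ν f‖ ^ 2 = ∫ x, ‖f x‖ ^ 2 ∂ν := by
  have h := inner_self_eq_norm_sq_to_K (𝕜 := ℂ) (lp ν f)
  rw [inner_lp hf hf] at h
  simp only [Complex.conj_mul'] at h
  have e : ∫ x, (‖f x‖ : ℂ) ^ 2 ∂ν = ((∫ x, ‖f x‖ ^ 2 ∂ν : ℝ) : ℂ) := by
    rw [← integral_complex_ofReal]; simp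
  rw [e] at h
  exact (Complex.ofReal_injective (h.trans (RCLike.ofReal_pow _ 2).symm)).symm

theorem tendsto_lp {φ : ℕ → X → ℂ} (hφ : ∀ n, MemLp (φ n) 2 ν) (hf : MemLp f 2 ν)
    (h : Tendsto (fun n => eLpNorm (fun p => φ n p - f p) 2 ν) atTop (𝓝 0)) :
    Tendsto (fun n => lp ν (φ n)) atTop (𝓝 (lp ν f)) := by
  have := (Lp.tendsto_Lp_iff_tendsto_eLpNorm'' φ hφ f hf).2 h
  simpa only [lp_of_memLp hf, lp_of_memLp (hφ _)] using this

end Lp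

/-! ### Measurability and bounds for the bias -/

theorem continuous_cyl {Y : Type*} [TopologicalSpace Y] {f g h : Y → ℝ} (hf : Continuous f)
    (hg : Continuous g) (hh : Continuous h) : Continuous fun y => cyl (f y) (g y) (h y) := by
  refine (PiLp.continuous_toLp 2 _).comp (continuous_pi fun i => ?_)
  fin_cases i
  · exact hf.mul (Real.continuous_cos.comp hg)
  · exact hf.mul (Real.continuous_sin.comp hg)
  · exact hh

theorem measurableSet_interiorRegion (θ : ℝ) : MeasurableSet (interiorRegion θ) := by
  have : IsOpen (interiorRegion θ) := isOpen_lt (by fun_prop) (by fun_prop)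
  exact this.measurableSet

theorem measurable_biasRZ (V₀ θ : ℝ) : Measurable (biasRZ V₀ θ) := by
  have h1 : Measurable (bias V₀ θ) := measurable_const.indicator (measurableSet_interiorRegion θ)
  exact h1.comp (continuous_cyl continuous_fst continuous_const continuous_snd).measurable

theorem abs_biasRZ_le {V₀ : ℝ} (hV₀ : 0 < V₀) (θ : ℝ) (p : ℝ × ℝ) : |biasRZ V₀ θ p| ≤ V₀ := by
  rw [biasRZ, bias]
  by_cases h : cyl p.1 0 p.2 ∈ interiorRegion θ
  · rw [indicator_of_mem h, abs_of_pos hV₀]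
  · rw [indicator_of_notMem h, abs_zero]; exact hV₀.le

theorem biasRZ_nonneg {V₀ : ℝ} (hV₀ : 0 < V₀) (θ : ℝ) (p : ℝ × ℝ) : 0 ≤ biasRZ V₀ θ p :=
  indicator_nonneg (fun _ _ => hV₀.le) _

section Form

variable {α V₀ θ : ℝ} {ω ω' : ℝ × ℝ → ℂ}

theorem memLp_bias (hV₀ : 0 < V₀) {f : ℝ × ℝ → ℂ} (hf : MemLp f 2 (volume.restrict halfPlane)) :
    MemLp (fun p => (biasRZ V₀ θ p : ℂ) * f p) 2 (volume.restrict halfPlane) := by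
  refine hf.of_le_mul (c := V₀) ?_ (ae_of_all _ fun p => ?_)
  · exact (Complex.measurable_ofReal.comp (measurable_biasRZ V₀ θ)).aestronglyMeasurable.mul hf.1
  · rw [norm_mul, Complex.norm_real]
    exact mul_le_mul_of_nonneg_right (abs_biasRZ_le hV₀ θ p) (norm_nonneg _)

theorem tendsto_eLpNorm_bias (hV₀ : 0 < V₀) {φ : ℕ → ℝ × ℝ → ℂ} {f : ℝ × ℝ → ℂ}
    (h : Tendsto (fun n => eLpNorm (fun p => φ n p - f p) 2 (volume.restrict halfPlane))
      atTop (𝓝 0)) :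
    Tendsto (fun n => eLpNorm (fun p => (biasRZ V₀ θ p : ℂ) * φ n p - (biasRZ V₀ θ p : ℂ) * f p) 2
      (volume.restrict halfPlane)) atTop (𝓝 0) := by
  have h2 := ENNReal.Tendsto.const_mul (a := ENNReal.ofReal V₀) h (Or.inr ENNReal.ofReal_ne_top)
  rw [mul_zero] at h2
  refine tendsto_of_tendsto_of_tendsto_of_le_of_le tendsto_const_nhds h2 (fun n => zero_le)
    fun n => eLpNorm_le_mul_eLpNorm_of_ae_le_mul (ae_of_all _ fun p => ?_) 2
  rw [← mul_sub, norm_mul, Complex.norm_real]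
  exact mul_le_mul_of_nonneg_right (abs_biasRZ_le hV₀ θ p) (norm_nonneg _)

/-- With every term an inner product of L² classes, congruence, linearity and limits of the form all
reduce to properties of the inner product. The centrifugal weight (4m² - 1)/(4r²) is distributed
evenly as (m² - 1/4) times 1/r on each side. -/
theorem qmSesq_eq (hV₀ : 0 < V₀) (hθ : 0 < Real.sin θ) (m : ℤ) (h : Admissible ω)
    (h' : Admissible ω') :
    qmSesq α V₀ θ m ω ω' =
      ⟪lp (volume.restrict halfPlane) (dr ω), lp (volume.restrict halfPlane) (dr ω')⟫_ℂ
      + ⟪lp (volume.restrict halfPlane) (dz ω), lp (volume.restrict halfPlane) (dz ω')⟫_ℂ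
      + ((m : ℂ) ^ 2 - 1 / 4) * ⟪lp (volume.restrict halfPlane) (fun p => ω p / (p.1 : ℂ)),
          lp (volume.restrict halfPlane) (fun p => ω' p / (p.1 : ℂ))⟫_ℂ
      + ⟪lp (volume.restrict halfPlane) ω,
          lp (volume.restrict halfPlane) (fun p => (biasRZ V₀ θ p : ℂ) * ω' p)⟫_ℂ
      - α * ⟪lp (volume.restrict (Ioi 0)) (trace θ ω),
          lp (volume.restrict (Ioi 0)) (trace θ ω')⟫_ℂ := by
  rw [inner_lp h.dr_spec.1 h'.dr_spec.1, inner_lp h.dz_spec.1 h'.dz_spec.1,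
    inner_lp h.hardy h'.hardy, inner_lp h.memLp (memLp_bias hV₀ h'.memLp),
    inner_lp (h.memLp_trace hθ) (h'.memLp_trace hθ), qmSesq,
    integral_add (integrable_conj_mul h.dr_spec.1 h'.dr_spec.1)
      (integrable_conj_mul h.dz_spec.1 h'.dz_spec.1),
    ← integral_const_mul ((m : ℂ) ^ 2 - 1 / 4)]
  congr 2
  · congr 2
    ext p
    simp only [map_div₀, Complex.conj_ofReal]
    push_cast
    ring
  · congr 1
    ext p
    ring

theorem H1Tendsto.tendsto_lp_val (h : Admissible ω) {φ : ℕ → ℝ × ℝ → ℂ}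
    (hφ : ∀ n, IsTest halfPlane (φ n)) (ht : H1Tendsto φ ω) :
    Tendsto (fun n => lp (volume.restrict halfPlane) (φ n)) atTop
      (𝓝 (lp (volume.restrict halfPlane) ω)) :=
  tendsto_lp (fun n => (hφ n).memLp.restrict _) h.memLp ht.val

theorem H1Tendsto.tendsto_lp_dr (h : Admissible ω) {φ : ℕ → ℝ × ℝ → ℂ}
    (hφ : ∀ n, IsTest halfPlane (φ n)) (ht : H1Tendsto φ ω) :
    Tendsto (fun n => lp (volume.restrict halfPlane) (fun p => fderiv ℝ (φ n) p (1, 0))) atTop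
      (𝓝 (lp (volume.restrict halfPlane) (ConicalSurface.dr ω))) :=
  tendsto_lp (fun n => ((hφ n).memLp_fderiv _).restrict _) h.dr_spec.1 ht.dr

theorem H1Tendsto.tendsto_lp_dz (h : Admissible ω) {φ : ℕ → ℝ × ℝ → ℂ}
    (hφ : ∀ n, IsTest halfPlane (φ n)) (ht : H1Tendsto φ ω) :
    Tendsto (fun n => lp (volume.restrict halfPlane) (fun p => fderiv ℝ (φ n) p (0, 1))) atTop
      (𝓝 (lp (volume.restrict halfPlane) (ConicalSurface.dz ω))) :=
  tendsto_lp (fun n => ((hφ n).memLp_fderiv _).restrict _) h.dz_spec.1 ht.dz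

theorem H1Tendsto.tendsto_lp_bias (hV₀ : 0 < V₀) (h : Admissible ω) {φ : ℕ → ℝ × ℝ → ℂ}
    (hφ : ∀ n, IsTest halfPlane (φ n)) (ht : H1Tendsto φ ω) :
    Tendsto (fun n => lp (volume.restrict halfPlane) (fun p => (biasRZ V₀ θ p : ℂ) * φ n p)) atTop
      (𝓝 (lp (volume.restrict halfPlane) (fun p => (biasRZ V₀ θ p : ℂ) * ω p))) :=
  tendsto_lp (fun n => memLp_bias hV₀ ((hφ n).memLp.restrict _)) (memLp_bias hV₀ h.memLp)
    (tendsto_eLpNorm_bias hV₀ ht.val)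

theorem H1Tendsto.tendsto_lp_trace (hθ : 0 < Real.sin θ) (h : Admissible ω) {φ : ℕ → ℝ × ℝ → ℂ}
    (hφ : ∀ n, IsTest halfPlane (φ n)) (ht : H1Tendsto φ ω) :
    Tendsto (fun n => lp (volume.restrict (Ioi 0)) (fun s => φ n (ray θ s))) atTop
      (𝓝 (lp (volume.restrict (Ioi 0)) (trace θ ω))) :=
  tendsto_lp (fun n => memLp_ray (hφ n).smooth (hφ n).compact θ) (h.memLp_trace hθ)
    ((h.isTrace_trace hθ).tendsto h hθ (fun n => ⟨(hφ n).smooth, (hφ n).compact⟩) ht)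

theorem inner_lp_bias (hV₀ : 0 < V₀) {f : ℝ × ℝ → ℂ}
    (hf : MemLp f 2 (volume.restrict halfPlane)) :
    ⟪lp (volume.restrict halfPlane) f,
      lp (volume.restrict halfPlane) (fun p => (biasRZ V₀ θ p : ℂ) * f p)⟫_ℂ
    = ((∫ p in halfPlane, biasRZ V₀ θ p * ‖f p‖ ^ 2 : ℝ) : ℂ) := by
  rw [inner_lp hf (memLp_bias hV₀ hf), ← integral_complex_ofReal]
  congr 1
  ext p
  push_cast
  rw [← Complex.conj_mul']
  ring

/-- The lower bound for the quadratic form without the centrifugal term. -/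
theorem Admissible.lower_bound (hα : 0 < α) (hV₀ : 0 < V₀) (hθ : 0 < Real.sin θ)
    (h : Admissible ω) :
    threshold α V₀ * ‖lp (volume.restrict halfPlane) ω‖ ^ 2 ≤
      ‖lp (volume.restrict halfPlane) (dr ω)‖ ^ 2 + ‖lp (volume.restrict halfPlane) (dz ω)‖ ^ 2
        + (⟪lp (volume.restrict halfPlane) ω,
            lp (volume.restrict halfPlane) (fun p => (biasRZ V₀ θ p : ℂ) * ω p)⟫_ℂ).re
        - α * ‖lp (volume.restrict (Ioi 0)) (trace θ ω)‖ ^ 2 := by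
  obtain ⟨φ, hφ, ht⟩ := h.exists_test_tendsto
  have t0 := ht.tendsto_lp_val h hφ
  have t1 := ht.tendsto_lp_dr h hφ
  have t2 := ht.tendsto_lp_dz h hφ
  have t3 := ht.tendsto_lp_bias (θ := θ) hV₀ h hφ
  have t4 := ht.tendsto_lp_trace hθ h hφ
  -- All terms present are continuous in H¹. The centrifugal term is absent, so no convergence of
  -- φₙ/r is required.
  refine le_of_tendsto_of_tendsto' ((t0.norm.pow 2).const_mul (threshold α V₀))
    ((((t1.norm.pow 2).add (t2.norm.pow 2)).add
      ((Complex.continuous_re.tendsto _).comp (t0.inner t3))).sub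
      ((t4.norm.pow 2).const_mul α)) fun n => ?_
  have m0 := (hφ n).memLp.restrict halfPlane
  have m1 := ((hφ n).memLp_fderiv (1, 0)).restrict halfPlane
  have m2 := ((hφ n).memLp_fderiv (0, 1)).restrict halfPlane
  have m4 := memLp_ray (hφ n).smooth (hφ n).compact θ
  have := (hφ n).lower_bound hα hV₀ hθ
  rw [integral_add ((memLp_two_iff_integrable_sq_norm m1.1).1 m1)
    ((memLp_two_iff_integrable_sq_norm m2.1).1 m2)] at this
  rw [Function.comp, inner_lp_bias hV₀ m0, Complex.ofReal_re, norm_lp_sq m0, norm_lp_sq m1,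
    norm_lp_sq m2, norm_lp_sq m4]
  exact this

end Form

/-! ### Wave packets and approximate ground states of the transverse operator -/

theorem integral_sq_comp_affine (ξ : ℝ → ℝ) {δ : ℝ} (hδ : 0 < δ) (c : ℝ) :
    ∫ t, ξ (δ * t + c) ^ 2 = δ⁻¹ * ∫ t, ξ t ^ 2 := by
  have h1 := Measure.integral_comp_mul_left (fun t => ξ (t + c) ^ 2) δ
  have h2 := integral_add_right_eq_self (μ := (volume : Measure ℝ)) (fun t => ξ t ^ 2) c
  rw [h1, h2, abs_of_pos (inv_pos.2 hδ), smul_eq_mul]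

theorem exists_bump_integral : ∃ ξ : ℝ → ℝ, ContDiff ℝ (⊤ : ℕ∞) ξ ∧ HasCompactSupport ξ ∧
    (∀ x, 0 ≤ ξ x ∧ ξ x ≤ 1) ∧ (∀ x, |x| ≤ 1 → ξ x = 1) ∧ (∀ x, 2 ≤ |x| → ξ x = 0) ∧
    0 < ∫ t, ξ t ^ 2 := by
  obtain ⟨ξ, h1, h2, h3, h4, h5⟩ := exists_bump
  refine ⟨ξ, h1, h2, h3, h4, h5, ?_⟩
  refine Continuous.integral_pos_of_hasCompactSupport_nonneg_nonzero (h1.continuous.pow 2)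
    (HasCompactSupport.intro h2 fun t ht => by simp [image_eq_zero_of_notMem_tsupport ht])
    (fun t => sq_nonneg _) (x := 0) (by simp [h4 0 (by simp)])

theorem contDiff_affine_comp {ξ : ℝ → ℝ} (h : ContDiff ℝ (⊤ : ℕ∞) ξ) (δ c : ℝ) :
    ContDiff ℝ (⊤ : ℕ∞) fun t => ξ (δ * t + c) :=
  h.comp ((contDiff_const.mul contDiff_id).add contDiff_const)

theorem hasDerivAt_affine_comp {ξ : ℝ → ℝ} (h : Differentiable ℝ ξ) (δ c t : ℝ) :
    HasDerivAt (fun t => ξ (δ * t + c)) (δ * deriv ξ (δ * t + c)) t := by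
  have := (h (δ * t + c)).hasDerivAt.comp t
    (((hasDerivAt_id t).const_mul δ).add_const c)
  rw [mul_one, mul_comm] at this
  exact this

theorem hasCompactSupport_affine_comp {F : Type*} [Zero F] {ξ : ℝ → F} (h : HasCompactSupport ξ)
    {δ : ℝ} (hδ : δ ≠ 0) (c : ℝ) : HasCompactSupport fun t => ξ (δ * t + c) :=
  (h.comp_homeomorph (Homeomorph.addRight c)).comp_homeomorph (Homeomorph.mulLeft₀ δ hδ)

theorem integrable_sq_of_test {ξ : ℝ → ℝ} (h : Continuous ξ) (hc : HasCompactSupport ξ) :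
    Integrable fun t => ξ t ^ 2 :=
  (h.pow 2).integrable_of_hasCompactSupport
    (HasCompactSupport.intro hc fun t ht => by simp [image_eq_zero_of_notMem_tsupport ht])

/-- Wave packets along the half-line. -/
theorem exists_wavePacket (k R : ℝ) {ε : ℝ} (hε : 0 < ε) : ∃ f : ℝ → ℂ,
    ContDiff ℝ (⊤ : ℕ∞) f ∧ HasCompactSupport f ∧ (∀ s, s ≤ R → f s = 0) ∧
    (0 < ∫ s, ‖f s‖ ^ 2) ∧
    ∫ s, ‖deriv (deriv f) s + (k : ℂ) ^ 2 * f s‖ ^ 2 ≤ ε ^ 2 * ∫ s, ‖f s‖ ^ 2 := by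
  obtain ⟨ξ, hξ, hc, h01, h1, h0, hpos⟩ := exists_bump_integral
  have hξ' : ContDiff ℝ (⊤ : ℕ∞) (deriv ξ) := (contDiff_infty_iff_deriv.1 hξ).2
  set I₀ := ∫ t, ξ t ^ 2 with hI₀
  set I₁ := ∫ t, deriv ξ t ^ 2 with hI₁
  set I₂ := ∫ t, deriv (deriv ξ) t ^ 2 with hI₂
  have hI₁0 : 0 ≤ I₁ := integral_nonneg fun _ => sq_nonneg _
  have hI₂0 : 0 ≤ I₂ := integral_nonneg fun _ => sq_nonneg _
  -- The packet has width 1/δ. Its residual is (δ²ξ'' + 2ikδξ') exp(iks), and the constant comes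
  -- from twice its squared modulus, using δ⁴ ≤ δ and δ² ≤ δ. The factor 1/δ from rescaling is
  -- common to both sides.
  obtain ⟨δ, hδ, hδ1, hδε⟩ : ∃ δ > 0, δ ≤ 1 ∧ δ * (2 * I₂ + 8 * k ^ 2 * I₁) ≤ ε ^ 2 * I₀ := by
    have hp : 0 < ε ^ 2 * I₀ := by positivity
    have hq : 0 < 2 * I₂ + 8 * k ^ 2 * I₁ + 1 := by positivity
    refine ⟨min 1 (ε ^ 2 * I₀ / (2 * I₂ + 8 * k ^ 2 * I₁ + 1)), by positivity, min_le_left _ _, ?_⟩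
    calc _ ≤ ε ^ 2 * I₀ / (2 * I₂ + 8 * k ^ 2 * I₁ + 1) * (2 * I₂ + 8 * k ^ 2 * I₁ + 1) := by
          exact mul_le_mul (min_le_right _ _) (by linarith) (by positivity) (by positivity)
      _ = _ := div_mul_cancel₀ _ hq.ne'
  -- This shift makes the argument of ξ at most -2 for all s ≤ R, where ξ vanishes.
  set c : ℝ := -(δ * R + 2) with hcdef
  set η : ℝ → ℝ := fun s => ξ (δ * s + c) with hη
  have hηs : ContDiff ℝ (⊤ : ℕ∞) η := contDiff_affine_comp hξ δ c
  have hηc : HasCompactSupport η := hasCompactSupport_affine_comp hc hδ.ne' c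
  have dη : ∀ s, HasDerivAt η (δ * deriv ξ (δ * s + c)) s :=
    hasDerivAt_affine_comp (hξ.differentiable (by simp)) δ c
  have dη' : ∀ s, HasDerivAt (fun s => δ * deriv ξ (δ * s + c))
      (δ * (δ * deriv (deriv ξ) (δ * s + c))) s := fun s =>
    (hasDerivAt_affine_comp (hξ'.differentiable (by simp)) δ c s).const_mul δ
  set e : ℝ → ℂ := fun s => Complex.exp (Complex.I * k * s) with he
  have de : ∀ s, HasDerivAt e (Complex.I * k * e s) s := fun s => by
    have h2 : HasDerivAt (fun s : ℝ => Complex.I * k * (s : ℂ)) (Complex.I * k * 1) s :=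
      (Complex.ofRealCLM.hasDerivAt (x := s)).const_mul (Complex.I * k)
    convert! h2.cexp using 1
    rw [mul_one, mul_comm]
  have hes : ContDiff ℝ (⊤ : ℕ∞) e :=
    (contDiff_const.mul Complex.ofRealCLM.contDiff).cexp
  have hen : ∀ s, ‖e s‖ = 1 := fun s => by
    have : Complex.I * k * s = ((k * s : ℝ) : ℂ) * Complex.I := by push_cast; ring
    rw [he]; simp only [this]; exact Complex.norm_exp_ofReal_mul_I _
  set f : ℝ → ℂ := fun s => (η s : ℂ) * e s with hf
  have df : ∀ s, HasDerivAt f (((δ * deriv ξ (δ * s + c) : ℝ) : ℂ) * e s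
      + (η s : ℂ) * (Complex.I * k * e s)) s := fun s => (dη s).ofReal_comp.mul (de s)
  have df' : deriv f = fun s => ((δ * deriv ξ (δ * s + c) : ℝ) : ℂ) * e s
      + (η s : ℂ) * (Complex.I * k * e s) := funext fun s => (df s).deriv
  have ddf : ∀ s, deriv (deriv f) s + (k : ℂ) ^ 2 * f s
      = (((δ ^ 2 * deriv (deriv ξ) (δ * s + c) : ℝ) : ℂ)
        + ((2 * k * δ * deriv ξ (δ * s + c) : ℝ) : ℂ) * Complex.I) * e s := fun s => by
    rw [df', (((dη' s).ofReal_comp.fun_mul (de s)).fun_add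
      ((dη s).ofReal_comp.fun_mul ((de s).const_mul (Complex.I * k)))).deriv]
    simp only [hf]
    push_cast
    linear_combination (k : ℂ) ^ 2 * η s * e s * Complex.I_sq
  have hfn : ∀ s, ‖f s‖ ^ 2 = η s ^ 2 := fun s => by
    rw [hf]; simp only [norm_mul, hen, mul_one, Complex.norm_real, Real.norm_eq_abs, sq_abs]
  have hddn : ∀ s, ‖deriv (deriv f) s + (k : ℂ) ^ 2 * f s‖ ^ 2
      ≤ 2 * δ ^ 4 * deriv (deriv ξ) (δ * s + c) ^ 2 
        + 8 * k ^ 2 * δ ^ 2 * deriv ξ (δ * s + c) ^ 2 := fun s => by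
    rw [ddf, norm_mul, hen, mul_one, ← Complex.normSq_eq_norm_sq, Complex.normSq_add_mul_I]
    nlinarith [sq_nonneg (δ ^ 2 * deriv (deriv ξ) (δ * s + c)),
      sq_nonneg (2 * k * δ * deriv ξ (δ * s + c))]
  have e0 : ∫ s, ‖f s‖ ^ 2 = δ⁻¹ * I₀ := by
    simp only [hfn, hη]
    exact integral_sq_comp_affine ξ hδ c
  have hsupp : ∀ s, s ≤ R → f s = 0 := fun s hs => by
    have : ξ (δ * s + c) = 0 := h0 _ (by
      rw [abs_of_nonpos (by rw [hcdef]; nlinarith)]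
      rw [hcdef]; nlinarith)
    simp [hf, hη, this]
  refine ⟨f, (Complex.ofRealCLM.contDiff.comp hηs).mul hes, ?_, hsupp, ?_, ?_⟩
  · exact HasCompactSupport.intro hηc fun s hs => by simp [hf, image_eq_zero_of_notMem_tsupport hs]
  · rw [e0]; positivity
  · have j2 : Integrable fun s => deriv (deriv ξ) (δ * s + c) ^ 2 := integrable_sq_of_test
      (contDiff_affine_comp (contDiff_infty_iff_deriv.1 hξ').2 δ c).continuous
      (hasCompactSupport_affine_comp hc.deriv.deriv hδ.ne' c)
    have j1 : Integrable fun s => deriv ξ (δ * s + c) ^ 2 := integrable_sq_of_test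
      (contDiff_affine_comp hξ' δ c).continuous (hasCompactSupport_affine_comp hc.deriv hδ.ne' c)
    calc _ ≤ ∫ s, (2 * δ ^ 4 * deriv (deriv ξ) (δ * s + c) ^ 2 
        + 8 * k ^ 2 * δ ^ 2 * deriv ξ (δ * s + c) ^ 2) :=
          integral_mono_of_nonneg (ae_of_all _ fun s => by positivity)
            ((j2.const_mul _).add (j1.const_mul _)) (ae_of_all _ hddn)
      _ = 2 * δ ^ 4 * (δ⁻¹ * I₂) + 8 * k ^ 2 * δ ^ 2 * (δ⁻¹ * I₁) := by
          rw [integral_add (j2.const_mul _) (j1.const_mul _), integral_const_mul,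
            integral_const_mul, integral_sq_comp_affine _ hδ, integral_sq_comp_affine _ hδ]
      _ = δ⁻¹ * (2 * δ ^ 4 * I₂ + 8 * k ^ 2 * δ ^ 2 * I₁) := by ring
      _ ≤ δ⁻¹ * (ε ^ 2 * I₀) := by
          gcongr
          refine le_trans ?_ hδε
          have b1 : δ ^ 4 ≤ δ := pow_le_of_le_one hδ.le hδ1 (by norm_num)
          have b2 : δ ^ 2 ≤ δ := pow_le_of_le_one hδ.le hδ1 (by norm_num)
          have b3 : 0 ≤ 8 * k ^ 2 * I₁ := by positivity
          nlinarith [mul_le_mul_of_nonneg_right b1 hI₂0, mul_le_mul_of_nonneg_right b2 b3]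
      _ = _ := by rw [e0]; ring

/-- The transverse operator has approximate ground states `h`; the form of the transverse operator
factorizes through the first order operator `d/dt + b`. -/
theorem exists_transverse_of_lt {α V₀ : ℝ} (hα : 0 < α) (hV₀ : 0 < V₀) (hlt : V₀ < α ^ 2) {ε : ℝ}
    (hε : 0 < ε) : ∃ (h b : ℝ → ℝ), ContDiff ℝ (⊤ : ℕ∞) h ∧ HasCompactSupport h ∧
    (0 < ∫ t, h t ^ 2) ∧ Measurable b ∧ (∀ t, |b t| ≤ α) ∧
    (∫ t, (deriv h t + b t * h t) ^ 2 ≤ ε ^ 2 * ∫ t, h t ^ 2) ∧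
    ∀ v : ℝ → ℂ, ContDiff ℝ (⊤ : ℕ∞) v → HasCompactSupport v →
      (∫ t, (conj (deriv v t) * deriv h t +
        ((Ioi (0 : ℝ)).indicator (fun _ => V₀) t - threshold α V₀ : ℝ) * (conj (v t) * h t)))
          - α * (conj (v 0) * h 0)
      = ∫ t, conj (deriv v t + b t * v t) * (deriv h t + b t * h t : ℝ) := by
  obtain ⟨ξ, hξ, hc, h01, h1, h0, hpos⟩ := exists_bump_integral
  obtain ⟨k₁, k₂, hk1, hk2, hk, -, -, hkeq⟩ := exists_rates hα hV₀
  obtain ⟨hk1s, hk2s⟩ := hkeq hlt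
  have hξ' : ContDiff ℝ (⊤ : ℕ∞) (deriv ξ) := (contDiff_infty_iff_deriv.1 hξ).2
  set I₁ := ∫ t, deriv ξ t ^ 2 with hI₁
  have hI₁0 : 0 ≤ I₁ := integral_nonneg fun _ => sq_nonneg _
  -- The small parameter is both the slope of the cutoff and the radius on which the corner is
  -- smoothed. The two terms are the corresponding residuals, π coming from ∫ (1 + (t/δ)²)⁻¹ = πδ,
  -- and exp(-4α) is a lower bound for the squared norm.
  obtain ⟨δ, hδ, hδ1, hδε⟩ : ∃ δ > 0, δ ≤ 1 ∧
      δ * (2 * I₁ + α ^ 2 / 2 * Real.pi) ≤ ε ^ 2 * Real.exp (-(4 * α)) := by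
    have hp : 0 < ε ^ 2 * Real.exp (-(4 * α)) := by positivity
    have hq : 0 < 2 * I₁ + α ^ 2 / 2 * Real.pi := by positivity
    refine ⟨min 1 (ε ^ 2 * Real.exp (-(4 * α)) / (2 * I₁ + α ^ 2 / 2 * Real.pi)), by positivity,
      min_le_left _ _, ?_⟩
    calc _ ≤ ε ^ 2 * Real.exp (-(4 * α)) / (2 * I₁ + α ^ 2 / 2 * Real.pi)
          * (2 * I₁ + α ^ 2 / 2 * Real.pi) := by
          gcongr
          exact min_le_right _ _
      _ = _ := div_mul_cancel₀ _ hq.ne'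
  -- Minus the logarithmic derivative of the exact ground state, which is exp(-k₁t) for t > 0 and
  -- exp(k₂t) for t < 0; thus d/dt + b annihilates that state.
  set b : ℝ → ℝ := fun t => if 0 < t then k₁ else -k₂ with hb
  have hbm : Measurable b := Measurable.ite measurableSet_Ioi measurable_const measurable_const
  have hbα : ∀ t, |b t| ≤ α := fun t => by
    simp only [hb]; split_ifs
    · rw [abs_of_nonneg hk1]; linarith
    · rw [abs_neg, abs_of_nonneg hk2]; linarith
  have hr : ∀ t : ℝ, 0 < t ^ 2 + δ ^ 2 := fun t => by positivity
  -- A smooth version of the exponent α|t|/2 + (k₁ - k₂)t/2, which equals k₁t for t > 0 and -k₂t for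
  -- t < 0; |t| is replaced by √(t² + δ²).
  set κ : ℝ → ℝ := fun t => α / 2 * √(t ^ 2 + δ ^ 2) + (k₁ - k₂) / 2 * t with hκ
  have dκ : ∀ t, HasDerivAt κ (α / 2 * (t / √(t ^ 2 + δ ^ 2)) + (k₁ - k₂) / 2) t := fun t => by
    have e1 : HasDerivAt (fun t : ℝ => t ^ 2 + δ ^ 2) (2 * t) t := by
      simpa using (hasDerivAt_pow 2 t).add_const (δ ^ 2)
    have e2 := ((e1.sqrt (hr t).ne').const_mul (α / 2)).add
      ((hasDerivAt_id t).const_mul ((k₁ - k₂) / 2))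
    rw [mul_one, mul_div_mul_left _ _ two_ne_zero] at e2
    exact e2
  have hκs : ContDiff ℝ (⊤ : ℕ∞) κ := by
    refine (contDiff_const.mul (ContDiff.sqrt (by fun_prop) fun t => (hr t).ne')).add
      (contDiff_const.mul contDiff_id)
  have habs : ∀ t, |t| ≤ √(t ^ 2 + δ ^ 2) := fun t =>
    Real.abs_le_sqrt (by linarith [sq_nonneg δ])
  have hκ0 : ∀ t, 0 ≤ κ t := fun t => by
    have e1 := habs t
    have e2 : |(k₁ - k₂) / 2 * t| ≤ α / 2 * |t| := by
      rw [abs_mul]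
      gcongr
      rw [abs_le]; constructor <;> linarith
    have e3 := neg_le_of_abs_le e2
    simp only [hκ]
    nlinarith
  set h : ℝ → ℝ := fun t => ξ (δ * t + 0) * Real.exp (-κ t) with hh
  have hhs : ContDiff ℝ (⊤ : ℕ∞) h := (contDiff_affine_comp hξ δ 0).mul hκs.neg.exp
  have hhc : HasCompactSupport h := (hasCompactSupport_affine_comp hc hδ.ne' 0).mul_right
  have dh : ∀ t, deriv h t + b t * h t = (δ * deriv ξ (δ * t + 0)
      + (b t - (α / 2 * (t / √(t ^ 2 + δ ^ 2)) + (k₁ - k₂) / 2)) * ξ (δ * t + 0))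
        * Real.exp (-κ t) := fun t => by
    rw [((hasDerivAt_affine_comp (hξ.differentiable (by simp)) δ 0 t).fun_mul
      (dκ t).fun_neg.exp).deriv]
    simp only [hh]
    ring
  -- The difference is α/2 times ±(1 - x) with x = |t|/√(t² + δ²) in [0, 1], and (1 - x)² ≤ 1 - x²,
  -- which is the stated Lorentzian.
  have hbκ : ∀ t, (b t - (α / 2 * (t / √(t ^ 2 + δ ^ 2)) + (k₁ - k₂) / 2)) ^ 2
      ≤ α ^ 2 / 4 * (1 + (δ⁻¹ * t) ^ 2)⁻¹ := fun t => by
    set x := |t| / √(t ^ 2 + δ ^ 2) with hx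
    have hs0 : 0 < √(t ^ 2 + δ ^ 2) := Real.sqrt_pos.2 (hr t)
    have hx0 : 0 ≤ x := by positivity
    have hx1 : x ≤ 1 := div_le_one_of_le₀ (habs t) hs0.le
    have hxs : x ^ 2 = 1 - (1 + (δ⁻¹ * t) ^ 2)⁻¹ := by
      rw [hx, div_pow, Real.sq_sqrt (hr t).le, sq_abs]
      field_simp
      ring
    have e1 : (b t - (α / 2 * (t / √(t ^ 2 + δ ^ 2)) + (k₁ - k₂) / 2)) ^ 2
        = α ^ 2 / 4 * (1 - x) ^ 2 := by
      rcases lt_or_ge 0 t with ht | ht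
      · simp only [hb, if_pos ht, hx, abs_of_pos ht]
        rw [← hk]; ring
      · simp only [hb, if_neg (not_lt.2 ht), hx, abs_of_nonpos ht]
        rw [← hk]; ring
    rw [e1]
    gcongr
    nlinarith
  have hexp1 : ∀ t, Real.exp (-κ t) ^ 2 ≤ 1 := fun t =>
    pow_le_one₀ (Real.exp_pos _).le (Real.exp_le_one_iff.2 (neg_nonpos.2 (hκ0 t)))
  have hdh : ∀ t, (deriv h t + b t * h t) ^ 2 ≤ 2 * δ ^ 2 * deriv ξ (δ * t + 0) ^ 2
      + α ^ 2 / 2 * (1 + (δ⁻¹ * t) ^ 2)⁻¹ := fun t => by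
    rw [dh, mul_pow]
    refine (mul_le_of_le_one_right (sq_nonneg _) (hexp1 t)).trans ?_
    refine (add_sq_le).trans ?_
    have e1 : ξ (δ * t + 0) ^ 2 ≤ 1 := pow_le_one₀ (h01 _).1 (h01 _).2
    have e2 := hbκ t
    rw [mul_pow, mul_pow]
    have e3 := mul_le_of_le_one_right (sq_nonneg
      (b t - (α / 2 * (t / √(t ^ 2 + δ ^ 2)) + (k₁ - k₂) / 2))) e1
    linarith
  -- On [0, 1] the cutoff is 1 and κ ≤ 2α, uniformly in δ ≤ 1; this keeps the norm from
  -- degenerating.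
  have hlow : Real.exp (-(4 * α)) ≤ ∫ t, h t ^ 2 := by
    have e1 : ∫ t in Icc (0 : ℝ) 1, Real.exp (-(4 * α)) = Real.exp (-(4 * α)) := by simp
    rw [← e1]
    have hi := integrable_sq_of_test hhs.continuous hhc
    refine le_trans ?_ (setIntegral_le_integral hi (ae_of_all _ fun t => sq_nonneg _)
      (s := Icc (0 : ℝ) 1))
    refine setIntegral_mono_on (by simp) hi.integrableOn measurableSet_Icc fun t ht => ?_
    have e2 : ξ (δ * t + 0) = 1 := h1 _ (by
      rw [add_zero, abs_of_nonneg (mul_nonneg hδ.le ht.1)]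
      exact mul_le_one₀ hδ1 ht.1 ht.2)
    have e3 : √(t ^ 2 + δ ^ 2) ≤ 2 := by
      rw [Real.sqrt_le_left (by norm_num)]
      nlinarith [ht.1, ht.2]
    have e4 : κ t ≤ 2 * α := by
      simp only [hκ]
      have e5 : (k₁ - k₂) / 2 * t ≤ α / 2 * 1 := by
        have := ht.1; have := ht.2
        nlinarith
      nlinarith
    simp only [hh]
    rw [e2, one_mul, ← Real.exp_nat_mul]
    gcongr
    push_cast
    linarith
  refine ⟨h, b, hhs, hhc, (Real.exp_pos _).trans_le hlow, hbm, hbα, ?_, ?_⟩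
  · have j1 : Integrable fun s => deriv ξ (δ * s + 0) ^ 2 := integrable_sq_of_test
      (contDiff_affine_comp hξ' δ 0).continuous (hasCompactSupport_affine_comp hc.deriv hδ.ne' 0)
    have j2 : Integrable fun t => (1 + (δ⁻¹ * t) ^ 2)⁻¹ :=
      integrable_inv_one_add_sq.comp_mul_left' (inv_ne_zero hδ.ne')
    have e2 : ∫ t, (1 + (δ⁻¹ * t) ^ 2)⁻¹ = δ * Real.pi := by
      have := Measure.integral_comp_mul_left (fun t : ℝ => (1 + t ^ 2)⁻¹) δ⁻¹
      rw [this, integral_univ_inv_one_add_sq, inv_inv, abs_of_pos hδ, smul_eq_mul]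
    calc _ ≤ ∫ t, (2 * δ ^ 2 * deriv ξ (δ * t + 0) ^ 2 + α ^ 2 / 2 * (1 + (δ⁻¹ * t) ^ 2)⁻¹) :=
          integral_mono_of_nonneg (ae_of_all _ fun s => sq_nonneg _)
            ((j1.const_mul _).add (j2.const_mul _)) (ae_of_all _ hdh)
      _ = 2 * δ ^ 2 * (δ⁻¹ * I₁) + α ^ 2 / 2 * (δ * Real.pi) := by
          rw [integral_add (j1.const_mul _) (j2.const_mul _), integral_const_mul,
            integral_const_mul, integral_sq_comp_affine _ hδ, e2]
      _ = δ * (2 * I₁ + α ^ 2 / 2 * Real.pi) := by field_simp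
      _ ≤ ε ^ 2 * Real.exp (-(4 * α)) := hδε
      _ ≤ _ := by gcongr
  · intro v hv hvc
    set g : ℝ → ℂ := fun t => conj (v t) * h t with hg
    have dv : ∀ t, HasDerivAt v (deriv v t) t := fun t => (hv.differentiable (by simp) t).hasDerivAt
    have dg : ∀ t, deriv g t = conj (deriv v t) * h t + conj (v t) * deriv h t := fun t =>
      ((dv t).star_conj.mul (hhs.differentiable (by simp) t).hasDerivAt.ofReal_comp).deriv
    have hgs : ContDiff ℝ (⊤ : ℕ∞) g :=
      (Complex.conjCLE.contDiff.comp hv).mul (Complex.ofRealCLM.contDiff.comp hhs)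
    have hgc : HasCompactSupport g :=
      HasCompactSupport.intro hvc fun t ht => by simp [hg, image_eq_zero_of_notMem_tsupport ht]
    have hg1 : ContDiff ℝ 1 g := hgs.of_le (by exact_mod_cast le_top)
    have jg : Integrable (deriv g) := (hg1.continuous_deriv le_rfl).integrable_of_hasCompactSupport
      hgc.deriv
    have jbg : Integrable fun t => (b t : ℂ) * deriv g t :=
      jg.bdd_mul (c := α) (Complex.measurable_ofReal.comp hbm).aestronglyMeasurable
        (ae_of_all _ fun t => by rw [Complex.norm_real]; exact hbα t)
    -- The function b jumps by k₁ + k₂ = α at the origin, so integrating by parts on each half-line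
    -- produces exactly the δ term of the form.
    have e1 : ∫ t, (b t : ℂ) * deriv g t = -(α * g 0) := by
      rw [← intervalIntegral.integral_Iic_add_Ioi jbg.integrableOn jbg.integrableOn (b := 0)]
      have a1 : ∫ t in Iic (0 : ℝ), (b t : ℂ) * deriv g t = -k₂ * g 0 := by
        rw [← hgc.integral_Iic_deriv_eq hg1, ← integral_const_mul]
        refine setIntegral_congr_fun measurableSet_Iic fun t ht => ?_
        simp [hb, not_lt.2 (mem_Iic.1 ht)]
      have a2 : ∫ t in Ioi (0 : ℝ), (b t : ℂ) * deriv g t = k₁ * -g 0 := by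
        rw [← hgc.integral_Ioi_deriv_eq hg1, ← integral_const_mul]
        refine setIntegral_congr_fun measurableSet_Ioi fun t ht => ?_
        simp [hb, mem_Ioi.1 ht]
      rw [a1, a2, ← hk]
      push_cast
      ring
    -- With equality in the rates, b² is the potential minus its ground state energy, so the cross
    -- terms b·(v̄h)' are all that separates the form from the factorized one.
    have hW : ∀ t, (Ioi (0 : ℝ)).indicator (fun _ => V₀) t - threshold α V₀ = b t ^ 2 := fun t => by
      rcases lt_or_ge 0 t with ht | ht
      · rw [indicator_of_mem (mem_Ioi.2 ht)]; simp only [hb, if_pos ht, hk1s]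
      · rw [indicator_of_notMem (by simpa using ht)]
        simp only [hb, if_neg (not_lt.2 ht), neg_sq, hk2s, zero_sub]
    have j1 : Integrable fun t => conj (deriv v t) * ((deriv h t : ℝ) : ℂ) :=
      Continuous.integrable_of_hasCompactSupport
        ((Complex.continuous_conj.comp (hv.continuous_deriv (by simp))).mul
          (Complex.continuous_ofReal.comp (hhs.continuous_deriv (by simp))))
        (HasCompactSupport.intro hvc.deriv fun t ht => by
          simp [image_eq_zero_of_notMem_tsupport ht])
    have j2 : Integrable fun t => ((b t ^ 2 : ℝ) : ℂ) * g t := by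
      refine (hgs.continuous.integrable_of_hasCompactSupport hgc).bdd_mul (c := α ^ 2)
        (Complex.measurable_ofReal.comp (hbm.pow_const 2)).aestronglyMeasurable
        (ae_of_all _ fun t => ?_)
      rw [Complex.norm_real, Real.norm_eq_abs, abs_pow]
      exact pow_le_pow_left₀ (abs_nonneg _) (hbα t) 2
    simp only [hW]
    have e2 : ∀ t, conj (deriv v t + b t * v t) * ((deriv h t + b t * h t : ℝ) : ℂ)
        = (conj (deriv v t) * deriv h t + ((b t ^ 2 : ℝ) : ℂ) * g t)
          + b t * deriv g t := fun t => by
      rw [dg]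
      simp only [hg, map_add, map_mul, Complex.conj_ofReal]
      push_cast
      ring
    simp only [e2]
    rw [integral_add (f := fun t => conj (deriv v t) * ((deriv h t : ℝ) : ℂ)
        + ((b t ^ 2 : ℝ) : ℂ) * g t)
      (j1.add j2) jbg, e1]
    ring

/-! ### Factorization of the transverse form -/

/-- For V₀ ≥ α² the threshold is 0, the bottom of the free motion on the side t < 0. There a wide
bump supported in t < 0 sees neither the step nor the δ, and the trivial factorization with b = 0
works. -/
theorem exists_transverse {α V₀ : ℝ} (hα : 0 < α) (hV₀ : 0 < V₀) {ε : ℝ}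
    (hε : 0 < ε) : ∃ (h b : ℝ → ℝ), ContDiff ℝ (⊤ : ℕ∞) h ∧ HasCompactSupport h ∧
    (0 < ∫ t, h t ^ 2) ∧ Measurable b ∧ (∀ t, |b t| ≤ α) ∧
    (∫ t, (deriv h t + b t * h t) ^ 2 ≤ ε ^ 2 * ∫ t, h t ^ 2) ∧
    ∀ v : ℝ → ℂ, ContDiff ℝ (⊤ : ℕ∞) v → HasCompactSupport v →
      (∫ t, (conj (deriv v t) * ((deriv h t : ℝ) : ℂ) +
        ((Ioi (0 : ℝ)).indicator (fun _ => V₀) t - threshold α V₀ : ℝ) * (conj (v t) * h t)))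
          - α * (conj (v 0) * h 0)
      = ∫ t, conj (deriv v t + b t * v t) * (deriv h t + b t * h t : ℝ) := by
  by_cases hlt : V₀ < α ^ 2
  · exact exists_transverse_of_lt hα hV₀ hlt hε
  obtain ⟨ξ, hξ, hc, h01, h1, h0, hpos⟩ := exists_bump_integral
  set I₀ := ∫ t, ξ t ^ 2 with hI₀
  set I₁ := ∫ t, deriv ξ t ^ 2 with hI₁
  have hI₁0 : 0 ≤ I₁ := integral_nonneg fun _ => sq_nonneg _
  obtain ⟨δ, hδ, hδε⟩ : ∃ δ > 0, δ ^ 2 * I₁ ≤ ε ^ 2 * I₀ := by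
    have hq : 0 < I₁ + I₀ := by positivity
    -- Adding I₀ in the denominator keeps the quotient defined without knowing that I₁ is positive.
    refine ⟨ε * √(I₀ / (I₁ + I₀)), by positivity, ?_⟩
    rw [mul_pow, Real.sq_sqrt (by positivity), mul_assoc]
    gcongr
    rw [div_mul_eq_mul_div, div_le_iff₀ hq]
    nlinarith
  -- For t ≥ 0 the argument is at least 4, beyond the support of ξ.
  set h : ℝ → ℝ := fun t => ξ (δ * t + 4) with hh
  have hz : ∀ t, 0 ≤ t → h t = 0 := fun t ht => h0 _ (by
    have : 0 ≤ δ * t := by positivity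
    rw [abs_of_nonneg (by linarith)]
    linarith)
  have dh : ∀ t, deriv h t = δ * deriv ξ (δ * t + 4) := fun t =>
    (hasDerivAt_affine_comp (hξ.differentiable (by simp)) δ 4 t).deriv
  have e0 : ∫ t, h t ^ 2 = δ⁻¹ * I₀ := integral_sq_comp_affine ξ hδ 4
  refine ⟨h, fun _ => 0, contDiff_affine_comp hξ δ 4, hasCompactSupport_affine_comp hc hδ.ne' 4,
    ?_, measurable_const, fun t => by simpa using hα.le, ?_, fun v hv hvc => ?_⟩
  · rw [e0]; positivity
  · simp only [zero_mul, add_zero, dh, mul_pow]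
    rw [integral_const_mul, integral_sq_comp_affine _ hδ, e0]
    calc δ ^ 2 * (δ⁻¹ * I₁) = δ⁻¹ * (δ ^ 2 * I₁) := by ring
      _ ≤ δ⁻¹ * (ε ^ 2 * I₀) := by gcongr
      _ = _ := by ring
  · rw [hz 0 le_rfl, threshold, if_neg hlt]
    simp only [Complex.ofReal_zero, mul_zero, sub_zero, zero_mul, add_zero]
    refine integral_congr_ae (ae_of_all _ fun t => ?_)
    simp only
    rcases lt_or_ge t 0 with ht | ht
    · rw [indicator_of_notMem (by simpa using ht.le)]; simp
    · rw [hz t ht]; simp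

theorem fderiv_mul_prod {A B : ℝ → ℂ} {a b : ℂ} {p : ℝ × ℝ} (hA : HasDerivAt A a p.1)
    (hB : HasDerivAt B b p.2) (v : ℝ × ℝ) :
    fderiv ℝ (fun q : ℝ × ℝ => A q.1 * B q.2) p v = v.1 * a * B p.2 + A p.1 * (v.2 * b) := by
  have h1 := hA.hasFDerivAt.comp p (hasFDerivAt_fst (𝕜 := ℝ) (p := p))
  have h2 := hB.hasFDerivAt.comp p (hasFDerivAt_snd (𝕜 := ℝ) (p := p))
  have := (h1.mul h2).fderiv
  rw [show (fun q : ℝ × ℝ => A q.1 * B q.2) = (A ∘ Prod.fst) * (B ∘ Prod.snd) from rfl, this]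
  simp
  ring

theorem fderiv_conj {E : Type*} [NormedAddCommGroup E] [NormedSpace ℝ E] {φ : E → ℂ} {x : E}
    (h : DifferentiableAt ℝ φ x) (v : E) :
    fderiv ℝ (fun y => conj (φ y)) x v = conj (fderiv ℝ φ x v) := by
  have := (Complex.conjCLE.hasFDerivAt.comp x h.hasFDerivAt).fderiv
  rw [show (fun y => conj (φ y)) = Complex.conjCLE ∘ φ from rfl, this]
  simp

theorem memLp_mul_prod {f w : ℝ → ℂ} (hf : MemLp f 2 volume) (hw : MemLp w 2 volume) :
    MemLp (fun q : ℝ × ℝ => f q.1 * w q.2) 2 volume := by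
  have hm : AEStronglyMeasurable (fun q : ℝ × ℝ => f q.1 * w q.2) volume :=
    hf.1.comp_fst.mul hw.1.comp_snd
  rw [memLp_two_iff_integrable_sq_norm hm]
  simp only [norm_mul, mul_pow]
  exact ((memLp_two_iff_integrable_sq_norm hf.1).1 hf).mul_prod
    ((memLp_two_iff_integrable_sq_norm hw.1).1 hw)

theorem norm_lp_mul_prod {f w : ℝ → ℂ} (hf : MemLp f 2 volume) (hw : MemLp w 2 volume) :
    ‖lp volume (fun q : ℝ × ℝ => f q.1 * w q.2)‖ ^ 2
      = (∫ s, ‖f s‖ ^ 2) * ∫ t, ‖w t‖ ^ 2 := by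
  rw [norm_lp_sq (memLp_mul_prod hf hw)]
  simp only [norm_mul, mul_pow]
  exact integral_prod_mul (fun s => ‖f s‖ ^ 2) fun t => ‖w t‖ ^ 2

theorem norm_integral_conj_mul_le {X : Type*} [MeasurableSpace X] {ν : Measure X} {f g : X → ℂ}
    (hf : MemLp f 2 ν) (hg : MemLp g 2 ν) :
    ‖∫ x, conj (f x) * g x ∂ν‖ ≤ ‖lp ν f‖ * ‖lp ν g‖ := by
  rw [← inner_lp hf hg]; exact norm_inner_le_norm _ _

/-- Integration by parts along the ray: the longitudinal term becomes one with f'', to be combined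
with k²f. -/
theorem integral_conj_fderiv_mul_prod {V : ℝ × ℝ → ℂ} (hV : ContDiff ℝ (⊤ : ℕ∞) V)
    (hVc : HasCompactSupport V) {f h : ℝ → ℂ} (hf : ContDiff ℝ (⊤ : ℕ∞) f)
    (hh : ContDiff ℝ (⊤ : ℕ∞) h) :
    ∫ q : ℝ × ℝ, conj (fderiv ℝ V q (1, 0)) * (f q.1 * h q.2)
      = -∫ q : ℝ × ℝ, conj (V q) * (deriv f q.1 * h q.2) := by
  set G : ℝ × ℝ → ℂ := fun q => f q.1 * h q.2 with hG
  have hGs : ContDiff ℝ (⊤ : ℕ∞) G := (hf.comp contDiff_fst).mul (hh.comp contDiff_snd)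
  have dG : ∀ q, fderiv ℝ G q (1, 0) = deriv f q.1 * h q.2 := fun q => by
    rw [fderiv_mul_prod (hf.differentiable (by simp) q.1).hasDerivAt
      (hh.differentiable (by simp) q.2).hasDerivAt]
    simp
  have hCs : ContDiff ℝ (⊤ : ℕ∞) fun q => conj (V q) := Complex.conjCLE.contDiff.comp hV
  have hCc : HasCompactSupport fun q => conj (V q) :=
    HasCompactSupport.intro hVc fun q hq => by simp [image_eq_zero_of_notMem_tsupport hq]
  have := integral_mul_fderiv_eq_neg_fderiv_mul_of_integrable (μ := (volume : Measure (ℝ × ℝ)))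
    (f := G) (g := fun q => conj (V q)) (v := (1, 0))
    (((continuous_fderiv_apply hGs _).mul hCs.continuous).integrable_of_hasCompactSupport
      hCc.mul_left)
    ((hGs.continuous.mul (continuous_fderiv_apply hCs _)).integrable_of_hasCompactSupport
      (hCc.fderiv_apply ℝ _).mul_left)
    ((hGs.continuous.mul hCs.continuous).integrable_of_hasCompactSupport hCc.mul_left)
    (fun q _ => hGs.differentiable (by simp) q) (fun q _ => hCs.differentiable (by simp) q)
  simp only [fderiv_conj (hV.differentiable (by simp) _), dG] at this
  simp only [mul_comm (conj _)]
  exact this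

/-- Integrated form of the factorization of the transverse operator. -/
theorem integral_transverse {α V₀ : ℝ} {h b : ℝ → ℝ} (hs : ContDiff ℝ (⊤ : ℕ∞) h)
    (hc : HasCompactSupport h) (hb : Measurable b) (hbα : ∀ t, |b t| ≤ α)
    (H : ∀ v : ℝ → ℂ, ContDiff ℝ (⊤ : ℕ∞) v → HasCompactSupport v →
      (∫ t, (conj (deriv v t) * ((deriv h t : ℝ) : ℂ) +
        ((Ioi (0 : ℝ)).indicator (fun _ => V₀) t - threshold α V₀ : ℝ) * (conj (v t) * h t)))
          - α * (conj (v 0) * h 0)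
      = ∫ t, conj (deriv v t + b t * v t) * (deriv h t + b t * h t : ℝ))
    {V : ℝ × ℝ → ℂ} (hV : ContDiff ℝ (⊤ : ℕ∞) V) (hVc : HasCompactSupport V) {f : ℝ → ℂ}
    (hf : Continuous f) (hfc : HasCompactSupport f) :
    (∫ q : ℝ × ℝ, conj (fderiv ℝ V q (0, 1)) * (f q.1 * ((deriv h q.2 : ℝ) : ℂ)))
      + (∫ q : ℝ × ℝ, ((Ioi (0 : ℝ)).indicator (fun _ => V₀) q.2 : ℝ) *
          (conj (V q) * (f q.1 * h q.2)))
      - threshold α V₀ * (∫ q : ℝ × ℝ, conj (V q) * (f q.1 * h q.2))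
      - α * ∫ s, conj (V (s, 0)) * (f s * h 0)
    = ∫ q : ℝ × ℝ, conj (fderiv ℝ V q (0, 1) + b q.2 * V q) *
        (f q.1 * ((deriv h q.2 + b q.2 * h q.2 : ℝ) : ℂ)) := by
  set W : ℝ → ℝ := (Ioi (0 : ℝ)).indicator (fun _ => V₀) with hW
  have hWm : Measurable W := measurable_const.indicator measurableSet_Ioi
  have hWb : ∀ t, ‖(W t : ℂ)‖ ≤ |V₀| := fun t => by
    rw [Complex.norm_real, hW]
    by_cases ht : t ∈ Ioi (0 : ℝ)
    · rw [indicator_of_mem ht, Real.norm_eq_abs]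
    · rw [indicator_of_notMem ht, norm_zero]; exact abs_nonneg _
  have hdh : Continuous (deriv h) := hs.continuous_deriv (by simp)
  have mV : MemLp V 2 volume := hV.continuous.memLp_of_hasCompactSupport hVc
  have mVt : MemLp (fun q => fderiv ℝ V q (0, 1)) 2 volume :=
    (continuous_fderiv_apply hV _).memLp_of_hasCompactSupport (hVc.fderiv_apply ℝ _)
  have mf : MemLp f 2 volume := hf.memLp_of_hasCompactSupport hfc
  have mh : MemLp (fun t => (h t : ℂ)) 2 volume :=
    (hs.continuous.memLp_of_hasCompactSupport hc).ofReal
  have mdh : MemLp (fun t => ((deriv h t : ℝ) : ℂ)) 2 volume :=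
    (hdh.memLp_of_hasCompactSupport hc.deriv).ofReal
  have mbh : MemLp (fun t => ((deriv h t + b t * h t : ℝ) : ℂ)) 2 volume := by
    have : MemLp (fun t => (b t : ℂ) * (h t : ℂ)) 2 volume :=
      mh.of_le_mul (c := α) ((Complex.measurable_ofReal.comp hb).aestronglyMeasurable.mul mh.1)
        (ae_of_all _ fun t => by
          rw [norm_mul, Complex.norm_real]
          exact mul_le_mul_of_nonneg_right (hbα t) (norm_nonneg _))
    refine (mdh.add this).ae_eq (ae_of_all _ fun t => by simp)
  have mbV : MemLp (fun q : ℝ × ℝ => fderiv ℝ V q (0, 1) + b q.2 * V q) 2 volume := by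
    refine mVt.add (mV.of_le_mul (c := α)
      (((Complex.measurable_ofReal.comp hb).comp measurable_snd).aestronglyMeasurable.mul mV.1)
        (ae_of_all _ fun t => ?_))
    rw [norm_mul]
    refine mul_le_mul_of_nonneg_right ?_ (norm_nonneg _)
    simp only [Complex.norm_real]
    exact hbα _
  have i1 := integrable_conj_mul mVt (memLp_mul_prod mf mdh)
  have i2 := integrable_conj_mul mV (memLp_mul_prod mf mh)
  have i3 : Integrable fun q : ℝ × ℝ => (W q.2 : ℂ) * (conj (V q) * (f q.1 * h q.2)) :=
    i2.bdd_mul (c := |V₀|)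
      ((Complex.measurable_ofReal.comp hWm).comp measurable_snd).aestronglyMeasurable
      (ae_of_all _ fun q => hWb q.2)
  have i4 := integrable_conj_mul mbV (memLp_mul_prod mf mbh)
  have i5 : Integrable fun s => conj (V (s, 0)) * (f s * h 0) := by
    refine Continuous.integrable_of_hasCompactSupport ?_ ?_
    · exact (Complex.continuous_conj.comp (hV.continuous.comp (by fun_prop))).mul
        (hf.mul continuous_const)
    · exact HasCompactSupport.intro hfc fun s hs => by
        simp [image_eq_zero_of_notMem_tsupport hs]
  set K : ℝ × ℝ → ℂ := fun q => f q.1 * (conj (fderiv ℝ V q (0, 1)) * ((deriv h q.2 : ℝ) : ℂ) +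
        ((W q.2 - threshold α V₀ : ℝ) : ℂ) * (conj (V q) * h q.2)) with hK
  have eK : ∀ q, K q = conj (fderiv ℝ V q (0, 1)) * (f q.1 * ((deriv h q.2 : ℝ) : ℂ))
      + (W q.2 : ℂ) * (conj (V q) * (f q.1 * h q.2))
      - threshold α V₀ * (conj (V q) * (f q.1 * h q.2)) := fun q => by
    simp only [hK]; push_cast; ring
  have iK : Integrable K := by
    rw [show K = _ from funext eK]; exact (i1.add i3).sub (i2.const_mul _)
  have e1 : (∫ q : ℝ × ℝ, conj (fderiv ℝ V q (0, 1)) * (f q.1 * ((deriv h q.2 : ℝ) : ℂ)))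
      + (∫ q : ℝ × ℝ, (W q.2 : ℂ) * (conj (V q) * (f q.1 * h q.2)))
      - threshold α V₀ * (∫ q : ℝ × ℝ, conj (V q) * (f q.1 * h q.2)) = ∫ s, ∫ t, K (s, t) := by
    rw [← integral_prod K iK, ← Measure.volume_eq_prod, ← integral_const_mul, ← integral_add i1 i3,
      ← integral_sub (f := fun q : ℝ × ℝ => conj (fderiv ℝ V q (0, 1)) *
          (f q.1 * ((deriv h q.2 : ℝ) : ℂ))
        + (W q.2 : ℂ) * (conj (V q) * (f q.1 * h q.2))) (i1.add i3) (i2.const_mul _)]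
    exact integral_congr_ae (ae_of_all _ fun q => (eK q).symm)
  rw [e1, ← integral_const_mul, ← integral_sub iK.integral_prod_left (i5.const_mul _)]
  rw [Measure.volume_eq_prod, integral_prod _ i4]
  refine integral_congr_ae (ae_of_all _ fun s => ?_)
  -- The transverse identity is applied on the line through each s and integrated against f(s).
  have hv := H (fun t => V (s, t)) (contDiff_vertical hV s)
    (hVc.comp_isClosedEmbedding (isClosedEmbedding_vertical s))
  simp only [deriv_vertical hV] at hv
  simp only [hK]
  rw [integral_const_mul]
  have e2 : ∀ t, conj (fderiv ℝ V (s, t) (0, 1) + b t * V (s, t)) *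
      (f s * ((deriv h t + b t * h t : ℝ) : ℂ)) = f s * (conj (fderiv ℝ V (s, t) (0, 1)
        + b t * V (s, t)) * ((deriv h t + b t * h t : ℝ) : ℂ)) := fun t => by ring
  simp only [e2]
  rw [integral_const_mul, ← hv]
  ring

/-! ### Approximate solutions of the eigenvalue equation -/

theorem norm_lp_le_mul {X : Type*} [MeasurableSpace X] {ν : Measure X} {f g : X → ℂ} {c : ℝ}
    (hf : MemLp f 2 ν) (hg : MemLp g 2 ν) (h : ∀ᵐ x ∂ν, ‖f x‖ ≤ c * ‖g x‖) :
    ‖lp ν f‖ ≤ c * ‖lp ν g‖ := by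
  refine Lp.norm_le_mul_norm_of_ae_le_mul ?_
  filter_upwards [coeFn_lp hf, coeFn_lp hg, h] with x h1 h2 h3
  rwa [h1, h2]

theorem norm_lp_comp_rot {θ : ℝ} {g : ℝ × ℝ → ℂ} (hg : MemLp g 2 volume)
    (hz : ∀ p, p ∉ halfPlane → g p = 0) :
    MemLp (fun q => g (rot θ q)) 2 volume ∧
      ‖lp volume (fun q => g (rot θ q))‖ = ‖lp (volume.restrict halfPlane) g‖ := by
  have hm : MemLp (fun q => g (rot θ q)) 2 volume :=
    hg.comp_measurePreserving (measurePreserving_rot θ)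
  refine ⟨hm, ?_⟩
  rw [← sq_eq_sq₀ (norm_nonneg _) (norm_nonneg _), norm_lp_sq hm, norm_lp_sq (hg.restrict _),
    setIntegral_halfPlane_eq_rot θ fun p hp => by simp [hz p hp]]

theorem norm_lp_fderiv_comp_rot_le {θ : ℝ} {v : ℝ × ℝ → ℂ} (h : IsTest halfPlane v) :
    ‖lp volume (fun q => fderiv ℝ (fun q => v (rot θ q)) q (0, 1))‖ ≤
      ‖lp (volume.restrict halfPlane) (fun p => fderiv ℝ v p (1, 0))‖
        + ‖lp (volume.restrict halfPlane) (fun p => fderiv ℝ v p (0, 1))‖ := by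
  have e : (fun q => fderiv ℝ (fun q => v (rot θ q)) q (0, 1)) =
      (-(Real.cos θ : ℂ)) • (fun q => fderiv ℝ v (rot θ q) (1, 0))
        + (Real.sin θ : ℂ) • fun q => fderiv ℝ v (rot θ q) (0, 1) := by
    ext q
    rw [fderiv_comp_rot h]
    simp
  have hz : ∀ w p, p ∉ halfPlane → fderiv ℝ v p w = 0 := fun w p hp => by
    simp [h.fderiv_eq_zero hp]
  obtain ⟨m1, n1⟩ := norm_lp_comp_rot (θ := θ) (h.memLp_fderiv (1, 0)) (hz _)
  obtain ⟨m2, n2⟩ := norm_lp_comp_rot (θ := θ) (h.memLp_fderiv (0, 1)) (hz _)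
  rw [e, lp_add (m1.const_smul _) (m2.const_smul _), lp_const_smul m1, lp_const_smul m2]
  refine (norm_add_le _ _).trans ?_
  rw [norm_smul, norm_smul, n1, n2, norm_neg, Complex.norm_real, Complex.norm_real]
  exact add_le_add (mul_le_of_le_one_left (norm_nonneg _) (Real.abs_cos_le_one θ))
    (mul_le_of_le_one_left (norm_nonneg _) (Real.abs_sin_le_one θ))

/-- On the support r = s sin θ - t cos θ ≥ R sin θ - T ≥ ρ, so pushing the packet out along the ray
keeps the whole product at distance at least ρ from the axis. -/
theorem isTest_mul_unrot {θ ρ T R : ℝ} (hθ : 0 < Real.sin θ) (hρ : 0 < ρ)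
    (hR : ρ + T ≤ R * Real.sin θ) {f h : ℝ → ℂ} (hf : ContDiff ℝ (⊤ : ℕ∞) f)
    (hfc : HasCompactSupport f) (hf0 : ∀ s ≤ R, f s = 0) (hh : ContDiff ℝ (⊤ : ℕ∞) h)
    (hhc : HasCompactSupport h) (hT : ∀ t, T < |t| → h t = 0) :
    IsTest halfPlane (fun p => f (unrot θ p).1 * h (unrot θ p).2) ∧
      ∀ p, p.1 < ρ → f (unrot θ p).1 * h (unrot θ p).2 = 0 := by
  have hz : ∀ p : ℝ × ℝ, p.1 < ρ → f (unrot θ p).1 * h (unrot θ p).2 = 0 := fun p hp => by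
    by_contra hne
    obtain ⟨h1, h2⟩ := mul_ne_zero_iff.1 hne
    have a1 : R < (unrot θ p).1 := not_le.1 fun h => h1 (hf0 _ h)
    have a2 : |(unrot θ p).2| ≤ T := not_lt.1 fun h => h2 (hT _ h)
    have e : p.1 = (unrot θ p).1 * Real.sin θ - (unrot θ p).2 * Real.cos θ := by
      conv_lhs => rw [← rot_unrot θ p, rot_apply]
    have a3 : (unrot θ p).2 * Real.cos θ ≤ T := by
      refine (le_abs_self _).trans ?_
      rw [abs_mul]
      exact (mul_le_of_le_one_right (abs_nonneg _) (Real.abs_cos_le_one θ)).trans a2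
    have a4 := mul_lt_mul_of_pos_right a1 hθ
    linarith
  refine ⟨⟨?_, ?_, ?_⟩, hz⟩
  · exact (hf.comp (contDiff_fst.comp (contDiff_unrot θ))).mul
      (hh.comp (contDiff_snd.comp (contDiff_unrot θ)))
  · have hc : HasCompactSupport fun q : ℝ × ℝ => f q.1 * h q.2 :=
      HasCompactSupport.intro (hfc.isCompact.prod hhc.isCompact) fun q hq => by
        rw [mem_prod, not_and_or] at hq
        rcases hq with hq | hq <;> simp [image_eq_zero_of_notMem_tsupport hq]
    exact hc.comp_homeomorph (rotHomeomorph θ).symm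
  · have : tsupport (fun p => f (unrot θ p).1 * h (unrot θ p).2) ⊆ {p : ℝ × ℝ | ρ ≤ p.1} :=
      closure_minimal (fun p hp => not_lt.1 fun h => hp (hz p h))
        (isClosed_le continuous_const continuous_fst)
    exact fun p hp => hρ.trans_le (this hp)

/-- The form without the centrifugal term applied to a wave packet along the half-line. -/
theorem form_mul_unrot {α V₀ θ k l : ℝ} (hθ : 0 < Real.sin θ)
    (hk : k ^ 2 = l - threshold α V₀)
    {f : ℝ → ℂ} {h b : ℝ → ℝ} (hf : ContDiff ℝ (⊤ : ℕ∞) f) (hfc : HasCompactSupport f)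
    (hs : ContDiff ℝ (⊤ : ℕ∞) h) (hc : HasCompactSupport h) (hb : Measurable b)
    (hbα : ∀ t, |b t| ≤ α)
    (H : ∀ v : ℝ → ℂ, ContDiff ℝ (⊤ : ℕ∞) v → HasCompactSupport v →
      (∫ t, (conj (deriv v t) * ((deriv h t : ℝ) : ℂ) +
        ((Ioi (0 : ℝ)).indicator (fun _ => V₀) t - threshold α V₀ : ℝ) * (conj (v t) * h t)))
          - α * (conj (v 0) * h 0)
      = ∫ t, conj (deriv v t + b t * v t) * (deriv h t + b t * h t : ℝ))
    {u v : ℝ × ℝ → ℂ} (hu : IsTest halfPlane u) (hv : IsTest halfPlane v)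
    (huf : ∀ q, u (rot θ q) = f q.1 * h q.2) :
    (∫ p in halfPlane, conj (fderiv ℝ v p (1, 0)) * fderiv ℝ u p (1, 0))
      + (∫ p in halfPlane, conj (fderiv ℝ v p (0, 1)) * fderiv ℝ u p (0, 1))
      + (∫ p in halfPlane, conj (v p) * (biasRZ V₀ θ p * u p))
      - α * (∫ s in Ioi (0 : ℝ), conj (v (ray θ s)) * u (ray θ s))
      - l * (∫ p in halfPlane, conj (v p) * u p)
    = (∫ q : ℝ × ℝ, conj (fderiv ℝ (fun q => v (rot θ q)) q (0, 1) + b q.2 * v (rot θ q)) *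
        (f q.1 * ((deriv h q.2 + b q.2 * h q.2 : ℝ) : ℂ)))
      - ∫ q : ℝ × ℝ, conj (v (rot θ q)) * ((deriv (deriv f) q.1 + k ^ 2 * f q.1) * h q.2) := by
  set V : ℝ × ℝ → ℂ := fun q => v (rot θ q) with hVd
  have hV : ContDiff ℝ (⊤ : ℕ∞) V := contDiff_comp_rot hv
  have hVc : HasCompactSupport V := hasCompactSupport_comp_rot hv
  have hhC : ContDiff ℝ (⊤ : ℕ∞) fun t => (h t : ℂ) := Complex.ofRealCLM.contDiff.comp hs
  have hdf : ContDiff ℝ (⊤ : ℕ∞) (deriv f) := (contDiff_infty_iff_deriv.1 hf).2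
  have dU : ∀ q w, fderiv ℝ (fun q => u (rot θ q)) q w
      = w.1 * deriv f q.1 * h q.2 + f q.1 * (w.2 * ((deriv h q.2 : ℝ) : ℂ)) := fun q w => by
    rw [show (fun q => u (rot θ q)) = fun q : ℝ × ℝ => f q.1 * (h q.2 : ℂ) from funext huf]
    exact fderiv_mul_prod (hf.differentiable (by simp) q.1).hasDerivAt
      (hs.differentiable (by simp) q.2).hasDerivAt.ofReal_comp w
  have mV : MemLp V 2 volume := hV.continuous.memLp_of_hasCompactSupport hVc
  have mVd : ∀ w, MemLp (fun q => fderiv ℝ V q w) 2 volume := fun w =>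
    (continuous_fderiv_apply hV _).memLp_of_hasCompactSupport (hVc.fderiv_apply ℝ _)
  have mf : MemLp f 2 volume := hf.continuous.memLp_of_hasCompactSupport hfc
  have mdf : MemLp (deriv f) 2 volume := hdf.continuous.memLp_of_hasCompactSupport hfc.deriv
  have mddf : MemLp (deriv (deriv f)) 2 volume :=
    (hdf.continuous_deriv (by simp)).memLp_of_hasCompactSupport hfc.deriv.deriv
  have mh : MemLp (fun t => (h t : ℂ)) 2 volume :=
    (hs.continuous.memLp_of_hasCompactSupport hc).ofReal
  have mdh : MemLp (fun t => ((deriv h t : ℝ) : ℂ)) 2 volume :=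
    ((hs.continuous_deriv (by simp)).memLp_of_hasCompactSupport hc.deriv).ofReal
  have eA : (∫ p in halfPlane, conj (fderiv ℝ v p (1, 0)) * fderiv ℝ u p (1, 0))
      + (∫ p in halfPlane, conj (fderiv ℝ v p (0, 1)) * fderiv ℝ u p (0, 1))
      = (∫ q : ℝ × ℝ, conj (fderiv ℝ V q (1, 0)) * (deriv f q.1 * h q.2))
        + ∫ q : ℝ × ℝ, conj (fderiv ℝ V q (0, 1)) * (f q.1 * ((deriv h q.2 : ℝ) : ℂ)) := by
    rw [← integral_add (integrable_conj_mul ((hv.memLp_fderiv _).restrict _)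
        ((hu.memLp_fderiv _).restrict _)) (integrable_conj_mul ((hv.memLp_fderiv _).restrict _)
        ((hu.memLp_fderiv _).restrict _)),
      ← integral_add (integrable_conj_mul (mVd _) (memLp_mul_prod mdf mh))
        (integrable_conj_mul (mVd _) (memLp_mul_prod mf mdh)),
      setIntegral_halfPlane_eq_rot θ fun p hp => by simp [hv.fderiv_eq_zero hp]]
    refine integral_congr_ae (ae_of_all _ fun q => ?_)
    simp only [gradient_comp_rot hv hu, dU]
    simp [hVd]
  have eC : (∫ p in halfPlane, conj (v p) * (biasRZ V₀ θ p * u p))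
      = ∫ q : ℝ × ℝ, ((Ioi (0 : ℝ)).indicator (fun _ => V₀) q.2 : ℝ) *
          (conj (V q) * (f q.1 * h q.2)) := by
    rw [setIntegral_halfPlane_eq_rot θ fun p hp => by simp [hv.eq_zero hp]]
    refine integral_congr_ae (ae_of_all _ fun q => ?_)
    by_cases hq : rot θ q ∈ halfPlane
    · simp only [biasRZ_rot hθ hq, hVd, huf]; ring
    · simp [hVd, hv.eq_zero hq]
  have eD : (∫ s in Ioi (0 : ℝ), conj (v (ray θ s)) * u (ray θ s))
      = ∫ s, conj (V (s, 0)) * (f s * h 0) := by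
    rw [setIntegral_eq_integral_of_forall_compl_eq_zero fun s hs => ?_]
    · simp only [hVd, ← rot_zero_right, huf]
    -- The points with s ≤ 0 lie outside the half-plane, where v is zero, so the trace integral may
    -- run over the whole line.
    · rw [hv.eq_zero, map_zero, zero_mul]
      simp only [halfPlane, ray, Set.mem_ofPred_eq, not_lt]
      exact mul_nonpos_of_nonpos_of_nonneg (not_lt.1 hs) hθ.le
  have eE : (∫ p in halfPlane, conj (v p) * u p) = ∫ q : ℝ × ℝ, conj (V q) * (f q.1 * h q.2) := by
    rw [setIntegral_halfPlane_eq_rot θ fun p hp => by simp [hv.eq_zero hp]]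
    simp only [hVd, huf]
  have eJ : (∫ q : ℝ × ℝ, conj (V q) * ((deriv (deriv f) q.1 + k ^ 2 * f q.1) * h q.2))
      = (∫ q : ℝ × ℝ, conj (V q) * (deriv (deriv f) q.1 * h q.2))
        + k ^ 2 * ∫ q : ℝ × ℝ, conj (V q) * (f q.1 * h q.2) := by
    rw [← integral_const_mul, ← integral_add (integrable_conj_mul mV (memLp_mul_prod mddf mh))
      ((integrable_conj_mul mV (memLp_mul_prod mf mh)).const_mul _)]
    refine integral_congr_ae (ae_of_all _ fun q => ?_)
    simp only
    ring
  have hkC : (k : ℂ) ^ 2 = l - threshold α V₀ := by exact_mod_cast hk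
  rw [eA, eC, eD, eE, eJ, integral_conj_fderiv_mul_prod hV hVc hdf hhC,
    ← integral_transverse hs hc hb hbα H hV hVc hf.continuous hfc, hkC]
  ring

/-- Approximate solutions of the eigenvalue equation in the weak sense, far out on the half-line. -/
theorem exists_approximate {α V₀ θ : ℝ} (hα : 0 < α) (hV₀ : 0 < V₀) (hθ : 0 < Real.sin θ) (c : ℂ)
    {l : ℝ} (hl : threshold α V₀ ≤ l) {ε : ℝ} (hε : 0 < ε) :
    ∃ u, IsTest halfPlane u ∧ 0 < ‖lp (volume.restrict halfPlane) u‖ ∧ ∀ v, IsTest halfPlane v →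
      ‖(∫ p in halfPlane, conj (fderiv ℝ v p (1, 0)) * fderiv ℝ u p (1, 0))
        + (∫ p in halfPlane, conj (fderiv ℝ v p (0, 1)) * fderiv ℝ u p (0, 1))
        + c * (∫ p in halfPlane, conj (v p) * (u p / p.1 / p.1))
        + (∫ p in halfPlane, conj (v p) * (biasRZ V₀ θ p * u p))
        - α * (∫ s in Ioi (0 : ℝ), conj (v (ray θ s)) * u (ray θ s))
        - l * (∫ p in halfPlane, conj (v p) * u p)‖ ≤
      ε * ‖lp (volume.restrict halfPlane) u‖ * (‖lp (volume.restrict halfPlane) v‖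
        + ‖lp (volume.restrict halfPlane) (fun p => fderiv ℝ v p (1, 0))‖
        + ‖lp (volume.restrict halfPlane) (fun p => fderiv ℝ v p (0, 1))‖) := by
  set k := √(l - threshold α V₀) with hkd
  have hk : k ^ 2 = l - threshold α V₀ := Real.sq_sqrt (by linarith)
  -- Half of ε pays for the residuals of f and h, where the factor 1 + α comes from the packet
  -- residual and |b| ≤ α; the other half pays for the centrifugal term.
  set ε₁ := ε / (2 * (1 + α)) with hε₁d
  have hε₁ : 0 < ε₁ := by positivity
  have hεe : ε₁ * (1 + α) = ε / 2 := by rw [hε₁d]; field_simp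
  -- Large enough that |c|/ρ² ≤ |c|/ρ ≤ ε/2; the 1 ensures ρ ≥ 1.
  set ρ := 1 + 2 * ‖c‖ / ε with hρd
  have hρ : 1 ≤ ρ := le_add_of_nonneg_right (by positivity)
  obtain ⟨h, b, hs, hc, hpos, hb, hbα, hle, H⟩ := exists_transverse hα hV₀ hε₁
  obtain ⟨T, hT⟩ : ∃ T : ℝ, ∀ t, T < |t| → h t = 0 := by
    obtain ⟨T, hT⟩ := hc.isCompact.isBounded.exists_norm_le
    exact ⟨T, fun t ht => image_eq_zero_of_notMem_tsupport fun h => ht.not_ge (hT t h)⟩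
  obtain ⟨f, hf, hfc, hf0, hfpos, hfle⟩ := exists_wavePacket k ((ρ + T) / Real.sin θ) hε₁
  have hhC : ContDiff ℝ (⊤ : ℕ∞) fun t => (h t : ℂ) := Complex.ofRealCLM.contDiff.comp hs
  have hhCc : HasCompactSupport fun t => (h t : ℂ) := hc.comp_left Complex.ofReal_zero
  have huz := isTest_mul_unrot (ρ := ρ) (T := T) hθ (by linarith)
    (by rw [div_mul_cancel₀ _ hθ.ne']) hf hfc hf0 hhC hhCc fun t ht => by simp [hT t ht]
  obtain ⟨u, hu, hz, huf⟩ : ∃ u, IsTest halfPlane u ∧ (∀ p, p.1 < ρ → u p = 0) ∧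
      ∀ q, u (rot θ q) = f q.1 * h q.2 :=
    ⟨_, huz.1, huz.2, fun q => by simp only [unrot_rot]⟩
  have mf : MemLp f 2 volume := hf.continuous.memLp_of_hasCompactSupport hfc
  have mh : MemLp (fun t => (h t : ℂ)) 2 volume :=
    (hs.continuous.memLp_of_hasCompactSupport hc).ofReal
  have hdf : ContDiff ℝ (⊤ : ℕ∞) (deriv f) := (contDiff_infty_iff_deriv.1 hf).2
  have mg : MemLp (fun s => deriv (deriv f) s + k ^ 2 * f s) 2 volume :=
    ((hdf.continuous_deriv (by simp)).memLp_of_hasCompactSupport hfc.deriv.deriv).add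
      (mf.const_mul _)
  have mdh : MemLp (fun t => ((deriv h t : ℝ) : ℂ)) 2 volume :=
    ((hs.continuous_deriv (by simp)).memLp_of_hasCompactSupport hc.deriv).ofReal
  have hbC : Measurable fun t => (b t : ℂ) := Complex.measurable_ofReal.comp hb
  have mbh : MemLp (fun t => ((deriv h t + b t * h t : ℝ) : ℂ)) 2 volume := by
    have : MemLp (fun t => (b t : ℂ) * (h t : ℂ)) 2 volume :=
      mh.of_le_mul (c := α) (hbC.aestronglyMeasurable.mul mh.1) (ae_of_all _ fun t => by
        rw [norm_mul, Complex.norm_real]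
        exact mul_le_mul_of_nonneg_right (hbα t) (norm_nonneg _))
    refine (mdh.add this).ae_eq (ae_of_all _ fun t => by simp)
  have hN : ‖lp (volume.restrict halfPlane) u‖ =
      ‖lp volume fun q : ℝ × ℝ => f q.1 * (h q.2 : ℂ)‖ := by
    rw [← (norm_lp_comp_rot (θ := θ) hu.memLp fun p hp => hu.eq_zero hp).2]
    simp only [huf]
  set N := ‖lp (volume.restrict halfPlane) u‖ with hNd
  have hN2 : N ^ 2 = (∫ s, ‖f s‖ ^ 2) * ∫ t, h t ^ 2 := by
    rw [hN, norm_lp_mul_prod mf mh]; simp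
  have hNpos : 0 < N := by
    have : 0 < N ^ 2 := by rw [hN2]; positivity
    exact (norm_nonneg _).lt_of_ne fun h => by rw [hNd, ← h] at this; norm_num at this
  have n1 : ‖lp volume fun q : ℝ × ℝ => (deriv (deriv f) q.1 + k ^ 2 * f q.1) * (h q.2 : ℂ)‖
      ≤ ε₁ * N := by
    rw [← sq_le_sq₀ (norm_nonneg _) (by positivity), norm_lp_mul_prod mg mh, mul_pow, hN2]
    simp only [Complex.norm_real, Real.norm_eq_abs, sq_abs]
    rw [← mul_assoc]
    exact mul_le_mul_of_nonneg_right hfle hpos.le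
  have n2 : ‖lp volume fun q : ℝ × ℝ => f q.1 * ((deriv h q.2 + b q.2 * h q.2 : ℝ) : ℂ)‖
      ≤ ε₁ * N := by
    rw [← sq_le_sq₀ (norm_nonneg _) (by positivity), norm_lp_mul_prod mf mbh, mul_pow, hN2]
    simp only [Complex.norm_real, Real.norm_eq_abs, sq_abs]
    rw [mul_left_comm]
    exact mul_le_mul_of_nonneg_left hle hfpos.le
  refine ⟨u, hu, hNpos, fun v hv => ?_⟩
  have mu : MemLp (fun p => u p / (p.1 : ℂ) / (p.1 : ℂ)) 2 (volume.restrict halfPlane) :=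
    (isTest_div (isTest_div hu)).memLp.restrict _
  have n3 : ‖lp (volume.restrict halfPlane) (fun p => u p / (p.1 : ℂ) / (p.1 : ℂ))‖ ≤ ρ⁻¹ * N := by
    refine norm_lp_le_mul mu (hu.memLp.restrict _) (ae_of_all _ fun p => ?_)
    rcases lt_or_ge p.1 ρ with hp | hp
    · rw [hz p hp]; simp
    · have hp1 : 1 ≤ p.1 := hρ.trans hp
      rw [div_div, norm_div, norm_mul, Complex.norm_real, Real.norm_eq_abs,
        abs_of_pos (by linarith), div_eq_inv_mul]
      refine mul_le_mul_of_nonneg_right (inv_anti₀ (by linarith) ?_) (norm_nonneg _)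
      nlinarith
  have n4 : ‖c * ∫ p in halfPlane, conj (v p) * (u p / p.1 / p.1)‖ ≤
      ε / 2 * N * ‖lp (volume.restrict halfPlane) v‖ := by
    rw [norm_mul]
    have hcρ : ‖c‖ * ρ⁻¹ ≤ ε / 2 := by
      rw [← div_eq_mul_inv, div_le_iff₀ (by linarith), hρd]
      have : ε / 2 * (2 * ‖c‖ / ε) = ‖c‖ := by field_simp
      nlinarith
    calc _ ≤ ‖c‖ * (‖lp (volume.restrict halfPlane) v‖ * (ρ⁻¹ * N)) := by
          refine mul_le_mul_of_nonneg_left ?_ (norm_nonneg _)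
          exact (norm_integral_conj_mul_le (hv.memLp.restrict _) mu).trans
            (mul_le_mul_of_nonneg_left n3 (norm_nonneg _))
      _ = (‖c‖ * ρ⁻¹) * (N * ‖lp (volume.restrict halfPlane) v‖) := by ring
      _ ≤ ε / 2 * (N * ‖lp (volume.restrict halfPlane) v‖) := by gcongr
      _ = _ := by ring
  obtain ⟨mV, nV⟩ := norm_lp_comp_rot (θ := θ) hv.memLp fun p hp => hv.eq_zero hp
  have hVs : ContDiff ℝ (⊤ : ℕ∞) fun q => v (rot θ q) := contDiff_comp_rot hv
  have mVt : MemLp (fun q => fderiv ℝ (fun q => v (rot θ q)) q (0, 1)) 2 volume :=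
    (continuous_fderiv_apply hVs _).memLp_of_hasCompactSupport
      ((hasCompactSupport_comp_rot hv).fderiv_apply ℝ _)
  have hbV : ∀ q : ℝ × ℝ, ‖(b q.2 : ℂ) * v (rot θ q)‖ ≤ α * ‖v (rot θ q)‖ := fun q => by
    rw [norm_mul, Complex.norm_real]
    exact mul_le_mul_of_nonneg_right (hbα q.2) (norm_nonneg _)
  have mbV : MemLp (fun q : ℝ × ℝ => (b q.2 : ℂ) * v (rot θ q)) 2 volume :=
    mV.of_le_mul (c := α) ((hbC.comp measurable_snd).aestronglyMeasurable.mul mV.1)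
      (ae_of_all _ hbV)
  have n5 : ‖lp volume fun q : ℝ × ℝ =>
      fderiv ℝ (fun q => v (rot θ q)) q (0, 1) + b q.2 * v (rot θ q)‖ ≤
      (‖lp (volume.restrict halfPlane) (fun p => fderiv ℝ v p (1, 0))‖
        + ‖lp (volume.restrict halfPlane) (fun p => fderiv ℝ v p (0, 1))‖)
        + α * ‖lp (volume.restrict halfPlane) v‖ := by
    refine (congrArg norm (lp_add mVt mbV)).le.trans ((norm_add_le _ _).trans
      (add_le_add (norm_lp_fderiv_comp_rot_le hv) ?_))
    rw [← nV]
    exact norm_lp_le_mul mbV mV (ae_of_all _ hbV)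
  have n6 := (norm_integral_conj_mul_le (mVt.add mbV) (memLp_mul_prod mf mbh)).trans
    (mul_le_mul n5 n2 (norm_nonneg _) (by positivity))
  have n7 := (norm_integral_conj_mul_le mV (memLp_mul_prod mg mh)).trans
    (mul_le_mul nV.le n1 (norm_nonneg _) (by positivity))
  have key := form_mul_unrot hθ hk hf hfc hs hc hb hbα H hu hv huf
  set Nv := ‖lp (volume.restrict halfPlane) v‖
  set Nr := ‖lp (volume.restrict halfPlane) (fun p => fderiv ℝ v p (1, 0))‖
  set Nz := ‖lp (volume.restrict halfPlane) (fun p => fderiv ℝ v p (0, 1))‖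
  have hNr : 0 ≤ Nr := norm_nonneg _
  have hNz : 0 ≤ Nz := norm_nonneg _
  have hNv : 0 ≤ Nv := norm_nonneg _
  refine le_trans (b := ((Nr + Nz) + α * Nv) * (ε₁ * N) + Nv * (ε₁ * N) + ε / 2 * N * Nv) ?_ ?_
  · refine le_trans (le_of_eq (congrArg norm ?_)) (norm_add_le_of_le (norm_sub_le_of_le n6 n7) n4)
    simp only [Pi.add_apply]
    rw [← key]
    ring
  · have e1 : ε = ε / 2 + ε₁ * (1 + α) := by rw [hεe]; ring
    have : 0 ≤ ε₁ * N * (α * (Nr + Nz)) := by positivity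
    have : 0 ≤ ε / 2 * N * (Nr + Nz) := by positivity
    have e2 : ε * N * (Nv + Nr + Nz) = ε / 2 * N * (Nv + Nr + Nz)
        + ε₁ * (1 + α) * N * (Nv + Nr + Nz) := by rw [hεe]; ring
    rw [e2]
    linarith

/-! ### Estimates for the partial-wave form -/

/-- The bound against smooth v extends to admissible v because both sides are continuous in v for H¹
convergence. -/
theorem exists_approximate_form {α V₀ θ : ℝ} (hα : 0 < α) (hV₀ : 0 < V₀) (hθ : 0 < Real.sin θ)
    (m : ℤ) {l : ℝ} (hl : threshold α V₀ ≤ l) {ε : ℝ} (hε : 0 < ε) :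
    ∃ u, IsTest halfPlane u ∧ 0 < ‖lp (volume.restrict halfPlane) u‖ ∧ ∀ v, Admissible v →
      ‖qmSesq α V₀ θ m v u
        - l * ⟪lp (volume.restrict halfPlane) v, lp (volume.restrict halfPlane) u⟫_ℂ‖ ≤
      ε * ‖lp (volume.restrict halfPlane) u‖ * (‖lp (volume.restrict halfPlane) v‖
        + ‖lp (volume.restrict halfPlane) (dr v)‖ + ‖lp (volume.restrict halfPlane) (dz v)‖) := by
  obtain ⟨u, hu, hpos, H⟩ := exists_approximate hα hV₀ hθ ((m : ℂ) ^ 2 - 1 / 4) hl hε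
  refine ⟨u, hu, hpos, fun v hv => ?_⟩
  obtain ⟨hua, hur, huz⟩ := hu.admissible
  have mu : MemLp (fun p => u p / (p.1 : ℂ) / (p.1 : ℂ)) 2 (volume.restrict halfPlane) :=
    (isTest_div (isTest_div hu)).memLp.restrict _
  have m0 := hu.memLp.restrict halfPlane
  have mr := (hu.memLp_fderiv (1, 0)).restrict halfPlane
  have mz := (hu.memLp_fderiv (0, 1)).restrict halfPlane
  have mt := memLp_ray hu.smooth hu.compact θ
  obtain ⟨φ, hφ, ht⟩ := hv.exists_test_tendsto
  have t0 := ht.tendsto_lp_val hv hφ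
  have t1 := ht.tendsto_lp_dr hv hφ
  have t2 := ht.tendsto_lp_dz hv hφ
  have t4 := ht.tendsto_lp_trace hθ hv hφ
  -- The whole weight 1/r² is moved onto u, which vanishes near the axis, because the approximations
  -- of v need not be known to converge after division by r.
  have eh : ⟪lp (volume.restrict halfPlane) (fun p => v p / (p.1 : ℂ)),
      lp (volume.restrict halfPlane) (fun p => u p / (p.1 : ℂ))⟫_ℂ =
      ⟪lp (volume.restrict halfPlane) v,
        lp (volume.restrict halfPlane) (fun p => u p / (p.1 : ℂ) / (p.1 : ℂ))⟫_ℂ := by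
    rw [inner_lp hv.hardy hua.hardy, inner_lp hv.memLp mu]
    congr 1
    ext p
    simp only [map_div₀, Complex.conj_ofReal]
    ring
  rw [qmSesq_eq hV₀ hθ m hv hua, lp_congr hur, lp_congr huz, lp_congr (hu.trace_ae_eq hθ), eh]
  refine le_of_tendsto_of_tendsto'
    (((((((t1.inner tendsto_const_nhds).add (t2.inner tendsto_const_nhds)).add
      ((t0.inner tendsto_const_nhds).const_mul _)).add (t0.inner tendsto_const_nhds)).sub
      ((t4.inner tendsto_const_nhds).const_mul _)).sub
      ((t0.inner tendsto_const_nhds).const_mul _)).norm)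
    (((t0.norm.add t1.norm).add t2.norm).const_mul _) fun n => ?_
  have m0' := (hφ n).memLp.restrict halfPlane
  rw [inner_lp (((hφ n).memLp_fderiv _).restrict _) mr,
    inner_lp (((hφ n).memLp_fderiv _).restrict _) mz, inner_lp m0' mu,
    inner_lp m0' (memLp_bias hV₀ m0), inner_lp (memLp_ray (hφ n).smooth (hφ n).compact θ) mt,
    inner_lp m0' m0]
  exact H _ (hφ n)

/-- The gradient is controlled by the form and the norm. -/
theorem Admissible.norm_gradient_le {α V₀ θ : ℝ} (hα : 0 < α) (hV₀ : 0 < V₀)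
    (hθ : 0 < Real.sin θ) {m : ℤ} (hm : m ≠ 0) {ω : ℝ × ℝ → ℂ} (h : Admissible ω) :
    threshold α V₀ * ‖lp (volume.restrict halfPlane) ω‖ ^ 2 ≤ qm α V₀ θ m ω ∧
      ‖lp (volume.restrict halfPlane) (dr ω)‖ ^ 2 + ‖lp (volume.restrict halfPlane) (dz ω)‖ ^ 2
        ≤ 2 * qm α V₀ θ m ω
          - threshold (2 * α) V₀ * ‖lp (volume.restrict halfPlane) ω‖ ^ 2 := by
  have h1 := h.lower_bound hα hV₀ hθ
  -- The lower bound at doubled coupling gives coercivity: with G the gradient, B the bias and T the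
  -- trace term, 2q ≥ 2G + 2B - 2αT, and G + B - 2αT is bounded below, which leaves G to spare.
  have h2 := h.lower_bound (α := 2 * α) (by positivity) hV₀ hθ
  have hb : 0 ≤ (⟪lp (volume.restrict halfPlane) ω,
      lp (volume.restrict halfPlane) (fun p => (biasRZ V₀ θ p : ℂ) * ω p)⟫_ℂ).re := by
    rw [inner_lp_bias hV₀ h.memLp, Complex.ofReal_re]
    exact integral_nonneg fun p => mul_nonneg (biasRZ_nonneg hV₀ θ p) (by positivity)
  have e : qm α V₀ θ m ω = ‖lp (volume.restrict halfPlane) (dr ω)‖ ^ 2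
      + ‖lp (volume.restrict halfPlane) (dz ω)‖ ^ 2
      + ((m : ℝ) ^ 2 - 1 / 4) * ‖lp (volume.restrict halfPlane) (fun p => ω p / (p.1 : ℂ))‖ ^ 2
      + (⟪lp (volume.restrict halfPlane) ω,
            lp (volume.restrict halfPlane) (fun p => (biasRZ V₀ θ p : ℂ) * ω p)⟫_ℂ).re
      - α * ‖lp (volume.restrict (Ioi 0)) (trace θ ω)‖ ^ 2 := by
    have := congrArg Complex.re ((qmSesq_self α V₀ θ m ω).symm.trans (qmSesq_eq hV₀ hθ m h h))
    rw [Complex.ofReal_re] at this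
    rw [this]
    simp only [inner_self_eq_norm_sq_to_K, Complex.coe_algebraMap]
    have em : ((m : ℂ) ^ 2 - 1 / 4) = (((m : ℝ) ^ 2 - 1 / 4 : ℝ) : ℂ) := by push_cast; ring
    rw [em]
    simp only [← Complex.ofReal_pow, ← Complex.ofReal_mul, Complex.add_re, Complex.sub_re,
      Complex.ofReal_re]
  have hm1 : (1 : ℝ) ≤ (m : ℝ) ^ 2 := by
    have : 0 < m ^ 2 := by positivity
    exact_mod_cast this
  have hc : 0 ≤ ((m : ℝ) ^ 2 - 1 / 4) *
      ‖lp (volume.restrict halfPlane) (fun p => ω p / (p.1 : ℂ))‖ ^ 2 :=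
    mul_nonneg (by linarith) (by positivity)
  constructor <;> linarith

/-! ### Change of variables to cylindrical coordinates -/

/-- Cylindrical coordinates as a map from the half-plane times the circle. -/
noncomputable def cylMap (q : (ℝ × ℝ) × ℝ) : Space := cyl q.1.1 q.2 q.1.2

theorem continuous_cylMap : Continuous cylMap :=
  continuous_cyl (continuous_fst.comp continuous_fst) continuous_snd
    (continuous_snd.comp continuous_fst)

/-- Lebesgue measure on the half-plane times the interval of the azimuths. -/
noncomputable def cylMeasure : Measure ((ℝ × ℝ) × ℝ) :=
  (volume.restrict halfPlane).prod (volume.restrict (Ioc 0 (2 * Real.pi)))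

theorem measurePreserving_toSpace :
    MeasurePreserving (fun q : ℝ × (ℝ × ℝ) => (!₂[q.2.1, q.2.2, q.1] : Space)) := by
  have h1 : MeasurePreserving (fun q : ℝ × (ℝ × ℝ) =>
      (q.1, (MeasurableEquiv.finTwoArrow (α := ℝ)).symm q.2)) :=
    (MeasurePreserving.id volume).prod (volume_preserving_finTwoArrow ℝ).symm
  have h2 := (volume_preserving_piFinSuccAbove (fun _ : Fin 3 => ℝ) 2).symm
  have h3 := (PiLp.volume_preserving_toLp (Fin 3)).comp (h2.comp h1)
  convert h3 using 1
  ext q i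
  fin_cases i <;> rfl

/-- `polarCoord` uses azimuths in (-π, π). Shifting by π moves them to (0, 2π) and amounts to the
reflection x ↦ -x, which preserves Lebesgue measure. -/
theorem lintegral_polar {f : ℝ × ℝ → ENNReal} :
    ∫⁻ x, f x = ∫⁻ q in Ioi (0 : ℝ) ×ˢ Ioo 0 (2 * Real.pi),
      ENNReal.ofReal q.1 * f (q.1 * Real.cos q.2, q.1 * Real.sin q.2) := by
  have h1 : ∫⁻ x, f x = ∫⁻ x, f (-x) := (lintegral_neg_eq_self f).symm
  have hp : MeasurePreserving (fun q : ℝ × ℝ => q + (0, Real.pi)) :=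
    measurePreserving_add_right volume _
  have h2 := hp.setLIntegral_comp_preimage_emb
    (MeasurableEquiv.addRight ((0, Real.pi) : ℝ × ℝ)).measurableEmbedding
    (fun q => ENNReal.ofReal q.1 * f (q.1 * Real.cos q.2, q.1 * Real.sin q.2))
    (Ioi (0 : ℝ) ×ˢ Ioo 0 (2 * Real.pi))
  rw [h1, ← lintegral_comp_polarCoord_symm, ← h2]
  have hs : (fun q : ℝ × ℝ => q + (0, Real.pi)) ⁻¹' (Ioi (0 : ℝ) ×ˢ Ioo 0 (2 * Real.pi))
      = polarCoord.target := by
    ext q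
    simp only [polarCoord_target, mem_preimage, mem_prod, mem_Ioi, mem_Ioo, Prod.fst_add,
      Prod.snd_add, add_zero]
    constructor <;> rintro ⟨h1, h2, h3⟩ <;> exact ⟨h1, by linarith, by linarith⟩
  rw [hs]
  refine lintegral_congr fun q => ?_
  simp [polarCoord_symm_apply, Real.cos_add_pi, Real.sin_add_pi]

/-- The change of variables to cylindrical coordinates. -/
theorem measurePreserving_cylMap :
    MeasurePreserving cylMap (cylMeasure.withDensity fun q => ENNReal.ofReal q.1.1) volume := by
  refine ⟨continuous_cylMap.measurable, ?_⟩
  have hw : Measurable fun q : (ℝ × ℝ) × ℝ => ENNReal.ofReal q.1.1 := by fun_prop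
  refine Measure.ext_of_lintegral _ fun f hf => ?_
  have hfc : Measurable fun q => f (cylMap q) := hf.comp continuous_cylMap.measurable
  rw [lintegral_map hf continuous_cylMap.measurable,
    lintegral_withDensity_eq_lintegral_mul _ hw hfc,
    ← measurePreserving_toSpace.lintegral_comp hf, Measure.volume_eq_prod,
    lintegral_prod (fun q : ℝ × (ℝ × ℝ) => f !₂[q.2.1, q.2.2, q.1])
      (hf.comp measurePreserving_toSpace.measurable).aemeasurable]
  simp only [lintegral_polar, Pi.mul_apply]
  have hG : Measurable fun q : (ℝ × ℝ) × ℝ => ENNReal.ofReal q.1.1 * f (cylMap q) := hw.mul hfc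
  have hprod : (volume.restrict (Ioi (0 : ℝ) ×ˢ Ioo 0 (2 * Real.pi)) : Measure (ℝ × ℝ))
      = (volume.restrict (Ioi (0 : ℝ))).prod (volume.restrict (Ioc 0 (2 * Real.pi))) := by
    rw [Measure.volume_eq_prod, ← Measure.prod_restrict]
    rw [Measure.restrict_congr_set (Ioo_ae_eq_Ioc (a := (0:ℝ)) (b := 2 * Real.pi))]
  rw [cylMeasure, lintegral_prod (fun q : (ℝ × ℝ) × ℝ => ENNReal.ofReal q.1.1 * f (cylMap q))
      hG.aemeasurable, restrict_halfPlane_eq_prod,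
    lintegral_prod_symm _ (hG.lintegral_prod_right').aemeasurable]
  refine lintegral_congr fun z => ?_
  rw [hprod, lintegral_prod]
  · rfl
  · have : Measurable fun q : ℝ × ℝ => (((q.1, z), q.2) : (ℝ × ℝ) × ℝ) := by fun_prop
    exact (hG.comp this).aemeasurable

theorem ae_cylMeasure_mem : ∀ᵐ q ∂cylMeasure, q.1 ∈ halfPlane := by
  have h : ∀ᵐ p ∂(volume.restrict halfPlane : Measure (ℝ × ℝ)), p ∈ halfPlane :=
    ae_restrict_mem measurableSet_halfPlane
  exact Measure.quasiMeasurePreserving_fst.ae h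

/-- The Jacobian r is positive on the half-plane, so the weighted and unweighted measures have the
same null sets. -/
theorem quasiMeasurePreserving_cylMap :
    Measure.QuasiMeasurePreserving cylMap cylMeasure volume := by
  refine measurePreserving_cylMap.quasiMeasurePreserving.mono_left ?_
  refine withDensity_absolutelyContinuous' (by fun_prop) ?_
  filter_upwards [ae_cylMeasure_mem] with q hq
  have hq' : 0 < q.1.1 := hq
  simpa using hq'

/-- The pull-back to cylindrical coordinates, normalized to preserve the `L²` norm. -/
noncomputable def pull (ψ : Space → ℂ) (q : (ℝ × ℝ) × ℝ) : ℂ := (√q.1.1 : ℝ) * ψ (cylMap q)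

theorem memLp_pull {ψ : Space → ℂ} (h : MemLp ψ 2 volume) : MemLp (pull ψ) 2 cylMeasure := by
  have hm : AEStronglyMeasurable (pull ψ) cylMeasure := by
    refine AEStronglyMeasurable.mul (Continuous.aestronglyMeasurable (by fun_prop)) ?_
    exact h.1.comp_quasiMeasurePreserving quasiMeasurePreserving_cylMap
  have h2 : MemLp (ψ ∘ cylMap) 2 (cylMeasure.withDensity fun q => ENNReal.ofReal q.1.1) :=
    h.comp_measurePreserving measurePreserving_cylMap
  rw [memLp_two_iff_integrable_sq_norm h2.1, integrable_withDensity_iff_integrable_smul'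
    (by fun_prop) (ae_of_all _ fun _ => ENNReal.ofReal_lt_top)] at h2
  rw [memLp_two_iff_integrable_sq_norm hm]
  refine h2.congr ?_
  filter_upwards [ae_cylMeasure_mem] with q hq
  have hq' : 0 ≤ q.1.1 := le_of_lt hq
  rw [ENNReal.toReal_ofReal hq', pull, norm_mul, mul_pow, Complex.norm_real, Real.norm_eq_abs,
    sq_abs, Real.sq_sqrt hq', smul_eq_mul, Function.comp]

theorem integral_cylMap {F : Space → ℂ} (hF : AEStronglyMeasurable F volume) :
    ∫ x, F x = ∫ q, (q.1.1 : ℂ) * F (cylMap q) ∂cylMeasure := by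
  rw [← measurePreserving_cylMap.map_eq, integral_map measurePreserving_cylMap.aemeasurable
    (by rwa [measurePreserving_cylMap.map_eq]),
    integral_withDensity_eq_integral_toReal_smul (by fun_prop)
      (ae_of_all _ fun _ => ENNReal.ofReal_lt_top)]
  refine integral_congr_ae ?_
  filter_upwards [ae_cylMeasure_mem] with q hq
  have hq' : 0 ≤ q.1.1 := le_of_lt hq
  rw [ENNReal.toReal_ofReal hq', Complex.real_smul]

/-! ### Reduced components and lifts -/

/-- Cauchy–Schwarz against the constant 1 on the finite factor. -/
theorem memLp_integral_right {X Y : Type*} [MeasurableSpace X] [MeasurableSpace Y] {ν : Measure X}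
    {τ : Measure Y} [SFinite ν] [IsFiniteMeasure τ] {F : X × Y → ℂ} (hF : MemLp F 2 (ν.prod τ)) :
    MemLp (fun p => ∫ y, F (p, y) ∂τ) 2 ν := by
  have hm : AEStronglyMeasurable (fun p => ∫ y, F (p, y) ∂τ) ν := hF.1.integral_prod_right'
  have hi := (memLp_two_iff_integrable_sq_norm hF.1).1 hF
  rw [memLp_two_iff_integrable_sq_norm hm]
  refine Integrable.mono' (hi.integral_prod_left.const_mul (τ.real univ)) (hm.norm.pow 2) ?_
  filter_upwards [hF.1.prodMk_left, hi.prod_right_ae] with p h1 h2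
  have h3 : MemLp (fun y => F (p, y)) 2 τ := (memLp_two_iff_integrable_sq_norm h1).2 h2
  have h4 : MemLp (fun _ : Y => (1 : ℂ)) 2 τ := memLp_const 1
  have h5 := norm_integral_conj_mul_le h4 h3
  simp only [map_one, one_mul] at h5
  rw [Real.norm_eq_abs, abs_of_nonneg (by positivity)]
  refine (pow_le_pow_left₀ (norm_nonneg _) h5 2).trans ?_
  rw [mul_pow, norm_lp_sq h3, norm_lp_sq h4]
  simp

/-- The normalization constant of the Fourier coefficients. -/
noncomputable def fourierConst : ℂ := ((√(2 * Real.pi) / (2 * Real.pi) : ℝ) : ℂ)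

theorem reduced_eq (m : ℤ) (ψ : Space → ℂ) (p : ℝ × ℝ) :
    reduced m ψ p = fourierConst * ∫ φ in Ioc (0 : ℝ) (2 * Real.pi),
      pull ψ (p, φ) * Complex.exp (-(Complex.I * m * φ)) := by
  rw [reduced, intervalIntegral.integral_of_le (by positivity), fourierConst,
    Real.sqrt_mul (by positivity)]
  simp only [pull, cylMap, mul_assoc]
  rw [integral_const_mul, ← mul_assoc, ← Complex.ofReal_mul]
  congr 2
  ring

theorem norm_exp_azimuth (m : ℤ) (φ : ℝ) : ‖Complex.exp (-(Complex.I * m * φ))‖ = 1 := by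
  rw [Complex.norm_exp]
  simp

theorem memLp_pull_exp (m : ℤ) {ψ : Space → ℂ} (h : MemLp ψ 2 volume) :
    MemLp (fun q => pull ψ q * Complex.exp (-(Complex.I * m * q.2))) 2 cylMeasure := by
  refine (memLp_pull h).of_le ((memLp_pull h).1.mul
    (Continuous.aestronglyMeasurable (by fun_prop))) (ae_of_all _ fun q => ?_)
  rw [norm_mul, norm_exp_azimuth, mul_one]

theorem memLp_reduced (m : ℤ) {ψ : Space → ℂ} (h : MemLp ψ 2 volume) :
    MemLp (reduced m ψ) 2 (volume.restrict halfPlane) := by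
  have := (memLp_integral_right (memLp_pull_exp m h)).const_mul fourierConst
  simpa only [← reduced_eq] using this

/-- `Θ` is the partial wave of angular momentum `-m` with the reduced component `η` (up to a
constant). -/
def IsLift (m : ℤ) (η : ℝ × ℝ → ℂ) (Θ : Space → ℂ) : Prop :=
  ∀ r φ z : ℝ, 0 < r → Θ (cyl r φ z) = η (r, z) * Complex.exp (-(Complex.I * m * φ)) / (√r : ℝ)

/-- Lifting is, up to a constant, the transpose of taking reduced components: the Jacobian r cancels
the two factors √r. Identities for functions on ℝ³ thereby become identities on the half-plane. -/
theorem IsLift.integral_mul {m : ℤ} {η : ℝ × ℝ → ℂ} {Θ k : Space → ℂ} (h : IsLift m η Θ)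
    (hη : MemLp η 2 (volume.restrict halfPlane)) (hΘ : AEStronglyMeasurable Θ volume)
    (hk : MemLp k 2 volume) :
    ∫ p in halfPlane, η p * reduced m k p = fourierConst * ∫ x, Θ x * k x := by
  have hi : Integrable (fun q : (ℝ × ℝ) × ℝ =>
      η q.1 * (pull k q * Complex.exp (-(Complex.I * m * q.2)))) cylMeasure :=
    MemLp.integrable_mul (p := 2) (q := 2) (hη.comp_fst _) (memLp_pull_exp m hk)
  have e : ∫ q, (q.1.1 : ℂ) * (Θ (cylMap q) * k (cylMap q)) ∂cylMeasure =
      ∫ q, η q.1 * (pull k q * Complex.exp (-(Complex.I * m * q.2))) ∂cylMeasure := by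
    refine integral_congr_ae ?_
    filter_upwards [ae_cylMeasure_mem] with q hq
    have hq' : 0 < q.1.1 := hq
    have hs : ((√q.1.1 : ℝ) : ℂ) ≠ 0 := by exact_mod_cast (Real.sqrt_pos.2 hq').ne'
    have e1 : (q.1.1 : ℂ) = ((√q.1.1 : ℝ) : ℂ) * ((√q.1.1 : ℝ) : ℂ) := by
      rw [← Complex.ofReal_mul, Real.mul_self_sqrt hq'.le]
    have e2 : Θ (cylMap q) = _ := h q.1.1 q.2 q.1.2 hq'
    rw [e2, pull]
    nth_rewrite 1 [e1]
    field_simp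
  rw [integral_cylMap (F := fun x => Θ x * k x) (hΘ.mul hk.1), e, cylMeasure,
    integral_prod _ hi, ← integral_const_mul]
  refine integral_congr_ae (ae_of_all _ fun p => ?_)
  simp only [reduced_eq]
  rw [integral_const_mul]
  ring

/-- Distance from the axis. -/
noncomputable def axisDist (x : Space) : ℝ := √(x 0 ^ 2 + x 1 ^ 2)

theorem continuous_axisDist : Continuous axisDist := by unfold axisDist; fun_prop

theorem axisDist_cyl {r : ℝ} (hr : 0 < r) (φ z : ℝ) : axisDist (cyl r φ z) = r := by
  have : (cyl r φ z) 0 ^ 2 + (cyl r φ z) 1 ^ 2 = r ^ 2 := by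
    simp only [cyl, PiLp.toLp_apply, Matrix.cons_val_zero, Matrix.cons_val_one]
    linear_combination r ^ 2 * Real.sin_sq_add_cos_sq φ
  rw [axisDist, this, Real.sqrt_sq hr.le]

theorem contDiffAt_axisDist {x : Space} (hx : 0 < axisDist x) :
    ContDiffAt ℝ (⊤ : ℕ∞) axisDist x := by
  have h : x 0 ^ 2 + x 1 ^ 2 ≠ 0 := fun h => by simp [axisDist, h] at hx
  unfold axisDist
  exact ContDiffAt.sqrt (by fun_prop) h

/-- The phase exp(-imφ) is the |m|-th power of (x - i sgn(m) y)/r, smooth off the axis. Since η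
vanishes near the axis, the lift is smooth on all of ℝ³ and is a legitimate test function there. -/
theorem exists_isLift (m : ℤ) {η : ℝ × ℝ → ℂ} (hη : IsTest halfPlane η) :
    ∃ Θ, IsTest univ Θ ∧ IsLift m η Θ := by
  set s : ℝ := (m.sign : ℝ) with hs
  set g : Space → ℝ × ℝ := fun x => (axisDist x, x 2) with hg
  have hgc : Continuous g := continuous_axisDist.prodMk (by fun_prop)
  set Θ : Space → ℂ := fun x => η (g x) *
    (((x 0 : ℂ) - Complex.I * s * x 1) / axisDist x) ^ m.natAbs / (√(axisDist x) : ℝ) with hΘ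
  have hz : ∀ x, x ∉ g ⁻¹' tsupport η → Θ x = 0 := fun x hx => by
    simp only [hΘ]
    rw [image_eq_zero_of_notMem_tsupport (fun h => hx h)]
    simp
  have hcl : IsClosed (g ⁻¹' tsupport η) := (isClosed_tsupport η).preimage hgc
  have hcpt : IsCompact (g ⁻¹' tsupport η) := by
    refine Metric.isCompact_of_isClosed_isBounded hcl ?_
    obtain ⟨C, hC⟩ := hη.compact.isCompact.isBounded.exists_norm_le
    refine (Metric.isBounded_closedBall (x := (0 : Space)) (r := √(C ^ 2 + C ^ 2))).subset
      fun x hx => ?_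
    have h1 := hC _ hx
    have h2 : |axisDist x| ≤ C := (norm_fst_le (g x)).trans h1
    have h3 : |x 2| ≤ C := (norm_snd_le (g x)).trans h1
    rw [mem_closedBall_zero_iff, EuclideanSpace.norm_eq]
    refine Real.sqrt_le_sqrt ?_
    have h4 : axisDist x ^ 2 = x 0 ^ 2 + x 1 ^ 2 := Real.sq_sqrt (by positivity)
    simp only [Fin.sum_univ_three, Real.norm_eq_abs, sq_abs]
    nlinarith [sq_le_sq' (abs_le.1 h2).1 (abs_le.1 h2).2, sq_le_sq' (abs_le.1 h3).1 (abs_le.1 h3).2]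
  refine ⟨Θ, ⟨contDiff_iff_contDiffAt.2 fun x => ?_, HasCompactSupport.intro hcpt hz,
    subset_univ _⟩, fun r φ z hr => ?_⟩
  · by_cases hx : x ∈ g ⁻¹' tsupport η
    · have hpos : 0 < axisDist x := hη.support hx
      have hd := contDiffAt_axisDist hpos
      have hC : ∀ {f : Space → ℝ}, ContDiffAt ℝ (⊤ : ℕ∞) f x →
          ContDiffAt ℝ (⊤ : ℕ∞) (fun x => (f x : ℂ)) x := fun hf =>
        Complex.ofRealCLM.contDiff.contDiffAt.comp x hf
      have hne : (axisDist x : ℂ) ≠ 0 := by exact_mod_cast hpos.ne'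
      have hse : ((√(axisDist x) : ℝ) : ℂ) ≠ 0 := by
        exact_mod_cast (Real.sqrt_pos.2 hpos).ne'
      have c0 : ContDiffAt ℝ (⊤ : ℕ∞) (fun x : Space => (x 0 : ℂ)) x := hC (by fun_prop)
      have c1 : ContDiffAt ℝ (⊤ : ℕ∞) (fun x : Space => (x 1 : ℂ)) x := hC (by fun_prop)
      have hgx : ContDiffAt ℝ (⊤ : ℕ∞) g x := hd.prodMk (by fun_prop)
      simp only [hΘ, div_eq_mul_inv]
      exact ((hη.smooth.contDiffAt.comp x hgx).mul
        (((c0.sub (contDiffAt_const.mul c1)).mul ((hC hd).inv hne)).pow _)).mul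
        ((hC (hd.sqrt hpos.ne')).inv hse)
    · refine contDiffAt_const (c := (0 : ℂ)) |>.congr_of_eventuallyEq ?_
      filter_upwards [hcl.isOpen_compl.mem_nhds hx] with y hy using hz y hy
  · simp only [hΘ, hg, axisDist_cyl hr]
    have hr' : (r : ℂ) ≠ 0 := by exact_mod_cast hr.ne'
    -- For m = 0 the sign is 0 and the base is not a phase, but then it is raised to the power 0.
    have e1 : (((cyl r φ z) 0 : ℂ) - Complex.I * s * (cyl r φ z) 1) / r
        = Complex.exp (-(Complex.I * s * φ)) ∨ m = 0 := by
      rcases lt_trichotomy m 0 with hm | hm | hm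
      · left
        have : s = -1 := by simp [hs, Int.sign_eq_neg_one_of_neg hm]
        simp only [cyl, PiLp.toLp_apply, Matrix.cons_val_zero, Matrix.cons_val_one, this]
        rw [show -(Complex.I * ((-1 : ℝ) : ℂ) * φ) = (φ : ℂ) * Complex.I by push_cast; ring,
          Complex.exp_mul_I]
        push_cast
        field_simp
        ring
      · exact Or.inr hm
      · left
        have : s = 1 := by simp [hs, Int.sign_eq_one_of_pos hm]
        simp only [cyl, PiLp.toLp_apply, Matrix.cons_val_zero, Matrix.cons_val_one, this]
        rw [show -(Complex.I * ((1 : ℝ) : ℂ) * φ) = ((-φ : ℝ) : ℂ) * Complex.I by push_cast; ring,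
          Complex.exp_mul_I]
        push_cast
        rw [Complex.cos_neg, Complex.sin_neg]
        field_simp
        ring
    have e2 : ((((cyl r φ z) 0 : ℂ) - Complex.I * s * (cyl r φ z) 1) / r) ^ m.natAbs
        = Complex.exp (-(Complex.I * m * φ)) := by
      rcases e1 with e1 | e1
      · rw [e1, ← Complex.exp_nat_mul]
        congr 1
        have : (m : ℂ) = s * (m.natAbs : ℂ) := by
          have h := congrArg (Int.cast : ℤ → ℂ) (Int.sign_mul_natAbs m)
          rw [Int.cast_mul, Int.cast_natCast] at h
          rw [← h, hs, Complex.ofReal_intCast]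
        rw [this]
        ring
      · simp [e1]
    rw [e2]
    rfl

/-! ### Derivatives of lifts -/

/-- Weak derivatives are defined with real test functions, whereas partial waves are complex; real
and imaginary parts are tested separately. -/
theorem HasWeakPartial.integral_test {E : Type*} [NormedAddCommGroup E] [NormedSpace ℝ E]
    [MeasureSpace E] [BorelSpace E] [FiniteDimensional ℝ E]
    [(volume : Measure E).IsAddHaarMeasure] {Ω : Set E} {v : E}
    {f g : E → ℂ} (h : HasWeakPartial Ω v f g) (hf : MemLp f 2 (volume.restrict Ω))
    (hg : MemLp g 2 (volume.restrict Ω)) {φ : E → ℂ} (hφ : IsTest Ω φ) :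
    ∫ x in Ω, fderiv ℝ φ x v * f x = -∫ x in Ω, φ x * g x := by
  have key : ∀ L : ℂ →L[ℝ] ℝ, ContDiff ℝ (⊤ : ℕ∞) (fun x => L (φ x)) ∧
      HasCompactSupport (fun x => L (φ x)) ∧
      (∀ x, fderiv ℝ (fun x => L (φ x)) x v = L (fderiv ℝ φ x v)) ∧
      ∫ x in Ω, L (fderiv ℝ φ x v) • f x = -∫ x in Ω, L (φ x) • g x := fun L => by
    have hs : ContDiff ℝ (⊤ : ℕ∞) (fun x => L (φ x)) := L.contDiff.comp hφ.smooth
    have hc : HasCompactSupport (fun x => L (φ x)) := hφ.compact.comp_left L.map_zero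
    have hd : ∀ x, fderiv ℝ (fun x => L (φ x)) x v = L (fderiv ℝ φ x v) := fun x => by
      have := (L.hasFDerivAt.comp x (hφ.smooth.differentiable (by simp) x).hasFDerivAt).fderiv
      rw [show (fun x => L (φ x)) = L ∘ φ from rfl, this]
      rfl
    refine ⟨hs, hc, hd, ?_⟩
    have := h _ hs hc ((tsupport_comp_subset L.map_zero φ).trans hφ.support)
    simpa only [hd] using this
  obtain ⟨s1, c1, d1, k1⟩ := key Complex.reCLM
  obtain ⟨s2, c2, d2, k2⟩ := key Complex.imCLM
  have split : ∀ (c z : ℂ), c * z = Complex.reCLM c • z + Complex.I * (Complex.imCLM c • z) :=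
    fun c z => by
      simp only [Complex.reCLM_apply, Complex.imCLM_apply, Complex.real_smul]
      conv_lhs => rw [← Complex.re_add_im c]
      ring
  have i1 : Integrable (fun x => Complex.reCLM (fderiv ℝ φ x v) • f x) (volume.restrict Ω) := by
    simp only [← d1]
    exact integrable_smul_of_memLp (continuous_fderiv_apply s1 v) (c1.fderiv_apply ℝ v) hf
  have i2 : Integrable (fun x => Complex.imCLM (fderiv ℝ φ x v) • f x) (volume.restrict Ω) := by
    simp only [← d2]
    exact integrable_smul_of_memLp (continuous_fderiv_apply s2 v) (c2.fderiv_apply ℝ v) hf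
  have i3 := integrable_smul_of_memLp s1.continuous c1 hg
  have i4 := integrable_smul_of_memLp s2.continuous c2 hg
  simp only [split (fderiv ℝ φ _ v), split (φ _)]
  rw [integral_add i1 (i2.const_mul _), integral_add i3 (i4.const_mul _), integral_const_mul,
    integral_const_mul, k1, k2]
  ring

theorem isTest_ofReal {E : Type*} [NormedAddCommGroup E] [NormedSpace ℝ E] {Ω : Set E}
    {φ : E → ℝ} (h1 : ContDiff ℝ (⊤ : ℕ∞) φ) (h2 : HasCompactSupport φ) (h3 : tsupport φ ⊆ Ω) :
    IsTest Ω (fun x => (φ x : ℂ)) ∧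
      ∀ x v, fderiv ℝ (fun x => (φ x : ℂ)) x v = (fderiv ℝ φ x v : ℂ) := by
  refine ⟨⟨Complex.ofRealCLM.contDiff.comp h1, h2.comp_left Complex.ofReal_zero,
    (tsupport_comp_subset Complex.ofReal_zero φ).trans h3⟩, fun x v => ?_⟩
  have := (Complex.ofRealCLM.hasFDerivAt.comp x (h1.differentiable (by simp) x).hasFDerivAt).fderiv
  rw [show (fun x => (φ x : ℂ)) = Complex.ofRealCLM ∘ φ from rfl, this]
  rfl

/-- The coordinate directions. -/
noncomputable abbrev axis (i : Fin 3) : Space := EuclideanSpace.single i 1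

theorem cyl_eq (r φ z : ℝ) : cyl r φ z =
    (r * Real.cos φ) • axis 0 + (r * Real.sin φ) • axis 1 + z • axis 2 := by
  ext i
  fin_cases i <;> simp [cyl]

theorem IsTest.hasDerivAt_comp {Θ : Space → ℂ} (hΘ : IsTest univ Θ) {c : ℝ → Space} {c' : Space}
    {t : ℝ} (h : HasDerivAt c c' t) :
    HasDerivAt (fun t => Θ (c t)) (fderiv ℝ Θ (c t) c') t :=
  (hΘ.smooth.differentiable (by simp) (c t)).hasFDerivAt.comp_hasDerivAt t h

theorem hasDerivAt_comp_prodMk_left {η : ℝ × ℝ → ℂ} (h : ContDiff ℝ (⊤ : ℕ∞) η) (r z : ℝ) :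
    HasDerivAt (fun r => η (r, z)) (fderiv ℝ η (r, z) (1, 0)) r :=
  (h.differentiable (by simp) (r, z)).hasFDerivAt.comp_hasDerivAt r
    ((hasDerivAt_id r).prodMk (hasDerivAt_const r z))

theorem hasDerivAt_comp_prodMk_right {η : ℝ × ℝ → ℂ} (h : ContDiff ℝ (⊤ : ℕ∞) η) (r z : ℝ) :
    HasDerivAt (fun z => η (r, z)) (fderiv ℝ η (r, z) (0, 1)) z :=
  (h.differentiable (by simp) (r, z)).hasFDerivAt.comp_hasDerivAt z
    ((hasDerivAt_const z r).prodMk (hasDerivAt_id z))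

namespace IsLift

variable {m : ℤ} {η : ℝ × ℝ → ℂ} {Θ : Space → ℂ}

theorem fderiv_axial (h : IsLift m η Θ) (hη : ContDiff ℝ (⊤ : ℕ∞) η) (hΘ : IsTest univ Θ) :
    IsLift m (fun p => fderiv ℝ η p (0, 1)) fun x => fderiv ℝ Θ x (axis 2) := by
  intro r φ z hr
  have hc : HasDerivAt (fun z => cyl r φ z) (axis 2) z := by
    simp only [cyl_eq]
    simpa using ((hasDerivAt_id z).smul_const (axis 2)).const_add
      ((r * Real.cos φ) • axis 0 + (r * Real.sin φ) • axis 1)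
  have h1 := hΘ.hasDerivAt_comp hc
  have h2 := ((hasDerivAt_comp_prodMk_right hη r z).mul_const
    (Complex.exp (-(Complex.I * m * φ)))).div_const ((√r : ℝ) : ℂ)
  simp only [h r φ _ hr] at h1
  exact h1.unique h2

/-- The azimuthal derivative of a lift. -/
theorem fderiv_azimuth (h : IsLift m (fun p => η p / (p.1 : ℂ)) Θ) (hΘ : IsTest univ Θ) :
    IsLift m (fun p => -(Complex.I * m) * (η p / (p.1 : ℂ)))
      fun x => -(x 1 : ℂ) * fderiv ℝ Θ x (axis 0) + x 0 * fderiv ℝ Θ x (axis 1) := by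
  intro r φ z hr
  have hc : HasDerivAt (fun φ => cyl r φ z)
      ((-(r * Real.sin φ)) • axis 0 + (r * Real.cos φ) • axis 1) φ := by
    simp only [cyl_eq]
    have := ((((Real.hasDerivAt_cos φ).const_mul r).smul_const (axis 0)).add
      (((Real.hasDerivAt_sin φ).const_mul r).smul_const (axis 1))).add_const (z • axis 2)
    exact this.congr_deriv (by simp)
  have h1 := hΘ.hasDerivAt_comp hc
  have he : HasDerivAt (fun φ : ℝ => Complex.exp (-(Complex.I * m * φ)))
      (Complex.exp (-(Complex.I * m * φ)) * (-(Complex.I * m))) φ := by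
    have h3 : HasDerivAt (fun φ : ℝ => -(Complex.I * m * φ)) (-(Complex.I * m)) φ := by
      exact ((Complex.ofRealCLM.hasDerivAt (x := φ)).const_mul (Complex.I * m)).neg.congr_deriv
        (by simp)
    exact h3.cexp
  have h2 := (he.const_mul (η (r, z) / (r : ℂ))).div_const ((√r : ℝ) : ℂ)
  simp only [h _ _ _ hr] at h1
  have h3 := h1.unique h2
  rw [map_add, map_smul, map_smul] at h3
  have e0 : (cyl r φ z) 0 = r * Real.cos φ := rfl
  have e1 : (cyl r φ z) 1 = r * Real.sin φ := rfl
  simp only [e0, e1]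
  simp only [Complex.real_smul] at h3
  push_cast at h3 ⊢
  rw [h3]
  ring

/-- The divergence of the radial field of a lift. -/
theorem fderiv_radial (h : IsLift m (fun p => η p / (p.1 : ℂ)) Θ)
    (hη : ContDiff ℝ (⊤ : ℕ∞) η) (hΘ : IsTest univ Θ) :
    IsLift m (fun p => fderiv ℝ η p (1, 0) + 1 / 2 * (η p / (p.1 : ℂ)))
      fun x => 2 * Θ x + (x 0 * fderiv ℝ Θ x (axis 0) + x 1 * fderiv ℝ Θ x (axis 1)) := by
  intro r φ z hr
  have hc : HasDerivAt (fun r => cyl r φ z) (Real.cos φ • axis 0 + Real.sin φ • axis 1) r := by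
    simp only [cyl_eq]
    have := ((((hasDerivAt_id r).mul_const (Real.cos φ)).smul_const (axis 0)).add
      (((hasDerivAt_id r).mul_const (Real.sin φ)).smul_const (axis 1))).add_const (z • axis 2)
    simpa using this
  have h1 := hΘ.hasDerivAt_comp hc
  have hs : 0 < √r := Real.sqrt_pos.2 hr
  have hsC : ((√r : ℝ) : ℂ) ≠ 0 := by exact_mod_cast hs.ne'
  have hrC : (r : ℂ) ≠ 0 := by exact_mod_cast hr.ne'
  have hsq : (r : ℂ) = ((√r : ℝ) : ℂ) ^ 2 := by exact_mod_cast (Real.sq_sqrt hr.le).symm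
  have hw : HasDerivAt (fun r : ℝ => ((√r : ℝ) : ℂ)) ((1 / (2 * √r) : ℝ) : ℂ) r :=
    (Real.hasDerivAt_sqrt hr.ne').ofReal_comp
  have hr1 : HasDerivAt (fun r : ℝ => (r : ℂ)) 1 r := Complex.ofRealCLM.hasDerivAt
  have h2 := ((((hasDerivAt_comp_prodMk_left hη r z).div hr1 hrC).mul_const
    (Complex.exp (-(Complex.I * m * φ)))).div hw hsC)
  -- The lift formula holds only for r > 0, so the two functions of r agree merely near the given
  -- point.
  have h3 := (h1.congr_of_eventuallyEq (f₁ := fun r => η (r, z) / (r : ℂ) *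
    Complex.exp (-(Complex.I * m * φ)) / (√r : ℝ)) ?_).unique h2
  · rw [map_add, map_smul, map_smul] at h3
    have e0 : (cyl r φ z) 0 = r * Real.cos φ := rfl
    have e1 : (cyl r φ z) 1 = r * Real.sin φ := rfl
    simp only [Complex.real_smul] at h3
    have h4 : ((cyl r φ z) 0 : ℂ) * fderiv ℝ Θ (cyl r φ z) (axis 0)
        + (cyl r φ z) 1 * fderiv ℝ Θ (cyl r φ z) (axis 1) = r *
        (Real.cos φ * fderiv ℝ Θ (cyl r φ z) (axis 0)
          + Real.sin φ * fderiv ℝ Θ (cyl r φ z) (axis 1)) := by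
      rw [e0, e1]; push_cast; ring
    beta_reduce
    rw [h4, h3, h _ _ _ hr]
    simp only [Pi.div_apply]
    push_cast
    simp only [hsq]
    field_simp
    ring
  · filter_upwards [lt_mem_nhds hr] with t ht using (h t φ z ht).symm

end IsLift

/-! ### Reduced components are admissible -/

theorem integrable_mul_of_memLp {X : Type*} [MeasurableSpace X] {ν : Measure X} {f g : X → ℂ}
    (hf : MemLp f 2 ν) (hg : MemLp g 2 ν) : Integrable (fun x => f x * g x) ν :=
  MemLp.integrable_mul hf hg

theorem isTest_coord_mul {Θ : Space → ℂ} (h : IsTest univ Θ) (i : Fin 3) :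
    IsTest univ (fun x => (x i : ℂ) * Θ x) ∧ ∀ x j, fderiv ℝ (fun x => (x i : ℂ) * Θ x) x (axis j)
      = (if i = j then Θ x else 0) + x i * fderiv ℝ Θ x (axis j) := by
  have hC : ∀ x, HasFDerivAt (fun x : Space => (x i : ℂ))
      (Complex.ofRealCLM.comp (EuclideanSpace.proj i : Space →L[ℝ] ℝ)) x := fun x =>
    (Complex.ofRealCLM.comp (EuclideanSpace.proj i : Space →L[ℝ] ℝ)).hasFDerivAt
  have hs : ContDiff ℝ (⊤ : ℕ∞) (fun x : Space => (x i : ℂ)) :=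
    (Complex.ofRealCLM.comp (EuclideanSpace.proj i : Space →L[ℝ] ℝ)).contDiff
  refine ⟨⟨hs.mul h.smooth, h.compact.mul_left, subset_univ _⟩, fun x j => ?_⟩
  have := ((hC x).mul (h.smooth.differentiable (by simp) x).hasFDerivAt).fderiv
  rw [show (fun x : Space => (x i : ℂ) * Θ x) = (fun x : Space => (x i : ℂ)) * Θ from rfl, this]
  simp only [add_apply, smul_apply, smul_eq_mul, ContinuousLinearMap.comp_apply,
    Complex.ofRealCLM_apply, PiLp.proj_apply]
  by_cases hij : i = j
  · subst hij; simp; ring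
  · simp [hij]

theorem IsLift.axisDist_mul {m : ℤ} {η : ℝ × ℝ → ℂ} {Θ : Space → ℂ}
    (h : IsLift m (fun p => η p / (p.1 : ℂ)) Θ) : IsLift m η fun x => (axisDist x : ℂ) * Θ x := by
  intro r φ z hr
  have hr' : (r : ℂ) ≠ 0 := by exact_mod_cast hr.ne'
  simp only [axisDist_cyl hr, h _ _ _ hr]
  field_simp

theorem abs_coord_div_axisDist_le {x : Space} {i : Fin 3} (hi : i = 0 ∨ i = 1) :
    |x i / axisDist x| ≤ 1 := by
  have h0 : 0 ≤ axisDist x := Real.sqrt_nonneg _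
  rw [abs_div, abs_of_nonneg h0]
  refine div_le_one_of_le₀ (Real.abs_le_sqrt ?_) (Real.sqrt_nonneg _)
  rcases hi with rfl | rfl
  · linarith [sq_nonneg (x 1)]
  · linarith [sq_nonneg (x 0)]

theorem memLp_coord_div {g : Space → ℂ} (hg : MemLp g 2 volume) {i : Fin 3} (hi : i = 0 ∨ i = 1) :
    MemLp (fun x => ((x i / axisDist x : ℝ) : ℂ) * g x) 2 volume := by
  refine hg.of_le ?_ (ae_of_all _ fun x => ?_)
  · have : Measurable fun x : Space => x i / axisDist x :=
      (by fun_prop : Continuous fun x : Space => x i).measurable.div continuous_axisDist.measurable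
    exact (Complex.measurable_ofReal.comp this).aestronglyMeasurable.mul hg.1
  · rw [norm_mul, Complex.norm_real]
    exact mul_le_of_le_one_left (norm_nonneg _) (abs_coord_div_axisDist_le hi)

theorem memLp_radial {g : Fin 3 → Space → ℂ} (hg : ∀ i, MemLp (g i) 2 volume) :
    MemLp (fun x => ((x 0 / axisDist x : ℝ) : ℂ) * g 0 x
      + ((x 1 / axisDist x : ℝ) : ℂ) * g 1 x) 2 volume :=
  (memLp_coord_div (hg 0) (Or.inl rfl)).add (memLp_coord_div (hg 1) (Or.inr rfl))

theorem memLp_azimuth {g : Fin 3 → Space → ℂ} (hg : ∀ i, MemLp (g i) 2 volume) :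
    MemLp (fun x => ((x 0 / axisDist x : ℝ) : ℂ) * g 1 x
      - ((x 1 / axisDist x : ℝ) : ℂ) * g 0 x) 2 volume :=
  (memLp_coord_div (hg 1) (Or.inl rfl)).sub (memLp_coord_div (hg 0) (Or.inr rfl))

theorem axisDist_mul_div (x : Space) {i : Fin 3} (hi : i = 0 ∨ i = 1) :
    (axisDist x : ℂ) * ((x i / axisDist x : ℝ) : ℂ) = x i := by
  rw [← Complex.ofReal_mul]
  congr 1
  by_cases h : axisDist x = 0
  · have h0 := (Real.sqrt_eq_zero (by positivity)).1 h
    have : x i = 0 := by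
      rcases hi with rfl | rfl
      · nlinarith [sq_nonneg (x 0), sq_nonneg (x 1)]
      · nlinarith [sq_nonneg (x 0), sq_nonneg (x 1)]
    simp [this]
  · field_simp

section

variable {ψ : Space → ℂ} {g : Fin 3 → Space → ℂ} {m : ℤ} {η : ℝ × ℝ → ℂ}

theorem integral_axial (hψ : MemLp ψ 2 volume) (hg : ∀ i, MemLp (g i) 2 volume)
    (hw : ∀ i, HasWeakPartial univ (axis i) ψ (g i)) (hη : IsTest halfPlane η) :
    ∫ p in halfPlane, fderiv ℝ η p (0, 1) * reduced m ψ p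
      = -∫ p in halfPlane, η p * reduced m (g 2) p := by
  obtain ⟨Θ, hΘ, hL⟩ := exists_isLift m hη
  have h1 := (hw 2).integral_test (hψ.restrict _) ((hg 2).restrict _) hΘ
  simp only [Measure.restrict_univ] at h1
  rw [hL.integral_mul (hη.memLp.restrict _) hΘ.smooth.continuous.aestronglyMeasurable (hg 2),
    (hL.fderiv_axial hη.smooth hΘ).integral_mul ((hη.memLp_fderiv _).restrict _)
      (hΘ.memLp_fderiv _).1 hψ, h1]
  ring

/-- The weak derivatives in x and y are tested with the components of the field (x, y)Θ, where Θ
lifts η/r. The divergence of this field lifts η_r + η/(2r), and x g₀ + y g₁ is r times the radial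
derivative of ψ. -/
theorem integral_radial (hψ : MemLp ψ 2 volume) (hg : ∀ i, MemLp (g i) 2 volume)
    (hw : ∀ i, HasWeakPartial univ (axis i) ψ (g i)) (hη : IsTest halfPlane η) :
    ∫ p in halfPlane, (fderiv ℝ η p (1, 0) + 1 / 2 * (η p / (p.1 : ℂ))) * reduced m ψ p
      = -∫ p in halfPlane, η p * reduced m (fun x => ((x 0 / axisDist x : ℝ) : ℂ) * g 0 x
          + ((x 1 / axisDist x : ℝ) : ℂ) * g 1 x) p := by
  have hη' := isTest_div hη
  obtain ⟨Θ, hΘ, hL⟩ := exists_isLift m hη'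
  obtain ⟨hX, dX⟩ := isTest_coord_mul hΘ 0
  obtain ⟨hY, dY⟩ := isTest_coord_mul hΘ 1
  have h0 := (hw 0).integral_test (hψ.restrict _) ((hg 0).restrict _) hX
  have h1 := (hw 1).integral_test (hψ.restrict _) ((hg 1).restrict _) hY
  simp only [Measure.restrict_univ] at h0 h1
  have hD : (fun x : Space => 2 * Θ x + (x 0 * fderiv ℝ Θ x (axis 0) + x 1 * fderiv ℝ Θ x (axis 1)))
      = fun x => fderiv ℝ (fun x : Space => (x 0 : ℂ) * Θ x) x (axis 0)
        + fderiv ℝ (fun x : Space => (x 1 : ℂ) * Θ x) x (axis 1) := by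
    ext x
    rw [dX, dY]
    simp only [if_true]
    ring
  have hL1 := hL.fderiv_radial hη.smooth hΘ
  rw [hD] at hL1
  rw [hL1.integral_mul (((hη.memLp_fderiv _).add (hη'.memLp.const_mul _)).restrict _)
      ((hX.memLp_fderiv _).1.add (hY.memLp_fderiv _).1) hψ,
    hL.axisDist_mul.integral_mul (hη.memLp.restrict _)
      ((Complex.continuous_ofReal.comp continuous_axisDist).mul
        hΘ.smooth.continuous).aestronglyMeasurable
      (memLp_radial hg)]
  simp only [add_mul]
  rw [integral_add (integrable_mul_of_memLp (hX.memLp_fderiv (axis 0)) hψ)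
    (integrable_mul_of_memLp (hY.memLp_fderiv (axis 1)) hψ), h0, h1, ← mul_neg]
  congr 1
  rw [← neg_add, ← integral_add (integrable_mul_of_memLp hX.memLp (hg 0))
    (integrable_mul_of_memLp hY.memLp (hg 1))]
  congr 2
  ext x
  rw [← axisDist_mul_div x (Or.inl rfl : (0 : Fin 3) = 0 ∨ (0 : Fin 3) = 1),
    ← axisDist_mul_div x (Or.inr rfl : (1 : Fin 3) = 0 ∨ (1 : Fin 3) = 1)]
  ring

/-- The same with the rotation field (-y, x)Θ, whose divergence is the azimuthal derivative of Θ,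
that is, multiplication by -im. -/
theorem integral_azimuth (hψ : MemLp ψ 2 volume) (hg : ∀ i, MemLp (g i) 2 volume)
    (hw : ∀ i, HasWeakPartial univ (axis i) ψ (g i)) (hη : IsTest halfPlane η) :
    ∫ p in halfPlane, (-(Complex.I * m) * (η p / (p.1 : ℂ))) * reduced m ψ p
      = -∫ p in halfPlane, η p * reduced m (fun x => ((x 0 / axisDist x : ℝ) : ℂ) * g 1 x
          - ((x 1 / axisDist x : ℝ) : ℂ) * g 0 x) p := by
  have hη' := isTest_div hη
  obtain ⟨Θ, hΘ, hL⟩ := exists_isLift m hη'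
  obtain ⟨hX, dX⟩ := isTest_coord_mul hΘ 0
  obtain ⟨hY, dY⟩ := isTest_coord_mul hΘ 1
  have h0 := (hw 0).integral_test (hψ.restrict _) ((hg 0).restrict _) hY
  have h1 := (hw 1).integral_test (hψ.restrict _) ((hg 1).restrict _) hX
  simp only [Measure.restrict_univ] at h0 h1
  have hD : (fun x : Space => -(x 1 : ℂ) * fderiv ℝ Θ x (axis 0) + x 0 * fderiv ℝ Θ x (axis 1))
      = fun x => fderiv ℝ (fun x : Space => (x 0 : ℂ) * Θ x) x (axis 1)
        - fderiv ℝ (fun x : Space => (x 1 : ℂ) * Θ x) x (axis 0) := by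
    ext x
    rw [dX, dY, if_neg (by decide), if_neg (by decide)]
    ring
  have hL1 := hL.fderiv_azimuth hΘ
  rw [hD] at hL1
  rw [hL1.integral_mul ((hη'.memLp.const_mul _).restrict _)
      ((hX.memLp_fderiv _).1.sub (hY.memLp_fderiv _).1) hψ,
    hL.axisDist_mul.integral_mul (hη.memLp.restrict _)
      ((Complex.continuous_ofReal.comp continuous_axisDist).mul
        hΘ.smooth.continuous).aestronglyMeasurable
      (memLp_azimuth hg)]
  simp only [sub_mul]
  rw [integral_sub (integrable_mul_of_memLp (hX.memLp_fderiv (axis 1)) hψ)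
    (integrable_mul_of_memLp (hY.memLp_fderiv (axis 0)) hψ), h0, h1, ← mul_neg]
  congr 1
  rw [neg_sub_neg, ← neg_sub, ← integral_sub (integrable_mul_of_memLp hX.memLp (hg 1))
    (integrable_mul_of_memLp hY.memLp (hg 0))]
  congr 2
  ext x
  rw [← axisDist_mul_div x (Or.inl rfl : (0 : Fin 3) = 0 ∨ (0 : Fin 3) = 1),
    ← axisDist_mul_div x (Or.inr rfl : (1 : Fin 3) = 0 ∨ (1 : Fin 3) = 1)]
  ring

/-- By `integral_azimuth`, im ω/r and the reduced angular derivative have the same integrals against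
test functions. Division by im is where m ≠ 0 enters; for m = 0 nothing is learnt about ω/r. -/
theorem reduced_div_ae_eq (hm : m ≠ 0) (hψ : MemLp ψ 2 volume) (hg : ∀ i, MemLp (g i) 2 volume)
    (hw : ∀ i, HasWeakPartial univ (axis i) ψ (g i)) :
    (fun p => reduced m ψ p / (p.1 : ℂ)) =ᵐ[volume.restrict halfPlane]
      (Complex.I * m)⁻¹ • reduced m (fun x => ((x 0 / axisDist x : ℝ) : ℂ) * g 1 x
          - ((x 1 / axisDist x : ℝ) : ℂ) * g 0 x) := by
  set k : Space → ℂ := fun x => ((x 0 / axisDist x : ℝ) : ℂ) * g 1 x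
          - ((x 1 / axisDist x : ℝ) : ℂ) * g 0 x with hk
  have hkL : MemLp k 2 volume := memLp_azimuth hg
  have hl : ∀ {f : ℝ × ℝ → ℂ}, MemLp f 2 (volume.restrict halfPlane) →
      LocallyIntegrableOn f halfPlane volume := fun hf =>
    locallyIntegrableOn_of_locallyIntegrable_restrict (hf.locallyIntegrable one_le_two)
  have hc : (Complex.I * m : ℂ) ≠ 0 := mul_ne_zero Complex.I_ne_zero (by exact_mod_cast hm)
  -- Square integrability of ω/r is not yet available, but 1/r is continuous in the open half-plane,
  -- and local integrability there is enough.
  have l1 : LocallyIntegrableOn (fun p : ℝ × ℝ => Complex.I * m / (p.1 : ℂ) * reduced m ψ p)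
      halfPlane volume := by
    refine (hl (memLp_reduced m hψ)).continuousOn_mul (ContinuousOn.div (by fun_prop)
      (by fun_prop) fun p hp => ?_) isOpen_halfPlane.isLocallyClosed
    have : (0 : ℝ) < p.1 := hp
    exact_mod_cast this.ne'
  have key := isOpen_halfPlane.ae_eq_zero_of_integral_contDiff_smul_eq_zero (μ := volume)
    (l1.sub (hl (memLp_reduced m hkL))) ?_
  · rw [Filter.EventuallyEq, ae_restrict_iff' measurableSet_halfPlane]
    filter_upwards [key] with p hp hpΩ
    have := sub_eq_zero.1 (hp hpΩ)
    rw [Pi.smul_apply, ← this, smul_eq_mul]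
    field_simp
  · intro φ h1 h2 h3
    obtain ⟨hη, -⟩ := isTest_ofReal h1 h2 h3
    have i1 : Integrable (fun p => (-(Complex.I * m) * ((φ p : ℂ) / (p.1 : ℂ))) * reduced m ψ p)
        (volume.restrict halfPlane) := integrable_mul_of_memLp
      (((isTest_div hη).memLp.const_mul _).restrict _) (memLp_reduced m hψ)
    have i2 : Integrable (fun p => (φ p : ℂ) * reduced m k p) (volume.restrict halfPlane) :=
      integrable_mul_of_memLp (hη.memLp.restrict _) (memLp_reduced m hkL)
    have h := integral_azimuth (m := m) hψ hg hw hη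
    rw [← setIntegral_eq_integral_of_forall_compl_eq_zero (s := halfPlane) fun p hp => by
      rw [image_eq_zero_of_notMem_tsupport fun h => hp (h3 h), zero_smul]]
    have e : ∀ p : ℝ × ℝ, φ p • ((fun p : ℝ × ℝ => Complex.I * m / (p.1 : ℂ) * reduced m ψ p)
        - reduced m k) p = -((-(Complex.I * m) * ((φ p : ℂ) / (p.1 : ℂ))) * reduced m ψ p)
          - (φ p : ℂ) * reduced m k p := fun p => by
      rw [Complex.real_smul, Pi.sub_apply]
      ring
    simp only [e]
    have i1' : Integrable (fun p => -((-(Complex.I * m) * ((φ p : ℂ) / (p.1 : ℂ))) * reduced m ψ p))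
        (volume.restrict halfPlane) := i1.neg
    rw [integral_sub i1' i2, integral_neg, h]
    ring

end

/-- The reduced components of functions in `H¹(ℝ³)` of nonzero angular momentum. -/
theorem admissible_reduced {m : ℤ} (hm : m ≠ 0) {ψ : Space → ℂ} (h : MemH1Space ψ) :
    Admissible (reduced m ψ) := by
  obtain ⟨hψ, hder⟩ := h
  choose g hg hw using hder
  rw [Measure.restrict_univ] at hψ
  simp only [Measure.restrict_univ] at hg
  have mk : MemLp (fun x => ((x 0 / axisDist x : ℝ) : ℂ) * g 0 x
          + ((x 1 / axisDist x : ℝ) : ℂ) * g 1 x) 2 volume := memLp_radial hg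
  have hh : MemLp (fun p => reduced m ψ p / (p.1 : ℂ)) 2 (volume.restrict halfPlane) :=
    ((memLp_reduced m (memLp_azimuth hg)).const_smul _).ae_eq (reduced_div_ae_eq hm hψ hg hw).symm
  -- The r-derivative is the reduced radial derivative of ψ plus ω/(2r), the latter from
  -- differentiating √r; it is square integrable thanks to the bound on ω/r.
  refine (Admissible.of_hasWeakPartial (memLp_reduced m hψ)
    ((memLp_reduced m mk).add (hh.const_mul (1 / 2))) (memLp_reduced m (hg 2))
    (fun φ h1 h2 h3 => ?_) (fun φ h1 h2 h3 => ?_) hh).1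
  · obtain ⟨hη, dη⟩ := isTest_ofReal h1 h2 h3
    have key := integral_radial (m := m) hψ hg hw hη
    have i1 : Integrable (fun p => (φ p : ℂ) * reduced m (fun x => ((x 0 / axisDist x : ℝ) : ℂ)
        * g 0 x + ((x 1 / axisDist x : ℝ) : ℂ) * g 1 x) p) (volume.restrict halfPlane) :=
      integrable_mul_of_memLp (hη.memLp.restrict _) (memLp_reduced m mk)
    have i2 : Integrable (fun p => (φ p : ℂ) * (1 / 2 * (reduced m ψ p / (p.1 : ℂ))))
        (volume.restrict halfPlane) :=
      integrable_mul_of_memLp (hη.memLp.restrict _) (hh.const_mul (1 / 2))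
    have i3 : Integrable (fun p => fderiv ℝ (fun p => (φ p : ℂ)) p (1, 0) * reduced m ψ p)
        (volume.restrict halfPlane) :=
      integrable_mul_of_memLp ((hη.memLp_fderiv _).restrict _) (memLp_reduced m hψ)
    have e1 : ∀ p : ℝ × ℝ, (fderiv ℝ (fun p => (φ p : ℂ)) p (1, 0)
        + 1 / 2 * ((φ p : ℂ) / (p.1 : ℂ))) * reduced m ψ p
        = fderiv ℝ (fun p => (φ p : ℂ)) p (1, 0) * reduced m ψ p
          + (φ p : ℂ) * (1 / 2 * (reduced m ψ p / (p.1 : ℂ))) := fun p => by ring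
    simp only [e1] at key
    rw [integral_add i3 i2] at key
    simp only [Complex.real_smul, Pi.add_apply, mul_add, ← dη]
    rw [integral_add i1 i2]
    linear_combination key
  · obtain ⟨hη, dη⟩ := isTest_ofReal h1 h2 h3
    simpa only [Complex.real_smul, ← dη] using integral_axial (m := m) hψ hg hw hη

/-! ### The form domain and the abstract criterion -/

theorem MemH1Space.add {ψ ψ' : Space → ℂ} (h : MemH1Space ψ) (h' : MemH1Space ψ') :
    MemH1Space (ψ + ψ') := by
  refine ⟨h.1.add h'.1, fun i => ?_⟩
  obtain ⟨g, hg, hw⟩ := h.2 i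
  obtain ⟨g', hg', hw'⟩ := h'.2 i
  exact ⟨g + g', hg.add hg', hw.add hw' h.1 h'.1 hg hg'⟩

theorem MemH1Space.const_smul {ψ : Space → ℂ} (h : MemH1Space ψ) (c : ℂ) :
    MemH1Space (c • ψ) := by
  refine ⟨h.1.const_smul c, fun i => ?_⟩
  obtain ⟨g, hg, hw⟩ := h.2 i
  exact ⟨c • g, hg.const_smul c, hw.const_smul c⟩

theorem MemH1Space.memLp {ψ : Space → ℂ} (h : MemH1Space ψ) : MemLp ψ 2 volume := by
  simpa only [Measure.restrict_univ] using h.1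

theorem IsTest.memH1Space {Θ : Space → ℂ} (h : IsTest univ Θ) : MemH1Space Θ :=
  ⟨h.memLp.restrict _, fun _ => ⟨_, (h.memLp_fderiv _).restrict _,
    hasWeakPartial_of_contDiff h.smooth _⟩⟩

theorem reduced_const_smul (m : ℤ) (c : ℂ) (ψ : Space → ℂ) :
    reduced m (c • ψ) = c • reduced m ψ := by
  ext p
  have : ∀ φ : ℝ, pull (c • ψ) (p, φ) * Complex.exp (-(Complex.I * m * φ))
      = c * (pull ψ (p, φ) * Complex.exp (-(Complex.I * m * φ))) := fun φ => by
    simp only [pull, Pi.smul_apply, smul_eq_mul]; ring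
  simp only [reduced_eq, this, Pi.smul_apply, smul_eq_mul]
  rw [integral_const_mul]
  ring

theorem ae_integrable_pull (m : ℤ) {ψ : Space → ℂ} (h : MemLp ψ 2 volume) :
    ∀ᵐ p ∂(volume.restrict halfPlane : Measure (ℝ × ℝ)),
      IntegrableOn (fun φ => pull ψ (p, φ) * Complex.exp (-(Complex.I * m * φ)))
        (Ioc 0 (2 * Real.pi)) := by
  have hF := memLp_pull_exp m h
  have hi := (memLp_two_iff_integrable_sq_norm hF.1).1 hF
  filter_upwards [hF.1.prodMk_left, hi.prod_right_ae] with p h1 h2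
  exact ((memLp_two_iff_integrable_sq_norm h1).2 h2).integrable one_le_two

theorem reduced_add (m : ℤ) {ψ ψ' : Space → ℂ} (h : MemLp ψ 2 volume) (h' : MemLp ψ' 2 volume) :
    reduced m (ψ + ψ') =ᵐ[volume.restrict halfPlane] reduced m ψ + reduced m ψ' := by
  filter_upwards [ae_integrable_pull m h, ae_integrable_pull m h'] with p h1 h2
  have : ∀ φ : ℝ, pull (ψ + ψ') (p, φ) * Complex.exp (-(Complex.I * m * φ))
      = pull ψ (p, φ) * Complex.exp (-(Complex.I * m * φ))
        + pull ψ' (p, φ) * Complex.exp (-(Complex.I * m * φ)) := fun φ => by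
    simp only [pull, Pi.add_apply]; ring
  simp only [reduced_eq, this, Pi.add_apply]
  rw [integral_add h1 h2, mul_add]

/-- The form domain as a subspace. -/
def formSubmodule (m : ℤ) : Submodule ℂ L2HalfPlane where
  carrier := formDomain m
  add_mem' := by
    rintro u u' ⟨ψ, h, e⟩ ⟨ψ', h', e'⟩
    refine ⟨ψ + ψ', h.add h', ?_⟩
    filter_upwards [Lp.coeFn_add u u', e, e', reduced_add m h.memLp h'.memLp] with p h1 h2 h3 h4
    rw [h1, h4, Pi.add_apply, Pi.add_apply, h2, h3]
  zero_mem' := by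
    refine ⟨(0 : ℂ) • 0, MemH1Space.const_smul ⟨MemLp.zero, fun i =>
      ⟨0, MemLp.zero, fun φ _ _ _ => by simp⟩⟩ 0, ?_⟩
    filter_upwards [Lp.coeFn_zero ℂ 2 (volume.restrict halfPlane)] with p h1
    rw [h1, reduced_const_smul, zero_smul]
  smul_mem' := by
    rintro c u ⟨ψ, h, e⟩
    refine ⟨c • ψ, h.const_smul c, ?_⟩
    filter_upwards [Lp.coeFn_smul c u, e] with p h1 h2
    rw [h1, reduced_const_smul, Pi.smul_apply, Pi.smul_apply, h2]

theorem admissible_of_mem {m : ℤ} (hm : m ≠ 0) {u : L2HalfPlane} (h : u ∈ formDomain m) :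
    Admissible u := by
  obtain ⟨ψ, hψ, e⟩ := h
  exact ((admissible_reduced hm hψ).congr e.symm).1

/-- The approximate eigenfunctions must lie in the form domain. A lift carries exp(-imφ), so the
lift for -m has angular momentum m, and its reduced component is u up to a nonzero constant that is
scaled away. -/
theorem lp_mem_formDomain (m : ℤ) {u : ℝ × ℝ → ℂ} (hu : IsTest halfPlane u) :
    lp (volume.restrict halfPlane) u ∈ formDomain m := by
  obtain ⟨Θ, hΘ, hL⟩ := exists_isLift (-m) hu
  have hc : (fourierConst * (2 * Real.pi : ℝ) : ℂ) ≠ 0 := by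
    rw [fourierConst, ← Complex.ofReal_mul]
    have : √(2 * Real.pi) / (2 * Real.pi) * (2 * Real.pi) ≠ 0 := by positivity
    exact_mod_cast this
  have key : ∀ p ∈ halfPlane, reduced m Θ p = (fourierConst * (2 * Real.pi : ℝ)) * u p := by
    intro p hp
    have hr : 0 < p.1 := hp
    have hs : ((√p.1 : ℝ) : ℂ) ≠ 0 := by exact_mod_cast (Real.sqrt_pos.2 hr).ne'
    have : ∀ φ : ℝ, pull Θ (p, φ) * Complex.exp (-(Complex.I * m * φ)) = u p := fun φ => by
      have e : Complex.exp (-(Complex.I * ((-m : ℤ) : ℂ) * φ)) * Complex.exp (-(Complex.I * m * φ))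
          = 1 := by
        rw [← Complex.exp_add, ← Complex.exp_zero]
        congr 1
        push_cast
        ring
      simp only [pull, cylMap]
      rw [hL _ _ _ hr]
      rw [div_eq_mul_inv, mul_comm (u _), ← mul_assoc]
      calc _ = ((√p.1 : ℝ) : ℂ) * ((√p.1 : ℝ) : ℂ)⁻¹ *
            (Complex.exp (-(Complex.I * ((-m : ℤ) : ℂ) * φ)) *
              Complex.exp (-(Complex.I * m * φ))) * u p := by ring
        _ = u p := by rw [e, mul_inv_cancel₀ hs, one_mul, one_mul]
    rw [reduced_eq]
    simp only [this]
    rw [setIntegral_const, measureReal_def, Real.volume_Ioc, sub_zero,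
      ENNReal.toReal_ofReal (by positivity), Complex.real_smul]
    ring
  refine ⟨(fourierConst * (2 * Real.pi : ℝ) : ℂ)⁻¹ • Θ, hΘ.memH1Space.const_smul _, ?_⟩
  filter_upwards [coeFn_lp (hu.memLp.restrict halfPlane), ae_restrict_mem measurableSet_halfPlane]
    with p h1 h2
  rw [h1, reduced_const_smul, Pi.smul_apply, key p h2, smul_eq_mul, inv_mul_cancel_left₀ hc]

/-- Conditions under which an operator associated with a form has no discrete spectrum. -/
theorem discreteSpectrum_eq_empty {H : Type*} [NormedAddCommGroup H] [InnerProductSpace ℂ H]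
    [CompleteSpace H] (D : Submodule ℂ H) (a : H → H → ℂ)
    (hadd : ∀ v ∈ D, ∀ u ∈ D, ∀ w ∈ D, a v (u + w) = a v u + a v w)
    (hsmul : ∀ v ∈ D, ∀ u ∈ D, ∀ c : ℂ, a v (c • u) = c * a v u)
    (hherm : ∀ v ∈ D, ∀ u ∈ D, conj (a v u) = a u v)
    {N : H → ℝ} {C C' μ : ℝ} (hC : 0 ≤ C) (hC' : 0 ≤ C')
    (hN : ∀ v ∈ D, N v ^ 2 ≤ C * (a v v).re + C' * ‖v‖ ^ 2)
    (hμ : ∀ v ∈ D, μ * ‖v‖ ^ 2 ≤ (a v v).re)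
    (happrox : ∀ l : ℝ, μ ≤ l → ∀ ε > 0, ∃ u ∈ D, 0 < ‖u‖ ∧
      ∀ v ∈ D, ‖a v u - l * ⟪v, u⟫_ℂ‖ ≤ ε * ‖u‖ * N v) :
    discreteSpectrum (FormOp (D : Set H) a) = ∅ := by
  have hspec : ∀ l : ℝ, μ ≤ l → l ∈ opSpectrum (FormOp (D : Set H) a) := by
    intro l hl hbij
    -- Bijectivity of A - l provides the resolvent R, linear by uniqueness.
    choose R hR huniq using hbij
    have hadd' : ∀ f g, R (f + g) = R f + R g := fun f g => by
      refine (huniq (f + g) _ ⟨D.add_mem (hR f).1 (hR g).1, fun v hv => ?_⟩).symm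
      rw [hadd v hv _ (hR f).1 _ (hR g).1, (hR f).2 v hv, (hR g).2 v hv, ← inner_add_right]
      congr 1
      module
    have hsmul' : ∀ (c : ℂ) f, R (c • f) = c • R f := fun c f => by
      refine (huniq (c • f) _ ⟨D.smul_mem c (hR f).1, fun v hv => ?_⟩).symm
      rw [hsmul v hv _ (hR f).1, (hR f).2 v hv, ← inner_smul_right]
      congr 1
      module
    let T : H →ₗ[ℂ] H := ⟨⟨R, hadd'⟩, hsmul'⟩
    have hform : ∀ f, ∀ v ∈ D, a v (R f) = ⟪v, f⟫_ℂ + l * ⟪v, R f⟫_ℂ := fun f v hv => by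
      rw [(hR f).2 v hv, inner_add_right, inner_smul_right]
    have hsymm : T.IsSymmetric := fun f g => by
      have h1 := hform g (R f) (hR f).1
      have h2 := congrArg conj (hform f (R g) (hR g).1)
      rw [hherm _ (hR g).1 _ (hR f).1, map_add, map_mul, inner_conj_symm, inner_conj_symm,
        Complex.conj_ofReal] at h2
      exact add_right_cancel (h1.symm.trans h2)
    -- Hellinger–Toeplitz: a symmetric operator defined everywhere is bounded.
    let L : H →L[ℂ] H := ⟨T, hsymm.continuous⟩
    set K := ‖L‖ with hK
    have hLK : ∀ f, ‖R f‖ ≤ K * ‖f‖ := fun f => L.le_opNorm f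
    have hK0 : 0 ≤ K := norm_nonneg _
    -- From a(Ru, Ru) = ⟨Ru, u⟩ + l‖Ru‖² and ‖Ru‖ ≤ K‖u‖, this M bounds N(Ru)² by M‖u‖²; as M ≥ 1,
    -- also N(Ru) ≤ M‖u‖.
    set M := 1 + (C * (K + |l| * K ^ 2) + C' * K ^ 2) with hM
    have hM1 : 1 ≤ M := le_add_of_nonneg_right (by positivity)
    obtain ⟨u, hu, hpos, hap⟩ := happrox l hl (1 / (2 * M)) (by positivity)
    have hRu := (hR u).1
    -- The weak equation tested with v = Ru returns ‖u‖², while the approximation makes it at most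
    -- ‖u‖²/2.
    have e1 : a (R u) u - l * ⟪R u, u⟫_ℂ = ((‖u‖ ^ 2 : ℝ) : ℂ) := by
      have h2 := congrArg conj (hform u u hu)
      rw [hherm _ hu _ hRu, map_add, map_mul, inner_conj_symm, inner_conj_symm,
        Complex.conj_ofReal, inner_self_eq_norm_sq_to_K] at h2
      rw [h2]
      push_cast
      simp
    have e2 : N (R u) ^ 2 ≤ M * ‖u‖ ^ 2 := by
      have h1 : (a (R u) (R u)).re ≤ (K + |l| * K ^ 2) * ‖u‖ ^ 2 := by
        rw [hform u _ hRu, inner_self_eq_norm_sq_to_K]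
        have h3 : (⟪R u, u⟫_ℂ).re ≤ K * ‖u‖ * ‖u‖ :=
          (Complex.re_le_norm _).trans ((norm_inner_le_norm _ _).trans
            (mul_le_mul_of_nonneg_right (hLK u) (norm_nonneg _)))
        have h4 : l * ‖R u‖ ^ 2 ≤ |l| * (K * ‖u‖) ^ 2 :=
          mul_le_mul (le_abs_self l) (pow_le_pow_left₀ (norm_nonneg _) (hLK u) 2) (by positivity)
            (abs_nonneg l)
        have h5 : (⟪R u, u⟫_ℂ + l * ((‖R u‖ : ℂ)) ^ 2).re = (⟪R u, u⟫_ℂ).re + l * ‖R u‖ ^ 2 := by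
          rw [Complex.add_re, ← Complex.ofReal_pow, ← Complex.ofReal_mul, Complex.ofReal_re]
        refine h5.le.trans ?_
        nlinarith
      have h2 : ‖R u‖ ^ 2 ≤ K ^ 2 * ‖u‖ ^ 2 := by
        rw [← mul_pow]; exact pow_le_pow_left₀ (norm_nonneg _) (hLK u) 2
      have h3 := mul_le_mul_of_nonneg_left h1 hC
      have h4 := mul_le_mul_of_nonneg_left h2 hC'
      have h5 := hN _ hRu
      have h6 : 0 ≤ ‖u‖ ^ 2 := by positivity
      rw [hM]
      nlinarith
    have e3 : N (R u) ≤ M * ‖u‖ := by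
      refine le_of_sq_le_sq ?_ (by positivity)
      rw [mul_pow]
      refine e2.trans (mul_le_mul_of_nonneg_right ?_ (by positivity))
      nlinarith
    have e4 := hap _ hRu
    rw [e1, Complex.norm_real, Real.norm_eq_abs, abs_of_nonneg (by positivity)] at e4
    have e5 : 1 / (2 * M) * ‖u‖ * N (R u) ≤ 1 / (2 * M) * ‖u‖ * (M * ‖u‖) :=
      mul_le_mul_of_nonneg_left e3 (by positivity)
    have e6 : 1 / (2 * M) * ‖u‖ * (M * ‖u‖) = ‖u‖ ^ 2 / 2 := by field_simp
    have : 0 < ‖u‖ ^ 2 := by positivity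
    linarith
  refine eq_empty_of_forall_notMem fun l hl => ?_
  obtain ⟨-, ⟨ε, hε, hiso⟩, ⟨u, hu0, hu⟩, -⟩ := hl
  have hle : μ ≤ l := by
    have h1 := hμ u hu.1
    rw [hu.2 u hu.1, inner_smul_right, inner_self_eq_norm_sq_to_K] at h1
    have h2 : (l * ((‖u‖ : ℂ)) ^ 2).re = l * ‖u‖ ^ 2 := by
      rw [← Complex.ofReal_pow, ← Complex.ofReal_mul, Complex.ofReal_re]
    have h3 : 0 < ‖u‖ ^ 2 := by have := norm_pos_iff.2 hu0; positivity
    exact le_of_mul_le_mul_right (h1.trans h2.le) h3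
  -- Points just above the eigenvalue are spectral too, so it is not isolated; finite multiplicity
  -- plays no role.
  have := hiso (l + ε / 2) (hspec _ (by linarith)) (by
    rw [add_sub_cancel_left, abs_of_pos (by linarith)]; linarith)
  linarith

/-! ### The partial-wave operator -/

section Form

variable {α V₀ θ : ℝ} {m : ℤ} {v ω ω' : ℝ × ℝ → ℂ}

theorem lp_eq_add {X : Type*} [MeasurableSpace X] {ν : Measure X} {f g h : X → ℂ}
    (hg : MemLp g 2 ν) (hh : MemLp h 2 ν) (e : f =ᵐ[ν] g + h) : lp ν f = lp ν g + lp ν h := by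
  rw [lp_congr e, lp_add hg hh]

theorem lp_eq_const_smul {X : Type*} [MeasurableSpace X] {ν : Measure X} {f g : X → ℂ}
    (hg : MemLp g 2 ν) {c : ℂ} (e : f =ᵐ[ν] c • g) : lp ν f = c • lp ν g := by
  rw [lp_congr e, lp_const_smul hg]

theorem qmSesq_congr_right (hV₀ : 0 < V₀) (hθ : 0 < Real.sin θ) (hv : Admissible v)
    (h : Admissible ω) (e : ω =ᵐ[volume.restrict halfPlane] ω') :
    qmSesq α V₀ θ m v ω' = qmSesq α V₀ θ m v ω := by
  obtain ⟨h', er, ez⟩ := h.congr e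
  rw [qmSesq_eq hV₀ hθ m hv h, qmSesq_eq hV₀ hθ m hv h', lp_congr er, lp_congr ez,
    lp_congr (h.trace_congr hθ e), lp_congr (e.mono fun p hp => by
      simp only; rw [hp] : (fun p => ω p / (p.1 : ℂ)) =ᵐ[volume.restrict halfPlane]
        fun p => ω' p / (p.1 : ℂ)),
    lp_congr (e.mono fun p hp => by
      simp only; rw [hp] : (fun p => (biasRZ V₀ θ p : ℂ) * ω p) =ᵐ[volume.restrict halfPlane]
        fun p => (biasRZ V₀ θ p : ℂ) * ω' p)]

theorem qmSesq_add_right (hV₀ : 0 < V₀) (hθ : 0 < Real.sin θ) (hv : Admissible v)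
    (h : Admissible ω) (h' : Admissible ω') :
    qmSesq α V₀ θ m v (ω + ω') = qmSesq α V₀ θ m v ω + qmSesq α V₀ θ m v ω' := by
  obtain ⟨ha, er, ez⟩ := h.add h'
  rw [qmSesq_eq hV₀ hθ m hv h, qmSesq_eq hV₀ hθ m hv h', qmSesq_eq hV₀ hθ m hv ha,
    lp_eq_add h.dr_spec.1 h'.dr_spec.1 er, lp_eq_add h.dz_spec.1 h'.dz_spec.1 ez,
    lp_eq_add (h.memLp_trace hθ) (h'.memLp_trace hθ) (h.trace_add h' hθ),
    lp_eq_add (f := fun p => (ω + ω') p / (p.1 : ℂ)) h.hardy h'.hardy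
      (ae_of_all _ fun p => by simp [add_div]),
    lp_eq_add (f := fun p => (biasRZ V₀ θ p : ℂ) * (ω + ω') p) (memLp_bias (θ := θ) hV₀ h.memLp)
      (memLp_bias (θ := θ) hV₀ h'.memLp) (ae_of_all _ fun p => by simp [mul_add])]
  simp only [inner_add_right]
  ring

theorem qmSesq_const_smul_right (hV₀ : 0 < V₀) (hθ : 0 < Real.sin θ) (hv : Admissible v)
    (h : Admissible ω) (c : ℂ) :
    qmSesq α V₀ θ m v (c • ω) = c * qmSesq α V₀ θ m v ω := by
  obtain ⟨ha, er, ez⟩ := h.const_smul c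
  rw [qmSesq_eq hV₀ hθ m hv h, qmSesq_eq hV₀ hθ m hv ha,
    lp_eq_const_smul h.dr_spec.1 er, lp_eq_const_smul h.dz_spec.1 ez,
    lp_eq_const_smul (h.memLp_trace hθ) (h.trace_const_smul hθ c),
    lp_eq_const_smul (c := c) (f := fun p => (c • ω) p / (p.1 : ℂ)) h.hardy
      (ae_of_all _ fun p => by simp [mul_div_assoc]),
    lp_eq_const_smul (c := c) (f := fun p => (biasRZ V₀ θ p : ℂ) * (c • ω) p)
      (memLp_bias (θ := θ) hV₀ h.memLp)
      (ae_of_all _ fun p => by simp [mul_left_comm])]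
  simp only [inner_smul_right]
  ring

theorem conj_qmSesq (α V₀ θ : ℝ) (m : ℤ) (v ω : ℝ × ℝ → ℂ) :
    conj (qmSesq α V₀ θ m v ω) = qmSesq α V₀ θ m ω v := by
  simp only [qmSesq, map_add, map_sub, map_mul, ← integral_conj, Complex.conj_ofReal,
    Complex.conj_conj, mul_comm]

end Form

theorem discreteSpectrum_partialWaveOp {α V₀ θ : ℝ} (hα : 0 < α) (hV₀ : 0 < V₀)
    (hθ : 0 < Real.sin θ) {m : ℤ} (hm : m ≠ 0) :
    discreteSpectrum (partialWaveOp α V₀ θ m) = ∅ := by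
  have hD : ∀ {u : L2HalfPlane}, u ∈ formSubmodule m → Admissible u := fun hu =>
    admissible_of_mem hm hu
  refine discreteSpectrum_eq_empty (formSubmodule m) (fun v ω => qmSesq α V₀ θ m v ω)
    (N := fun v => ‖lp (volume.restrict halfPlane) v‖ + ‖lp (volume.restrict halfPlane) (dr v)‖
      + ‖lp (volume.restrict halfPlane) (dz v)‖)
    -- From (x + y + z)² ≤ 3(x² + y² + z²) and the gradient bound y² + z² ≤ 2q - μ(2α)x², where
    -- μ(2α) is the threshold at doubled coupling.
    (C := 6) (C' := 3 * (1 - threshold (2 * α) V₀)) (μ := threshold α V₀)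
    (fun v hv u hu w hw => ?_) (fun v hv u hu c => ?_) (fun v _ u _ => conj_qmSesq α V₀ θ m v u)
    (by norm_num) (by linarith [threshold_nonpos (2 * α) V₀]) (fun v hv => ?_) (fun v hv => ?_)
    (fun l hl ε hε => ?_)
  · rw [← qmSesq_add_right hV₀ hθ (hD hv) (hD hu) (hD hw)]
    exact qmSesq_congr_right hV₀ hθ (hD hv) ((hD hu).add (hD hw)).1 (Lp.coeFn_add u w).symm
  · rw [← qmSesq_const_smul_right hV₀ hθ (hD hv) (hD hu) c]
    exact qmSesq_congr_right hV₀ hθ (hD hv) ((hD hu).const_smul c).1 (Lp.coeFn_smul c u).symm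
  · have h := ((hD hv).norm_gradient_le hα hV₀ hθ hm).2
    simp only [lp_coeFn] at h ⊢
    rw [qmSesq_self, Complex.ofReal_re]
    set x := ‖v‖
    set y := ‖lp (volume.restrict halfPlane) (dr v)‖
    set z := ‖lp (volume.restrict halfPlane) (dz v)‖
    nlinarith [sq_nonneg (x - y), sq_nonneg (y - z), sq_nonneg (x - z)]
  · have h := ((hD hv).norm_gradient_le hα hV₀ hθ hm).1
    simp only [lp_coeFn] at h ⊢
    rwa [qmSesq_self, Complex.ofReal_re]
  · obtain ⟨u, hu, hpos, H⟩ := exists_approximate_form hα hV₀ hθ m hl hε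
    have hum := lp_mem_formDomain m hu
    refine ⟨lp (volume.restrict halfPlane) u, hum, hpos, fun v hv => ?_⟩
    have h1 := H v (hD hv)
    have e := qmSesq_congr_right (α := α) (m := m) hV₀ hθ (hD hv) hu.admissible.1
      (coeFn_lp (hu.memLp.restrict halfPlane)).symm
    simp only [e]
    rw [lp_coeFn] at h1 ⊢
    exact h1

end ConicalSurface

theorem proposition5p1 (α V₀ θ : ℝ) (hα : 0 < α) (hV₀ : 0 < V₀)
    (hθ : θ ∈ Set.Ioo 0 (Real.pi / 2)) (m : ℤ) (hm : m ≠ 0) :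
    (∀ ψ : ConicalSurface.Space → ℂ, ConicalSurface.MemH1Space ψ →
      -- all terms of `q_m` are finite on the reduced component of `ψ`
      ConicalSurface.MemH1HalfPlane (ConicalSurface.reduced m ψ) ∧
      MeasureTheory.IntegrableOn (fun p => ‖ConicalSurface.reduced m ψ p‖ ^ 2 / p.1 ^ 2)
        ConicalSurface.halfPlane ∧
      (∃ τ, ConicalSurface.IsTrace θ (ConicalSurface.reduced m ψ) τ) ∧
      -- the lower bound
      ConicalSurface.threshold α V₀ *
          (∫ p in ConicalSurface.halfPlane, ‖ConicalSurface.reduced m ψ p‖ ^ 2) ≤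
        ConicalSurface.qm α V₀ θ m (ConicalSurface.reduced m ψ)) ∧
    -- the component does not produce discrete spectrum
    ConicalSurface.discreteSpectrum (ConicalSurface.partialWaveOp α V₀ θ m) = ∅ := by
  have hs : 0 < Real.sin θ := Real.sin_pos_of_pos_of_lt_pi hθ.1 (by linarith [hθ.2, Real.pi_pos])
  refine ⟨fun ψ hψ => ?_, ConicalSurface.discreteSpectrum_partialWaveOp hα hV₀ hs hm⟩
  have h := ConicalSurface.admissible_reduced hm hψ
  refine ⟨h.memH1, ?_, h.exists_isTrace hs, ?_⟩
  · refine ((memLp_two_iff_integrable_sq_norm h.hardy.1).1 h.hardy).congr (ae_of_all _ fun p => ?_)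
    simp only [norm_div, Complex.norm_real, div_pow, Real.norm_eq_abs, sq_abs]
  · rw [← ConicalSurface.norm_lp_sq h.memLp]
    exact (h.norm_gradient_le hα hV₀ hs hm).1
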